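/- A ceer is a computably enumerable equivalence relation on $\mathbb{N}$. For equivalence relations $R,S$ on $\mathbb{N}$ write $R\le S$ if there is a computable $f$ with $x\,R\,y \Leftrightarrow f(x)\,S\,f(y)$ for all $x,y$; let $R\oplus S$ be the relation that copies $R$ on the even numbers and $S$ on the odd numbers, let $\mathrm{Id}$ be equality on $\mathbb{N}$, and for $k\ge 1$ let $\mathrm{Id}_k$ be congruence modulo $k$ (with $S\oplus \mathrm{Id}_0:=S$). Write $R\le_{\mathcal I}S$ if $R\le S\oplus\mathrm{Id}_k$ for some $k\ge 0$. The $\mathcal I$-degrees are the classes of ceers modulo the equivalence relation induced by $\le_{\mathcal I}$, partially ordered by $\le_{\mathcal I}$; $\mathbf{Id}$ is the $\mathcal I$-degree of $\mathrm{Id}$. A ceer $R$ is light if there is an infinite c.e. set of pairwise $R$-inequivalent numbers; a light $\mathcal I$-degree is the $\mathcal I$-degree of a light ceer. A light $\mathcal I$-degree $\mathbf e$ is light minimal if $\mathbf{Id}<_{\mathcal I}\mathbf e$ and no $\mathcal I$-degree lies strictly between $\mathbf{Id}$ and $\mathbf e$. A light $\mathcal I$-degree $\mathbf a$ is a light $\mathcal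 I$-strongly minimal cover of two incomparable light minimal degrees $\mathbf d,\mathbf e$ if $\mathbf d,\mathbf e<_{\mathcal I}\mathbf a$ and every light $\mathcal I$-degree $<_{\mathcal I}\mathbf a$ is $\mathbf d$, $\mathbf e$ or $\mathbf{Id}$. For an $\mathcal I$-degree $\mathbf c$ let $H_{\mathbf c}$ be the graph whose vertices are the light minimal degrees $\le_{\mathcal I}\mathbf c$, with an edge between $\mathbf d$ and $\mathbf e$ if and only if there are two incomparable $\mathcal I$-degrees $\mathbf a,\mathbf b\le_{\mathcal I}\mathbf c$ which are both light $\mathcal I$-strongly minimal covers of $\mathbf d,\mathbf e$. Corollary. For every computable graph $G$ (simple and undirected, with a computable vertex set $V\subseteq\mathbb{N}$ and a computable edge relation) there is a light $\mathcal I$-degree $\mathbf c$ such that $H_{\mathbf c}$ is isomorphic to the disjoint union of $G$ with a nonempty graph which has no edges. -/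

import Mathlib

namespace CeerDegrees

/-- A ceer: an equivalence relation on `ℕ` which is computably enumerable as a set of pairs. -/
structure Ceer where
  rel : Setoid ℕ
  ce : REPred fun p : ℕ × ℕ => rel p.1 p.2

/-- Computable reducibility `R ≤ S` of equivalence relations on `ℕ`. -/
def Reducible (R S : Setoid ℕ) : Prop :=
  ∃ f : ℕ → ℕ, Computable f ∧ ∀ x y, R x y ↔ S (f x) (f y)

/-- The uniform join `R ⊕ S`: `R` on the even numbers and `S` on the odd numbers. -/
def join (R S : Setoid ℕ) : Setoid ℕ where
  r x y := (∃ u v, x = 2 * u ∧ y = 2 * v ∧ R u v) ∨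
    (∃ u v, x = 2 * u + 1 ∧ y = 2 * v + 1 ∧ S u v)
  iseqv := by
    refine ⟨fun x => ?_, ?_, ?_⟩
    · rcases Nat.even_or_odd' x with ⟨u, rfl | rfl⟩
      · exact Or.inl ⟨u, u, rfl, rfl, R.refl' u⟩
      · exact Or.inr ⟨u, u, rfl, rfl, S.refl' u⟩
    · rintro x y (⟨u, v, hx, hy, h⟩ | ⟨u, v, hx, hy, h⟩)
      · exact Or.inl ⟨v, u, hy, hx, R.symm' h⟩
      · exact Or.inr ⟨v, u, hy, hx, S.symm' h⟩
    · rintro x y z (⟨u, v, hx, hy, h⟩ | ⟨u, v, hx, hy, h⟩)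
        (⟨u', v', hx', hy', h'⟩ | ⟨u', v', hx', hy', h'⟩)
      · obtain rfl : v = u' := by omega
        exact Or.inl ⟨u, v', hx, hy', R.trans' h h'⟩
      · omega
      · omega
      · obtain rfl : v = u' := by omega
        exact Or.inr ⟨u, v', hx, hy', S.trans' h h'⟩

/-- `Id_n`: congruence modulo `n`; it has exactly `n` classes if `n ≥ 1`. -/
def idMod (n : ℕ) : Setoid ℕ where
  r x y := x ≡ y [MOD n]
  iseqv := ⟨fun x => Nat.ModEq.refl x, fun h => h.symm, fun h h' => h.trans h'⟩

/-- `S ⊕ Id_k`, with the convention `S ⊕ Id_0 = S`. -/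
def joinId (S : Setoid ℕ) : ℕ → Setoid ℕ
  | 0 => S
  | k + 1 => join S (idMod (k + 1))

/-- `R ≤_I S`: reducibility modulo uniform joins with finite ceers. -/
def ReducibleI (R S : Setoid ℕ) : Prop :=
  ∃ k, Reducible R (joinId S k)

section helpers

theorem join_even (R S : Setoid ℕ) (u v : ℕ) : join R S (2 * u) (2 * v) ↔ R u v := by
  constructor
  · rintro (⟨a, b, ha, hb, h⟩ | ⟨a, b, ha, hb, h⟩)
    · obtain rfl : u = a := by omega
      obtain rfl : v = b := by omega
      exact h
    · omega
  · exact fun h => Or.inl ⟨u, v, rfl, rfl, h⟩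

theorem join_odd (R S : Setoid ℕ) (u v : ℕ) :
    join R S (2 * u + 1) (2 * v + 1) ↔ S u v := by
  constructor
  · rintro (⟨a, b, ha, hb, h⟩ | ⟨a, b, ha, hb, h⟩)
    · omega
    · obtain rfl : u = a := by omega
      obtain rfl : v = b := by omega
      exact h
  · exact fun h => Or.inr ⟨u, v, rfl, rfl, h⟩

theorem not_join_even_odd (R S : Setoid ℕ) (u v : ℕ) : ¬ join R S (2 * u) (2 * v + 1) := by
  rintro (⟨a, b, ha, hb, h⟩ | ⟨a, b, ha, hb, h⟩) <;> omega

theorem not_join_odd_even (R S : Setoid ℕ) (u v : ℕ) : ¬ join R S (2 * u + 1) (2 * v) := by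
  rintro (⟨a, b, ha, hb, h⟩ | ⟨a, b, ha, hb, h⟩) <;> omega

theorem Reducible.refl (R : Setoid ℕ) : Reducible R R := ⟨id, Computable.id, fun _ _ => Iff.rfl⟩

theorem Reducible.trans {R S T : Setoid ℕ} (h : Reducible R S) (h' : Reducible S T) :
    Reducible R T := by
  obtain ⟨f, hf, hfr⟩ := h
  obtain ⟨g, hg, hgr⟩ := h'
  exact ⟨fun x => g (f x), hg.comp hf, fun x y => (hfr x y).trans (hgr _ _)⟩

theorem ReducibleI.refl (R : Setoid ℕ) : ReducibleI R R := ⟨0, Reducible.refl R⟩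

theorem reducible_join_left (R S : Setoid ℕ) : Reducible R (join R S) :=
  ⟨fun x => 2 * x,
    (Primrec.nat_mul.comp (Primrec.const 2) Primrec.id).to_comp,
    fun x y => (join_even R S x y).symm⟩

theorem ReducibleI.exists_succ {R S : Setoid ℕ} (h : ReducibleI R S) :
    ∃ k, Reducible R (join S (idMod (k + 1))) := by
  obtain ⟨_ | k, h⟩ := h
  · exact ⟨0, Reducible.trans h (reducible_join_left _ _)⟩
  · exact ⟨k, h⟩

/-- `(T ⊕ Id_m) ⊕ Id_k ≤ T ⊕ Id_{m + k}`. -/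
theorem reducible_join_join (T : Setoid ℕ) (m k : ℕ) :
    Reducible (join (join T (idMod (m + 1))) (idMod (k + 1))) (join T (idMod (m + k + 2))) := by
  refine ⟨fun x => if x % 2 = 0 then
      (if x / 2 % 2 = 0 then x / 2 else 2 * (x / 2 / 2 % (m + 1)) + 1)
      else 2 * (m + 1 + x / 2 % (k + 1)) + 1, ?_, ?_⟩
  · have half : Primrec fun x : ℕ => x / 2 := Primrec.nat_div.comp Primrec.id (Primrec.const 2)
    have even : ∀ {f : ℕ → ℕ}, Primrec f → PrimrecPred fun x => f x % 2 = 0 := fun hf =>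
      Primrec.eq.comp (Primrec.nat_mod.comp hf (Primrec.const 2)) (Primrec.const 0)
    have odd : ∀ {f : ℕ → ℕ}, Primrec f → Primrec fun x => 2 * f x + 1 := fun hf =>
      Primrec.succ.comp (Primrec.nat_mul.comp (Primrec.const 2) hf)
    refine Primrec.to_comp (Primrec.ite (even Primrec.id) (Primrec.ite (even half) half
      (odd (Primrec.nat_mod.comp (Primrec.nat_div.comp half (Primrec.const 2))
        (Primrec.const (m + 1)))))
      (odd (Primrec.nat_add.comp (Primrec.const (m + 1))
        (Primrec.nat_mod.comp half (Primrec.const (k + 1))))))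
  · have key : ∀ a b, a < m + k + 2 → b < m + k + 2 →
        (join T (idMod (m + k + 2)) (2 * a + 1) (2 * b + 1) ↔ a = b) := by
      intro a b ha hb
      rw [join_odd]
      change a % (m + k + 2) = b % (m + k + 2) ↔ a = b
      rw [Nat.mod_eq_of_lt ha, Nat.mod_eq_of_lt hb]
    have e1 : ∀ u : ℕ, 2 * u % 2 = 0 := fun u => by omega
    have e2 : ∀ u : ℕ, 2 * u / 2 = u := fun u => by omega
    have o1 : ∀ u : ℕ, (2 * u + 1) % 2 = 1 := fun u => by omega
    have o2 : ∀ u : ℕ, (2 * u + 1) / 2 = u := fun u => by omega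
    have lm : ∀ u : ℕ, u % (m + 1) < m + 1 := fun u => Nat.mod_lt _ (by omega)
    have lk : ∀ u : ℕ, u % (k + 1) < k + 1 := fun u => Nat.mod_lt _ (by omega)
    intro x y
    rcases Nat.even_or_odd' x with ⟨a, rfl | rfl⟩ <;>
      rcases Nat.even_or_odd' y with ⟨b, rfl | rfl⟩
    · rw [join_even]
      rcases Nat.even_or_odd' a with ⟨c, rfl | rfl⟩ <;>
        rcases Nat.even_or_odd' b with ⟨d, rfl | rfl⟩
      · simp only [e1, e2, if_true, join_even]
      · simp only [e1, e2, o1, o2, if_true, one_ne_zero, if_false, not_join_even_odd]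
      · simp only [e1, e2, o1, o2, if_true, one_ne_zero, if_false, not_join_odd_even]
      · simp only [e1, e2, o1, o2, if_true, one_ne_zero, if_false]
        have hc := lm c
        have hd := lm d
        rw [join_odd, key _ _ (by omega) (by omega)]
        rfl
    · simp only [e1, e2, o1, o2, if_true, one_ne_zero, if_false, not_join_even_odd, false_iff]
      rcases Nat.even_or_odd' a with ⟨c, rfl | rfl⟩
      · simp only [e1, if_true, not_join_even_odd, not_false_eq_true]
      · have hc := lm c
        have hb := lk b
        simp only [o1, o2, one_ne_zero, if_false]
        rw [key _ _ (by omega) (by omega)]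
        omega
    · simp only [e1, e2, o1, o2, if_true, one_ne_zero, if_false, not_join_odd_even, false_iff]
      rcases Nat.even_or_odd' b with ⟨c, rfl | rfl⟩
      · simp only [e1, if_true, not_join_odd_even, not_false_eq_true]
      · have hc := lm c
        have ha := lk a
        simp only [o1, o2, one_ne_zero, if_false]
        rw [key _ _ (by omega) (by omega)]
        omega
    · simp only [o1, o2, one_ne_zero, if_false]
      have ha := lk a
      have hb := lk b
      rw [join_odd, key _ _ (by omega) (by omega)]
      change a % (k + 1) = b % (k + 1) ↔ _
      omega

theorem Reducible.join_right {R S : Setoid ℕ} (h : Reducible R S) (F : Setoid ℕ) :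
    Reducible (join R F) (join S F) := by
  obtain ⟨f, hf, hfr⟩ := h
  refine ⟨fun x => bif x % 2 == 0 then 2 * f (x / 2) else x, ?_, ?_⟩
  · exact Computable.cond
      (Primrec.beq.comp (Primrec.nat_mod.comp Primrec.id (Primrec.const 2))
        (Primrec.const 0)).to_comp
      (Primrec.nat_mul.to_comp.comp (Computable.const 2)
        (hf.comp (Primrec.nat_div.comp Primrec.id (Primrec.const 2)).to_comp))
      Computable.id
  · have e1 : ∀ u : ℕ, 2 * u % 2 = 0 := fun u => by omega
    have e2 : ∀ u : ℕ, 2 * u / 2 = u := fun u => by omega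
    have o1 : ∀ u : ℕ, (2 * u + 1) % 2 = 1 := fun u => by omega
    intro x y
    rcases Nat.even_or_odd' x with ⟨a, rfl | rfl⟩ <;>
      rcases Nat.even_or_odd' y with ⟨b, rfl | rfl⟩ <;>
      simp [e1, e2, o1, join_even, join_odd, not_join_even_odd, not_join_odd_even, hfr]

theorem ReducibleI.trans {R S T : Setoid ℕ} (h : ReducibleI R S) (h' : ReducibleI S T) :
    ReducibleI R T := by
  obtain ⟨k, hk⟩ := h.exists_succ
  obtain ⟨m, hm⟩ := h'.exists_succ
  exact ⟨m + k + 2, (hk.trans (hm.join_right _)).trans (reducible_join_join T m k)⟩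

end helpers

instance : Preorder Ceer where
  le R S := ReducibleI R.rel S.rel
  le_refl R := ReducibleI.refl R.rel
  le_trans _ _ _ h h' := h.trans h'

/-- The `I`-degrees of ceers: ceers modulo `≡_I`, partially ordered by `≤_I`. -/
abbrev IDegree : Type := Antisymmetrization Ceer (· ≤ ·)

/-- The `I`-degree of a ceer. -/
def degI (R : Ceer) : IDegree := toAntisymmetrization (· ≤ ·) R

/-- The identity ceer `Id`. -/
def idCeer : Ceer where
  rel := ⊥
  ce := by
    refine ComputablePred.to_re ⟨fun p => inferInstanceAs (Decidable (p.1 = p.2)), ?_⟩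
    exact (Primrec.eq.comp Primrec.fst Primrec.snd).decide.to_comp

/-- A ceer is light if it has an infinite c.e. transversal, i.e. an infinite c.e. set of pairwise
inequivalent numbers. -/
def Ceer.IsLight (R : Ceer) : Prop :=
  ∃ W : Set ℕ, W.Infinite ∧ (REPred fun x => x ∈ W) ∧
    ∀ x ∈ W, ∀ y ∈ W, x ≠ y → ¬ R.rel x y

/-- A light `I`-degree: the `I`-degree of a light ceer. -/
def IDegree.IsLight (d : IDegree) : Prop := ∃ R : Ceer, R.IsLight ∧ degI R = d

/-- A light `I`-degree is light minimal if it lies strictly above the degree of `Id`, with nothing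
strictly in between. -/
def IsLightMinimal (e : IDegree) : Prop :=
  IDegree.IsLight e ∧ degI idCeer < e ∧ ∀ x : IDegree, ¬ (degI idCeer < x ∧ x < e)

/-- `a` is a light `I`-strongly minimal cover of the pair of incomparable light minimal degrees
`d`, `e`: it lies above both, and the only light degrees strictly below it are `d`, `e` and the
degree of `Id`. -/
def IsLightStronglyMinimalCover (a d e : IDegree) : Prop :=
  IDegree.IsLight a ∧ IncompRel (· ≤ ·) d e ∧ d < a ∧ e < a ∧
    ∀ x : IDegree, IDegree.IsLight x → x < a → x = d ∨ x = e ∨ x = degI idCeer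

/-- The vertices of `H_c`: the light minimal degrees below `c`. -/
abbrev LightVertex (c : IDegree) : Type := {d : IDegree // IsLightMinimal d ∧ d ≤ c}

/-- The graph `H_c`: two light minimal degrees below `c` are adjacent if there are two incomparable
`I`-degrees below `c` which are both light `I`-strongly minimal covers of them. -/
def lightGraph (c : IDegree) : SimpleGraph (LightVertex c) where
  Adj d e := ∃ a b : IDegree, a ≤ c ∧ b ≤ c ∧ IncompRel (· ≤ ·) a b ∧
    IsLightStronglyMinimalCover a d e ∧ IsLightStronglyMinimalCover b d e
  symm := by
    have aux : ∀ {a d e : IDegree}, IsLightStronglyMinimalCover a d e →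
        IsLightStronglyMinimalCover a e d := by
      rintro a d e ⟨ha, hde, hd, he, h⟩
      exact ⟨ha, hde.symm, he, hd, fun x hx hxa => or_left_comm.1 (h x hx hxa)⟩
    exact ⟨fun d e ⟨a, b, ha, hb, hab, h, h'⟩ => ⟨a, b, ha, hb, hab, aux h, aux h'⟩⟩
  loopless := ⟨fun d ⟨_, _, _, _, _, h, _⟩ => h.2.1.1 le_rfl⟩

/-- A graph whose vertex set `V` is a set of natural numbers is computable if both `V` and the
edge relation are computable. -/
def IsComputableGraph {V : Set ℕ} (G : SimpleGraph V) : Prop :=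
  (ComputablePred fun x : ℕ => x ∈ V) ∧
    ComputablePred fun p : ℕ × ℕ => ∃ (h₁ : p.1 ∈ V) (h₂ : p.2 ∈ V), G.Adj ⟨p.1, h₁⟩ ⟨p.2, h₂⟩

end CeerDegrees

/-! ### Computability toolkit -/

-- The starting point is a c.e. equivalence relation `R` on `ℕ`, viewed as a sequence of columns and
-- generic for c.e. sets of requests of the form "merge these pairs, but keep some pair of each of
-- these clauses apart" (`IsGeneric`; a finite injury construction gives `exists_isGeneric`). Every
-- column has infinitely many classes, and a c.e. subset of a column meets finitely many classes or
-- all of them (`IsGeneric.finite_or_full`).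
--
-- From `R` and a computable graph `E` on `ℕ` a ceer `C` is built. The even numbers are singletons
-- and supply a copy of `Id`. For each `q = ⟨c, d⟩` there is a block with a side carrying column `c`
-- and a side carrying column `d`; if `E c d`, the two sides are glued at their base points. The
-- required degree is that of `C`. Finite summands are absorbed by the even numbers, so a ceer below
-- `C` is literally a pullback of `C` along a computable `φ` (`exists_pull_of_reducibleI`), and it
-- has light degree iff `φ` reaches arbitrarily late blocks (`isLight_deg_iff`).
--
-- If such a `φ` meets all classes of a side carrying `c`, then `vdeg c`, the degree of column `c`
-- plus `Id`, lies below it. The degrees `vdeg c` are light minimal and pairwise incomparable. For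
-- `c ≠ d` the strongly minimal covers of `vdeg c` and `vdeg d` below the top are the degrees of two
-- sides of these types plus `Id` (`isCover_sideDeg`, `eq_sideDeg_of_isCover`). All unglued pairs of
-- sides give one degree (`sideDeg_congr`); a glued pair exists only if `c` and `d` are
-- `E`-adjacent, and its degree is incomparable with the unglued one (`incompRel_sideDeg`). Hence
-- the edges between column degrees are those of `E`.
--
-- If `φ` meets all classes of no side, it meets finitely many classes on each. An infinite family
-- of pairs with independent, undecided equivalence would split into two incomparable light parts
-- (`Separated.exists_incomparable`), so minimality excludes it. Without such a family, the pullback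
-- is either decidable or lies above some `ydeg a`, which codes the `R`-class of `a` by pairs in
-- distinct blocks (`computable_of_bounded`, `reducible_ymap`). Thus the remaining light minimal
-- degrees are of the form `ydeg a`. The position of the coding pairs is irrelevant, so any two
-- degrees above `ydeg a` and a second light minimal degree `e` have a common lower bound still
-- above both; two covers of the pair then coincide, and `ydeg a` is an isolated vertex
-- (`not_incompRel_of_isCover`).

attribute [fun_prop] Computable
attribute [fun_prop] REPred
attribute [fun_prop] ComputablePred

namespace CeerDegrees

section toolkit

variable {α β γ σ : Type} [Primcodable α] [Primcodable β] [Primcodable γ] [Primcodable σ]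

@[fun_prop] theorem computable_id : Computable (fun x : α => x) := Computable.id

@[fun_prop] theorem computable_const (b : β) : Computable (fun _ : α => b) := Computable.const b

@[fun_prop] theorem computable_comp {f : β → γ} {g : α → β} (hf : Computable f)
    (hg : Computable g) : Computable (fun x => f (g x)) := hf.comp hg

@[fun_prop] theorem computable_pair {f : α → β} {g : α → γ} (hf : Computable f)
    (hg : Computable g) : Computable (fun x => (f x, g x)) := hf.pair hg

@[fun_prop] theorem computable_fst {f : α → β × γ} (hf : Computable f) :
    Computable (fun x => (f x).1) := Computable.fst.comp hf

@[fun_prop] theorem computable_snd {f : α → β × γ} (hf : Computable f) :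
    Computable (fun x => (f x).2) := Computable.snd.comp hf

@[fun_prop] theorem computable_add {f g : α → ℕ} (hf : Computable f) (hg : Computable g) :
    Computable (fun x => f x + g x) := Primrec.nat_add.to_comp.comp hf hg

@[fun_prop] theorem computable_sub {f g : α → ℕ} (hf : Computable f) (hg : Computable g) :
    Computable (fun x => f x - g x) := Primrec.nat_sub.to_comp.comp hf hg

@[fun_prop] theorem computable_mul {f g : α → ℕ} (hf : Computable f) (hg : Computable g) :
    Computable (fun x => f x * g x) := Primrec.nat_mul.to_comp.comp hf hg

@[fun_prop] theorem computable_div {f g : α → ℕ} (hf : Computable f) (hg : Computable g) :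
    Computable (fun x => f x / g x) := Primrec.nat_div.to_comp.comp hf hg

@[fun_prop] theorem computable_mod {f g : α → ℕ} (hf : Computable f) (hg : Computable g) :
    Computable (fun x => f x % g x) := Primrec.nat_mod.to_comp.comp hf hg

@[fun_prop] theorem computable_natPair {f g : α → ℕ} (hf : Computable f) (hg : Computable g) :
    Computable (fun x => Nat.pair (f x) (g x)) := Primrec₂.natPair.to_comp.comp hf hg

@[fun_prop] theorem computable_unpair {f : α → ℕ} (hf : Computable f) :
    Computable (fun x => (f x).unpair) := Primrec.unpair.to_comp.comp hf

@[fun_prop] theorem computable_some {f : α → β} (hf : Computable f) :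
    Computable (fun x => some (f x)) := Primrec.option_some.to_comp.comp hf

@[fun_prop] theorem computable_cons {f : α → β} {g : α → List β} (hf : Computable f)
    (hg : Computable g) : Computable (fun x => f x :: g x) := Primrec.list_cons.to_comp.comp hf hg

@[fun_prop] theorem computable_append {f g : α → List β} (hf : Computable f)
    (hg : Computable g) : Computable (fun x => f x ++ g x) :=
  Primrec.list_append.to_comp.comp hf hg

@[fun_prop] theorem computable_range {f : α → ℕ} (hf : Computable f) :
    Computable (fun x => List.range (f x)) := Primrec.list_range.to_comp.comp hf

@[fun_prop] theorem computable_length {f : α → List β} (hf : Computable f) :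
    Computable (fun x => (f x).length) := Primrec.list_length.to_comp.comp hf

@[fun_prop] theorem computable_getElem? {f : α → List β} {g : α → ℕ} (hf : Computable f)
    (hg : Computable g) : Computable (fun x => (f x)[g x]?) :=
  Primrec.list_getElem?.to_comp.comp hf hg

@[fun_prop] theorem computable_getD {f : α → Option β} {g : α → β} (hf : Computable f)
    (hg : Computable g) : Computable (fun x => (f x).getD (g x)) :=
  Primrec.option_getD.to_comp.comp hf hg

@[fun_prop] theorem computable_elim {o : α → Option β} {g : α → γ} {f : α → β → γ}
    (ho : Computable o) (hg : Computable g) (hf : Computable fun x : α × β => f x.1 x.2) :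
    Computable (fun x => (o x).elim (g x) (f x)) :=
  (Computable.option_casesOn ho hg hf.to₂).of_eq fun a => by cases o a <;> rfl

@[fun_prop] theorem computable_decode {f : α → ℕ} (hf : Computable f) :
    Computable (fun x => (Encodable.decode (f x) : Option β)) := Computable.decode.comp hf

@[fun_prop] theorem computable_encode {f : α → β} (hf : Computable f) :
    Computable (fun x => Encodable.encode (f x)) := Computable.encode.comp hf

@[fun_prop] theorem computable_isSome {f : α → Option β} (hf : Computable f) :
    Computable (fun x => (f x).isSome) := Primrec.option_isSome.to_comp.comp hf

theorem computablePred_of_bool {f : α → Bool} (hf : Computable f) :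
    ComputablePred fun a => f a = true :=
  ⟨inferInstance, hf.of_eq fun a => by simp⟩

theorem exists_bool_of_computablePred {p : α → Prop} (hp : ComputablePred p) :
    ∃ f : α → Bool, Computable f ∧ ∀ a, p a ↔ f a = true := by
  obtain ⟨_, h⟩ := hp
  exact ⟨_, h, fun a => by simp⟩

@[fun_prop] theorem computablePred_eq {f g : α → β} (hf : Computable f) (hg : Computable g) :
    ComputablePred fun a => f a = g a := by
  classical
  exact ⟨fun a => Classical.propDecidable _, ((Primrec.eq (α := β)).decide.to_comp.comp hf hg)⟩

@[fun_prop] theorem computablePred_le {f g : α → ℕ} (hf : Computable f) (hg : Computable g) :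
    ComputablePred fun a => f a ≤ g a :=
  ⟨inferInstance, Primrec.nat_le.decide.to_comp.comp hf hg⟩

@[fun_prop] theorem computablePred_lt {f g : α → ℕ} (hf : Computable f) (hg : Computable g) :
    ComputablePred fun a => f a < g a :=
  ⟨inferInstance, Primrec.nat_lt.decide.to_comp.comp hf hg⟩

@[fun_prop] theorem computablePred_comp {p : β → Prop} {f : α → β} (hp : ComputablePred p)
    (hf : Computable f) : ComputablePred fun a => p (f a) := by
  obtain ⟨g, hg, h⟩ := exists_bool_of_computablePred hp
  simp only [h]
  exact computablePred_of_bool (hg.comp hf)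

@[fun_prop] theorem computablePred_not {p : α → Prop} (hp : ComputablePred p) :
    ComputablePred fun a => ¬ p a := hp.not

@[fun_prop] theorem computablePred_and {p q : α → Prop} (hp : ComputablePred p)
    (hq : ComputablePred q) : ComputablePred fun a => p a ∧ q a := by
  obtain ⟨f, hf, h⟩ := exists_bool_of_computablePred hp
  obtain ⟨g, hg, h'⟩ := exists_bool_of_computablePred hq
  simp only [h, h', ← Bool.and_eq_true]
  exact computablePred_of_bool (Primrec.and.to_comp.comp hf hg)

@[fun_prop] theorem computablePred_or {p q : α → Prop} (hp : ComputablePred p)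
    (hq : ComputablePred q) : ComputablePred fun a => p a ∨ q a := by
  obtain ⟨f, hf, h⟩ := exists_bool_of_computablePred hp
  obtain ⟨g, hg, h'⟩ := exists_bool_of_computablePred hq
  simp only [h, h', ← Bool.or_eq_true]
  exact computablePred_of_bool (Primrec.or.to_comp.comp hf hg)

theorem computablePred_imp {p q : α → Prop} (hp : ComputablePred p)
    (hq : ComputablePred q) : ComputablePred fun a => p a → q a := by
  simp only [imp_iff_not_or]
  fun_prop

@[fun_prop] theorem computable_ite {p : α → Prop} [∀ a, Decidable (p a)] {f g : α → β}
    (hp : ComputablePred p) (hf : Computable f) (hg : Computable g) :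
    Computable fun a => if p a then f a else g a := by
  obtain ⟨c, hc, h⟩ := exists_bool_of_computablePred hp
  exact (Computable.cond hc hf hg).of_eq fun a => by
    by_cases h' : p a
    · simp [h', (h a).1 h']
    · simp [h', mt (h a).2 h']

@[fun_prop] theorem computable_foldl {f : α → List β} {g : α → σ} {h : α → σ → β → σ}
    (hf : Computable f) (hg : Computable g)
    (hh : Computable fun x : α × σ × β => h x.1 x.2.1 x.2.2) :
    Computable fun a => (f a).foldl (h a) (g a) := by
  -- The fold is a recursion on the list index, with the list looked up at each step.
  have key : Computable fun a => Nat.rec (motive := fun _ => σ) (g a)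
      (fun i acc => ((f a)[i]?).elim acc (fun b => h a acc b)) (f a).length := by
    refine Computable.nat_rec (by fun_prop) hg
      (h := fun a p => ((f a)[p.1]?).elim p.2 (fun b => h a p.2 b)) ?_
    refine Computable₂.mk ?_
    refine computable_elim (by fun_prop) (by fun_prop) ?_
    exact hh.comp (g := fun x : (α × ℕ × σ) × β => (x.1.1, x.1.2.2, x.2)) (by fun_prop)
  refine key.of_eq fun a => ?_
  have : ∀ n, Nat.rec (motive := fun _ => σ) (g a)
      (fun i acc => ((f a)[i]?).elim acc (fun b => h a acc b)) n
      = ((f a).take n).foldl (h a) (g a) := by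
    intro n
    induction n with
    | zero => rfl
    | succ n ih =>
      simp only [ih, List.take_add_one, List.foldl_append]
      cases (f a)[n]? <;> rfl
  rw [this, List.take_length]

@[fun_prop] theorem computable_map {f : α → List β} {h : α → β → σ}
    (hf : Computable f) (hh : Computable fun x : α × β => h x.1 x.2) :
    Computable fun a => (f a).map (h a) := by
  have : Computable fun a => (f a).foldl (fun acc b => acc ++ [h a b]) [] := by
    refine computable_foldl hf (by fun_prop) ?_
    have : Computable fun x : α × List σ × β => h x.1 x.2.2 :=
      hh.comp (g := fun x : α × List σ × β => (x.1, x.2.2)) (by fun_prop)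
    fun_prop
  refine this.of_eq fun a => ?_
  have : ∀ L : List β, ∀ acc : List σ,
      L.foldl (fun acc b => acc ++ [h a b]) acc = acc ++ L.map (h a) := by
    intro L
    induction L with
    | nil => simp
    | cons b L ih => intro acc; simp [ih]
  simp [this]

theorem computablePred_forall_mem {f : α → List β} {p : α → β → Prop} (hf : Computable f)
    (hp : ComputablePred fun x : α × β => p x.1 x.2) :
    ComputablePred fun a => ∀ b ∈ f a, p a b := by
  obtain ⟨c, hc, h⟩ := exists_bool_of_computablePred hp
  have : Computable fun a => (f a).foldl (fun acc b => acc && c (a, b)) true :=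
    computable_foldl hf (by fun_prop) (Primrec.and.to_comp.comp (by fun_prop) (by fun_prop))
  refine (computablePred_of_bool this).of_eq fun a => ?_
  have : ∀ L : List β, ∀ acc : Bool,
      (L.foldl (fun acc b => acc && c (a, b)) acc = true ↔ acc = true ∧ ∀ b ∈ L, p a b) := by
    intro L
    induction L with
    | nil => simp
    | cons b L ih =>
      intro acc
      have := h (a, b)
      simp only at this
      simp [ih, this, and_assoc]
  simp [this]

theorem computablePred_exists_mem {f : α → List β} {p : α → β → Prop} (hf : Computable f)
    (hp : ComputablePred fun x : α × β => p x.1 x.2) :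
    ComputablePred fun a => ∃ b ∈ f a, p a b := by
  refine (computablePred_forall_mem (p := fun a b => ¬ p a b) hf hp.not).not.of_eq fun a => ?_
  push Not
  rfl

theorem computablePred_forall_lt {f : α → ℕ} {p : α → ℕ → Prop} (hf : Computable f)
    (hp : ComputablePred fun x : α × ℕ => p x.1 x.2) :
    ComputablePred fun a => ∀ b < f a, p a b :=
  (computablePred_forall_mem (f := fun a => List.range (f a)) (by fun_prop) hp).of_eq
    fun a => by simp

@[fun_prop] theorem repred_of_computablePred {p : α → Prop} (hp : ComputablePred p) :
    REPred p := hp.to_re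

@[fun_prop] theorem repred_not {p : α → Prop} (hp : ComputablePred p) :
    REPred fun a => ¬ p a := hp.not.to_re

/-- The stages come from `evaln`. Monotonicity in the stage lets finitely many witnesses be moved to
one common stage, as needed for conjunctions and bounded quantifiers. -/
theorem exists_bool_of_repred {p : α → Prop} (hp : REPred p) :
    ∃ f : α × ℕ → Bool, Computable f ∧ (∀ a, p a ↔ ∃ n, f (a, n) = true) ∧
      ∀ a n m, n ≤ m → f (a, n) = true → f (a, m) = true := by
  obtain ⟨c, hc⟩ := Nat.Partrec.Code.exists_code.1 hp
  refine ⟨fun x => (Nat.Partrec.Code.evaln x.2 c (Encodable.encode x.1)).isSome, ?_, ?_, ?_⟩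
  · exact Primrec.option_isSome.to_comp.comp (Computable.comp
      (g := fun x : α × ℕ => ((x.2, c), Encodable.encode x.1))
      Nat.Partrec.Code.primrec_evaln.to_comp (by fun_prop))
  · intro a
    have h1 : p a ↔ (Nat.Partrec.Code.eval c (Encodable.encode a)).Dom := by
      rw [hc]
      simp only [Encodable.encodek, Part.coe_some, Part.bind_some, Part.map_Dom]
      exact ⟨fun h => ⟨h, trivial⟩, fun h => h.1⟩
    rw [h1, Part.dom_iff_mem]
    simp only [Nat.Partrec.Code.evaln_complete, Option.isSome_iff_exists]
    exact ⟨fun ⟨x, k, h⟩ => ⟨k, x, h⟩, fun ⟨k, x, h⟩ => ⟨x, k, h⟩⟩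
  · intro a n m hnm h
    rw [Option.isSome_iff_exists] at h ⊢
    obtain ⟨x, h⟩ := h
    exact ⟨x, Nat.Partrec.Code.evaln_mono hnm h⟩

theorem repred_of_exists {f : α × ℕ → Bool} (hf : Computable f) :
    REPred fun a => ∃ n, f (a, n) = true := by
  have := (Partrec.rfind (p := fun a n => Part.some (f (a, n))) hf.partrec.to₂).dom_re
  refine this.of_eq fun a => Nat.rfind_dom.trans ?_
  exact ⟨fun ⟨n, h, _⟩ => ⟨n, (Part.mem_some_iff.1 h).symm⟩,
    fun ⟨n, h⟩ => ⟨n, Part.mem_some_iff.2 h.symm, fun _ => trivial⟩⟩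

theorem repred_exists_nat {p : α → ℕ → Prop} (hp : ComputablePred fun x : α × ℕ => p x.1 x.2) :
    REPred fun a => ∃ n, p a n := by
  obtain ⟨f, hf, h⟩ := exists_bool_of_computablePred hp
  exact (repred_of_exists hf).of_eq fun a => exists_congr fun n => (h (a, n)).symm

@[fun_prop] theorem repred_comp {p : β → Prop} {f : α → β} (hp : REPred p)
    (hf : Computable f) : REPred fun a => p (f a) := by
  obtain ⟨g, hg, h, -⟩ := exists_bool_of_repred hp
  simp only [h]
  exact repred_of_exists (f := fun x : α × ℕ => g (f x.1, x.2)) (by fun_prop)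

@[fun_prop] theorem repred_and {p q : α → Prop} (hp : REPred p) (hq : REPred q) :
    REPred fun a => p a ∧ q a := by
  obtain ⟨f, hf, h, hm⟩ := exists_bool_of_repred hp
  obtain ⟨g, hg, h', hm'⟩ := exists_bool_of_repred hq
  refine (repred_exists_nat (p := fun a n => f (a, n) = true ∧ g (a, n) = true)
    (by fun_prop)).of_eq fun a => ?_
  rw [h, h']
  constructor
  · rintro ⟨n, h1, h2⟩
    exact ⟨⟨n, h1⟩, ⟨n, h2⟩⟩
  · rintro ⟨⟨n, h1⟩, ⟨m, h2⟩⟩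
    exact ⟨max n m, hm _ _ _ (le_max_left _ _) h1, hm' _ _ _ (le_max_right _ _) h2⟩

@[fun_prop] theorem repred_or {p q : α → Prop} (hp : REPred p) (hq : REPred q) :
    REPred fun a => p a ∨ q a := by
  obtain ⟨f, hf, h, hm⟩ := exists_bool_of_repred hp
  obtain ⟨g, hg, h', hm'⟩ := exists_bool_of_repred hq
  refine (repred_exists_nat (p := fun a n => f (a, n) = true ∨ g (a, n) = true)
    (by fun_prop)).of_eq fun a => ?_
  rw [h, h', exists_or]

@[fun_prop] theorem repred_exists {p : α → β → Prop} (hp : REPred fun x : α × β => p x.1 x.2) :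
    REPred fun a => ∃ b, p a b := by
  obtain ⟨f, hf, h, hm⟩ := exists_bool_of_repred hp
  refine (repred_exists_nat (p := fun a n =>
    ((Encodable.decode n.unpair.1 : Option β).elim false fun b => f ((a, b), n.unpair.2)) = true)
    (by fun_prop)).of_eq fun a => ?_
  constructor
  · rintro ⟨n, hn⟩
    cases hd : (Encodable.decode n.unpair.1 : Option β) with
    | none => simp [hd] at hn
    | some b =>
      simp only [hd, Option.elim] at hn
      exact ⟨b, (h (a, b)).2 ⟨_, hn⟩⟩
  · rintro ⟨b, hb⟩
    obtain ⟨n, hn⟩ := (h (a, b)).1 hb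
    exact ⟨Nat.pair (Encodable.encode b) n, by simp [hn]⟩

theorem repred_forall_mem {f : α → List β} {p : α → β → Prop} (hf : Computable f)
    (hp : REPred fun x : α × β => p x.1 x.2) :
    REPred fun a => ∀ b ∈ f a, p a b := by
  obtain ⟨g, hg, h, hm⟩ := exists_bool_of_repred hp
  refine (repred_exists_nat (p := fun a n => ∀ b ∈ f a, g ((a, b), n) = true)
    (computablePred_forall_mem (by fun_prop) (by fun_prop))).of_eq fun a => ?_
  have h' : ∀ b, p a b ↔ ∃ n, g ((a, b), n) = true := fun b => h (a, b)
  simp only [h']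
  generalize f a = L
  constructor
  · rintro ⟨n, hn⟩ b hb
    exact ⟨n, hn b hb⟩
  · intro hL
    induction L with
    | nil => exact ⟨0, by simp⟩
    | cons b L ih =>
      obtain ⟨n, hn⟩ := ih fun b hb => hL b (List.mem_cons_of_mem _ hb)
      obtain ⟨m, hm'⟩ := hL b List.mem_cons_self
      refine ⟨max n m, fun c hc => ?_⟩
      rcases List.mem_cons.1 hc with rfl | hc
      · exact hm _ _ _ (le_max_right _ _) hm'
      · exact hm _ _ _ (le_max_left _ _) (hn c hc)

theorem repred_exists_mem {f : α → List β} {p : α → β → Prop} (hf : Computable f)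
    (hp : REPred fun x : α × β => p x.1 x.2) : REPred fun a => ∃ b ∈ f a, p a b := by
  have h := computablePred_exists_mem (f := fun x : α × β => f x.1) (p := fun x b => b = x.2)
    (by fun_prop) (by fun_prop)
  have h' : ComputablePred fun x : α × β => x.2 ∈ f x.1 := h.of_eq fun x => by simp
  exact repred_exists (repred_and h'.to_re hp)

theorem computablePred_of_repred {p : α → Prop} (hp : REPred p) (hn : REPred fun a => ¬ p a) :
    ComputablePred p := ComputablePred.computable_iff_re_compl_re'.2 ⟨hp, hn⟩

/-- Uniformization of c.e. relations which are total. -/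
theorem exists_computable_select {p : α → β → Prop} (hp : REPred fun x : α × β => p x.1 x.2)
    (h : ∀ a, ∃ b, p a b) : ∃ f : α → β, Computable f ∧ ∀ a, p a (f a) := by
  classical
  obtain ⟨g, hg, hgp, -⟩ := exists_bool_of_repred hp
  let q : α → ℕ → Prop := fun a n =>
    ((Encodable.decode n.unpair.1 : Option β).elim false fun b => g ((a, b), n.unpair.2)) = true
  have hq : ComputablePred fun x : α × ℕ => q x.1 x.2 := by
    change ComputablePred fun x : α × ℕ => ((Encodable.decode x.2.unpair.1 : Option β).elim false
      fun b => g ((x.1, b), x.2.unpair.2)) = true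
    fun_prop
  have htot : ∀ a, ∃ n, q a n := fun a => by
    obtain ⟨b, hb⟩ := h a
    obtain ⟨n, hn⟩ := (hgp (a, b)).1 hb
    exact ⟨Nat.pair (Encodable.encode b) n, by simp [q, hn]⟩
  obtain ⟨c, hc, hcq⟩ := exists_bool_of_computablePred hq
  have hfind : Computable fun a => Nat.find (htot a) := by
    have hr := (Partrec.rfind (p := fun a n => Part.some (c (a, n))) hc.partrec.to₂)
    refine Partrec.of_eq hr fun a => ?_
    refine Part.eq_some_iff.2 (Nat.mem_rfind.2 ⟨?_, fun {m} hm => ?_⟩)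
    · exact Part.mem_some_iff.2 ((hcq (a, _)).1 (Nat.find_spec (htot a))).symm
    · have := mt (hcq (a, m)).2 (Nat.find_min (htot a) hm)
      exact Part.mem_some_iff.2 (by simpa using this)
  have hspec : ∀ a, ∃ b, (Encodable.decode (Nat.find (htot a)).unpair.1 : Option β) = some b ∧
      p a b := fun a => by
    have := Nat.find_spec (htot a)
    cases hd : (Encodable.decode (Nat.find (htot a)).unpair.1 : Option β) with
    | none => simp only [q, hd, Option.elim_none, Bool.false_eq_true] at this
    | some b =>
      simp only [q, hd, Option.elim_some] at this
      exact ⟨b, rfl, (hgp (a, b)).2 ⟨_, this⟩⟩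
  choose f hf hfp using hspec
  refine ⟨f, ?_, hfp⟩
  have : Computable fun a => (Encodable.decode (Nat.find (htot a)).unpair.1 : Option β) := by
    fun_prop
  exact Computable.option_some_iff.1 (this.of_eq hf)

/-- Recursion with dependence on the whole history through a c.e. relation. -/
theorem exists_computable_history {p : List β → β → Prop}
    (hp : REPred fun x : List β × β => p x.1 x.2) (h : ∀ L, ∃ b, p L b) :
    ∃ f : ℕ → β, Computable f ∧ ∀ n, p ((List.range n).map f) (f n) := by
  obtain ⟨g, hg, hgp⟩ := exists_computable_select hp h
  let H : ℕ → List β := fun n => Nat.rec [] (fun _ L => L ++ [g L]) n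
  have hH : Computable H :=
    Computable.nat_rec (f := fun n : ℕ => n) (g := fun _ => ([] : List β))
      (h := fun _ p => p.2 ++ [g p.2]) (by fun_prop) (by fun_prop) (Computable₂.mk (by fun_prop))
  refine ⟨fun n => g (H n), by fun_prop, fun n => ?_⟩
  have : (List.range n).map (fun n => g (H n)) = H n := by
    induction n with
    | zero => rfl
    | succ n ih => rw [List.range_succ, List.map_append, ih]; rfl
  rw [this]
  exact hgp _

end toolkit

end CeerDegrees

namespace CeerDegrees

/-! ### Merging classes -/

/-- The equivalence relation obtained from `R` by identifying the classes of `p.1` and `p.2`. -/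
def merge (R : ℕ → ℕ → Prop) (p : ℕ × ℕ) (x y : ℕ) : Prop :=
  R x y ∨ (R x p.1 ∧ R p.2 y) ∨ (R x p.2 ∧ R p.1 y)

/-- Identification of the classes of all pairs in a list. -/
def mergeAll (R : ℕ → ℕ → Prop) (L : List (ℕ × ℕ)) : ℕ → ℕ → Prop := L.foldl merge R

theorem mergeAll_mono {R R' : ℕ → ℕ → Prop} (h : ∀ x y, R x y → R' x y) (L : List (ℕ × ℕ))
    {x y : ℕ} (hxy : mergeAll R L x y) : mergeAll R' L x y := by
  induction L generalizing R R' with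
  | nil => exact h _ _ hxy
  | cons p L ih =>
    refine ih (R := merge R p) (R' := merge R' p) (fun x y hm => ?_) hxy
    rcases hm with hm | hm | hm
    · exact Or.inl (h _ _ hm)
    · exact Or.inr (Or.inl ⟨h _ _ hm.1, h _ _ hm.2⟩)
    · exact Or.inr (Or.inr ⟨h _ _ hm.1, h _ _ hm.2⟩)

/-- Normal form of `x` with respect to a list of substitutions. -/
def app (M : List (ℕ × ℕ)) (x : ℕ) : ℕ := M.foldl (fun w p => if w = p.1 then p.2 else w) x

/-- The pair is normalized before it is appended: the new substitution then acts on normal forms,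
and the effect is exactly to identify two classes. -/
def addPair (M : List (ℕ × ℕ)) (p : ℕ × ℕ) : List (ℕ × ℕ) := M ++ [(app M p.1, app M p.2)]

def addAll (M L : List (ℕ × ℕ)) : List (ℕ × ℕ) := L.foldl addPair M

/-- The equivalence relation described by a list of substitutions. -/
def eqv (M : List (ℕ × ℕ)) (x y : ℕ) : Prop := app M x = app M y

theorem eqv_addPair (M : List (ℕ × ℕ)) (p : ℕ × ℕ) : eqv (addPair M p) = merge (eqv M) p := by
  funext x y
  simp only [eqv, merge, addPair, app, List.foldl_append, List.foldl_cons, List.foldl_nil]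
  grind

theorem eqv_addAll (M L : List (ℕ × ℕ)) : eqv (addAll M L) = mergeAll (eqv M) L := by
  induction L generalizing M with
  | nil => rfl
  | cons p L ih =>
    change eqv (addAll (addPair M p) L) = mergeAll (merge (eqv M) p) L
    rw [ih, eqv_addPair]

theorem eqv_addAll_of_eqv {M : List (ℕ × ℕ)} (L : List (ℕ × ℕ)) {x y : ℕ} (h : eqv M x y) :
    eqv (addAll M L) x y := by
  induction L generalizing M with
  | nil => exact h
  | cons p L ih => exact ih (by rw [eqv_addPair]; exact Or.inl h)

theorem eqv_addAll_of_mem (M : List (ℕ × ℕ)) {L : List (ℕ × ℕ)} {p : ℕ × ℕ} (h : p ∈ L) :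
    eqv (addAll M L) p.1 p.2 := by
  induction L generalizing M with
  | nil => simp at h
  | cons q L ih =>
    rcases List.mem_cons.1 h with rfl | h
    · refine eqv_addAll_of_eqv L ?_
      rw [eqv_addPair]
      exact Or.inr (Or.inl ⟨rfl, rfl⟩)
    · exact ih _ h

/-- Merging pairs which are related by an equivalence relation `S` keeps one below `S`. -/
theorem eqv_addAll_le {M L : List (ℕ × ℕ)} (S : Setoid ℕ) (hM : ∀ x y, eqv M x y → S x y)
    (hL : ∀ p ∈ L, S p.1 p.2) {x y : ℕ} (h : eqv (addAll M L) x y) : S x y := by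
  induction L generalizing M with
  | nil => exact hM _ _ h
  | cons p L ih =>
    refine ih (M := addPair M p) (fun x y hxy => ?_) (fun q hq => hL q (by simp [hq])) h
    have hp := hL p (by simp)
    rw [eqv_addPair] at hxy
    rcases hxy with hxy | hxy | hxy
    · exact hM _ _ hxy
    · exact S.trans' (hM _ _ hxy.1) (S.trans' hp (hM _ _ hxy.2))
    · exact S.trans' (hM _ _ hxy.1) (S.trans' (S.symm' hp) (hM _ _ hxy.2))

section
variable {α : Type} [Primcodable α]

@[fun_prop] theorem computable_app {M : α → List (ℕ × ℕ)} {x : α → ℕ} (hM : Computable M)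
    (hx : Computable x) : Computable fun a => app (M a) (x a) := by
  unfold app
  fun_prop

@[fun_prop] theorem computable_addPair {M : α → List (ℕ × ℕ)} {p : α → ℕ × ℕ}
    (hM : Computable M) (hp : Computable p) : Computable fun a => addPair (M a) (p a) := by
  unfold addPair
  fun_prop

@[fun_prop] theorem computable_addAll {M L : α → List (ℕ × ℕ)}
    (hM : Computable M) (hL : Computable L) : Computable fun a => addAll (M a) (L a) := by
  unfold addAll
  exact computable_foldl hL hM (by fun_prop)

@[fun_prop] theorem computablePred_eqv {M : α → List (ℕ × ℕ)} {x y : α → ℕ} (hM : Computable M)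
    (hx : Computable x) (hy : Computable y) : ComputablePred fun a => eqv (M a) (x a) (y a) := by
  unfold eqv
  fun_prop

end

/-! ### The priority construction -/

/-- A request `(d, B, L, K, tag)`: merge the pairs in `L`, while in each clause in `K` some pair
has to be kept apart; `d` is not to be blocked by earlier requests and `B` are the columns
blocked by this request. -/
abbrev Req : Type := ℕ × List ℕ × List (ℕ × ℕ) × List (List (ℕ × ℕ)) × (ℕ × ℕ)

abbrev Req.d (q : Req) : ℕ := q.1
abbrev Req.B (q : Req) : List ℕ := q.2.1
abbrev Req.L (q : Req) : List (ℕ × ℕ) := q.2.2.1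
abbrev Req.K (q : Req) : List (List (ℕ × ℕ)) := q.2.2.2.1
abbrev Req.tag (q : Req) : ℕ × ℕ := q.2.2.2.2

/-- The column of a point. -/
def col (p : ℕ) : ℕ := p.unpair.1

@[fun_prop] theorem computable_col {α : Type} [Primcodable α] {f : α → ℕ} (hf : Computable f) :
    Computable fun a => col (f a) := by
  unfold col
  fun_prop

/-- A state: a list of substitutions and the log of actions (requirement, stage, request). -/
abbrev GState : Type := List (ℕ × ℕ) × List (ℕ × ℕ × Req)

/-- Merging `L` changes nothing below `n`. -/
def Respects (M L : List (ℕ × ℕ)) (n : ℕ) : Prop :=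
  ∀ x < n, ∀ y < n, eqv (addAll M L) x y → eqv M x y

/-- Requirement `e` has acted since it was last injured. -/
def Satisfied (log : List (ℕ × ℕ × Req)) (e : ℕ) : Prop :=
  ∃ en ∈ log, en.1 = e ∧ ∀ en' ∈ log, en'.1 < e → en'.2.1 < en.2.1

/-- Stage `t = ⟨⟨w, k⟩, ⟨c, s⟩⟩` acts, where `q` is the request with code `c`. -/
def Acts (U : ℕ × ℕ × ℕ → Bool) (t : ℕ) (S : GState) (q : Req) : Prop :=
  U (t.unpair.1.unpair.1, t.unpair.2.unpair.1, t.unpair.2.unpair.2) = true ∧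
  ¬ Satisfied S.2 t.unpair.1 ∧
  (∀ k < t.unpair.1.unpair.2, Satisfied S.2 (Nat.pair t.unpair.1.unpair.1 k)) ∧
  (∀ en ∈ S.2, en.1.unpair.1 = t.unpair.1.unpair.1 → ∀ b ∈ en.2.2.B, b ≠ q.d) ∧
  (∀ p ∈ q.L, p.1 < t ∧ p.2 < t ∧ col p.1 = col p.2) ∧
  (∀ κ ∈ q.K, ∃ p ∈ κ, p.1 < t ∧ p.2 < t ∧ ¬ eqv (addAll S.1 q.L) p.1 p.2) ∧
  -- Restraints are squares because `Nat.pair c x < (max c x + 1) ^ 2`; they protect long initial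
  -- parts of early columns.
  Respects S.1 q.L ((t.unpair.1 + 1) ^ 2) ∧
  ∀ en ∈ S.2, en.1 < t.unpair.1 → Respects S.1 q.L ((t.unpair.1 + en.2.1 + 2) ^ 2)

open Classical in
noncomputable def gstep (U : ℕ × ℕ × ℕ → Bool) (t : ℕ) (S : GState) : Option Req :=
  (Encodable.decode t.unpair.2.unpair.1 : Option Req).elim none fun q =>
    if Acts U t S q then some q else none

noncomputable def gnext (U : ℕ × ℕ × ℕ → Bool) (t : ℕ) (S : GState) : GState :=
  (gstep U t S).elim S fun q => (addAll S.1 q.L, (t.unpair.1, t, q) :: S.2)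

noncomputable def gstate (U : ℕ × ℕ × ℕ → Bool) (t : ℕ) : GState :=
  Nat.rec ([], []) (gnext U) t

/-- The request on which stage `t` acts. -/
noncomputable def gact (U : ℕ × ℕ × ℕ → Bool) (t : ℕ) : Option Req := gstep U t (gstate U t)

section
variable {α : Type} [Primcodable α]

@[fun_prop] theorem computable_sq {n : α → ℕ} (hn : Computable n) :
    Computable fun a => n a ^ 2 := by
  simp only [pow_two]
  exact computable_mul hn hn

theorem computablePred_respects {M L : α → List (ℕ × ℕ)} {n : α → ℕ} (hM : Computable M)
    (hL : Computable L) (hn : Computable n) :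
    ComputablePred fun a => Respects (M a) (L a) (n a ^ 2) := by
  refine computablePred_forall_lt (by fun_prop) (computablePred_forall_lt (by fun_prop)
    (computablePred_imp ?_ ?_)) <;> fun_prop

theorem computablePred_satisfied {l : α → List (ℕ × ℕ × Req)} {e : α → ℕ} (hl : Computable l)
    (he : Computable e) : ComputablePred fun a => Satisfied (l a) (e a) := by
  refine computablePred_exists_mem hl (computablePred_and (by fun_prop)
    (computablePred_forall_mem (by fun_prop) (computablePred_imp ?_ ?_))) <;> fun_prop

theorem computablePred_acts {U : ℕ × ℕ × ℕ → Bool} (hU : Computable U) :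
    ComputablePred fun x : (ℕ × GState) × Req => Acts U x.1.1 x.1.2 x.2 := by
  unfold Acts
  refine computablePred_and (computablePred_eq (by fun_prop) (by fun_prop)) (computablePred_and
    (computablePred_not (computablePred_satisfied (by fun_prop) (by fun_prop)))
    (computablePred_and (computablePred_forall_lt (by fun_prop) (computablePred_satisfied
      (by fun_prop) (by fun_prop))) (computablePred_and
    (computablePred_forall_mem (by fun_prop) (computablePred_imp (by fun_prop)
      (computablePred_forall_mem (by fun_prop) (by fun_prop))))
    (computablePred_and (computablePred_forall_mem (by fun_prop) (by fun_prop))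
    (computablePred_and (computablePred_forall_mem (by fun_prop) (computablePred_exists_mem
      (by fun_prop) (by fun_prop)))
    (computablePred_and (computablePred_respects (by fun_prop) (by fun_prop) (by fun_prop))
    (computablePred_forall_mem (by fun_prop) (computablePred_imp (by fun_prop)
      (computablePred_respects (by fun_prop) (by fun_prop) (by fun_prop))))))))))

theorem computable_gstep {U : ℕ × ℕ × ℕ → Bool} (hU : Computable U) :
    Computable fun x : ℕ × GState => gstep U x.1 x.2 := by
  classical
  unfold gstep
  refine computable_elim (by fun_prop) (by fun_prop) (computable_ite (computablePred_acts hU)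
    (by fun_prop) (by fun_prop))

theorem computable_gstate {U : ℕ × ℕ × ℕ → Bool} (hU : Computable U) :
    Computable (gstate U) := by
  refine Computable.nat_rec (f := fun n : ℕ => n) (g := fun _ => (([], []) : GState))
    (h := fun _ x => gnext U x.1 x.2) (by fun_prop) (by fun_prop) (Computable₂.mk ?_)
  have := computable_gstep hU
  unfold gnext
  have h2 : Computable fun x : ℕ × ℕ × GState => gstep U x.2.1 x.2.2 :=
    this.comp (g := fun x : ℕ × ℕ × GState => (x.2.1, x.2.2)) (by fun_prop)
  exact computable_elim h2 (by fun_prop) (by fun_prop)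

theorem computable_gact {U : ℕ × ℕ × ℕ → Bool} (hU : Computable U) : Computable (gact U) :=
  (computable_gstep hU).comp (g := fun t => (t, gstate U t))
    (computable_id.pair (computable_gstate hU))

end

/-! ### Verification of the priority construction -/

section verification

variable {U : ℕ × ℕ × ℕ → Bool}

theorem gact_eq_some {t : ℕ} {q : Req} (h : gact U t = some q) :
    Encodable.decode t.unpair.2.unpair.1 = some q ∧ Acts U t (gstate U t) q := by
  unfold gact gstep at h
  cases hd : (Encodable.decode t.unpair.2.unpair.1 : Option Req) with
  | none => rw [hd] at h; cases h
  | some q' =>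
    rw [hd, Option.elim_some] at h
    split_ifs at h with ha
    cases h
    exact ⟨rfl, ha⟩

theorem gact_of_acts {t : ℕ} {q : Req} (hd : Encodable.decode t.unpair.2.unpair.1 = some q)
    (h : Acts U t (gstate U t) q) : gact U t = some q := by
  unfold gact gstep
  rw [hd, Option.elim_some, if_pos h]

theorem gstate_succ (t : ℕ) : gstate U (t + 1) = (gact U t).elim (gstate U t) fun q =>
    (addAll (gstate U t).1 q.L, (t.unpair.1, t, q) :: (gstate U t).2) := rfl

theorem mem_log {t : ℕ} {en : ℕ × ℕ × Req} :
    en ∈ (gstate U t).2 ↔ en.2.1 < t ∧ en.1 = en.2.1.unpair.1 ∧ gact U en.2.1 = some en.2.2 := by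
  induction t with
  | zero => simp [gstate]
  | succ t ih =>
    rw [gstate_succ]
    obtain ⟨e, s, q⟩ := en
    simp only at ih ⊢
    cases h : gact U t with
    | none =>
      simp only [Option.elim_none, ih]
      constructor
      · exact fun h' => ⟨by omega, h'.2⟩
      · rintro ⟨h1, h2, h3⟩
        refine ⟨lt_of_le_of_ne (by omega) ?_, h2, h3⟩
        rintro rfl
        simp [h] at h3
    | some q' =>
      simp only [Option.elim_some, List.mem_cons, ih, Prod.mk.injEq]
      constructor
      · rintro (⟨rfl, rfl, rfl⟩ | h')
        · exact ⟨by omega, rfl, h⟩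
        · exact ⟨by omega, h'.2⟩
      · rintro ⟨h1, h2, h3⟩
        rcases eq_or_ne s t with rfl | hne
        · left
          rw [h] at h3
          exact ⟨h2, rfl, (Option.some.inj h3).symm⟩
        · exact Or.inr ⟨by omega, h2, h3⟩

theorem eqv_gstate_succ {t x y : ℕ} (h : eqv (gstate U t).1 x y) :
    eqv (gstate U (t + 1)).1 x y := by
  rw [gstate_succ]
  cases gact U t with
  | none => exact h
  | some q => exact eqv_addAll_of_eqv _ h

theorem eqv_gstate_mono {t t' x y : ℕ} (htt : t ≤ t') (h : eqv (gstate U t).1 x y) :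
    eqv (gstate U t').1 x y := by
  induction htt with
  | refl => exact h
  | step _ ih => exact eqv_gstate_succ ih

/-- Actions before stage `t` merge only numbers below `t` inside one column. In particular every
number `≥ t` is still alone at stage `t`, which supplies fresh points. -/
theorem eqv_gstate_col {t x y : ℕ} (h : eqv (gstate U t).1 x y) :
    x = y ∨ (x < t ∧ y < t ∧ col x = col y) := by
  let S : ℕ → Setoid ℕ := fun t =>
    { r := fun x y => x = y ∨ (x < t ∧ y < t ∧ col x = col y)
      iseqv := ⟨fun x => Or.inl rfl, fun h => by rcases h with h | h <;> grind,
        fun h h' => by rcases h with h | h <;> rcases h' with h' | h' <;> grind⟩ }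
  induction t generalizing x y with
  | zero => exact Or.inl h
  | succ t ih =>
    have hs : ∀ x y, eqv (gstate U t).1 x y → S (t + 1) x y := fun x y hxy => by
      rcases ih hxy with h1 | h1
      · exact Or.inl h1
      · exact Or.inr ⟨by omega, by omega, h1.2.2⟩
    rw [gstate_succ] at h
    cases ha : gact U t with
    | none => rw [ha] at h; exact hs _ _ h
    | some q =>
      rw [ha] at h
      refine eqv_addAll_le (S (t + 1)) hs (fun p hp => ?_) h
      obtain ⟨h1, h2, h3⟩ := (gact_eq_some ha).2.2.2.2.2.1 p hp
      exact Or.inr ⟨by omega, by omega, h3⟩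

/-- Requirement `e` acts at stage `t`. -/
def ActsAt (U : ℕ × ℕ × ℕ → Bool) (e t : ℕ) : Prop := t.unpair.1 = e ∧ ∃ q, gact U t = some q

theorem satisfied_iff {t e : ℕ} : Satisfied (gstate U t).2 e ↔
    ∃ s < t, ActsAt U e s ∧ ∀ e' < e, ∀ s' < t, ActsAt U e' s' → s' < s := by
  constructor
  · rintro ⟨⟨e1, s, q⟩, hen, rfl, h⟩
    obtain ⟨h1, h2, h3⟩ := mem_log.1 hen
    refine ⟨s, h1, ⟨h2.symm, q, h3⟩, ?_⟩
    rintro e' he' s' hs' ⟨rfl, q', hq'⟩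
    exact h (s'.unpair.1, s', q') (mem_log.2 ⟨hs', rfl, hq'⟩) he'
  · rintro ⟨s, hs, ⟨rfl, q, hq⟩, h⟩
    refine ⟨(s.unpair.1, s, q), mem_log.2 ⟨hs, rfl, hq⟩, rfl, ?_⟩
    rintro ⟨e', s', q'⟩ hen' he'
    obtain ⟨h1, h2, h3⟩ := mem_log.1 hen'
    exact h e' he' s' h1 ⟨h2.symm, q', h3⟩

/-- No requirement of higher priority than `e` acts from stage `T` on, and `T` is minimal. -/
def Quiet (U : ℕ × ℕ × ℕ → Bool) (e T : ℕ) : Prop :=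
  (∀ s ≥ T, ∀ e' < e, ¬ ActsAt U e' s) ∧ (T = 0 ∨ ∃ e' < e, ∃ s, T = s + 1 ∧ ActsAt U e' s)

theorem Quiet.satisfied {e T s t : ℕ} (h : Quiet U e T) (hs : T ≤ s) (ha : ActsAt U e s)
    (hst : s < t) : Satisfied (gstate U t).2 e := by
  refine satisfied_iff.2 ⟨s, hst, ha, fun e' he' s' _ ha' => ?_⟩
  by_contra hc
  exact h.1 s' (by omega) e' he' ha'

theorem ActsAt.not_satisfied {e t : ℕ} (h : ActsAt U e t) : ¬ Satisfied (gstate U t).2 e := by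
  obtain ⟨rfl, q, hq⟩ := h
  exact (gact_eq_some hq).2.2.1

theorem Quiet.succ {e T t : ℕ} (h : Quiet U e T) (ht : T ≤ t) (ha : ActsAt U e t) :
    Quiet U (e + 1) (t + 1) := by
  refine ⟨fun s hs e' he' ha' => ?_, Or.inr ⟨e, by omega, t, rfl, ha⟩⟩
  rcases Nat.lt_succ_iff_lt_or_eq.1 he' with he' | rfl
  · exact h.1 s (by omega) e' he' ha'
  · exact ha'.not_satisfied (h.satisfied ht ha (by omega))

/-- Finite injury: once all requirements of higher priority have stopped, a requirement that acts
stays satisfied and never acts again. Taking the least such stage gives the second half of `Quiet`,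
which ties `T` to the last injuring action. -/
theorem exists_quiet (e : ℕ) : ∃ T, Quiet U e T := by
  classical
  suffices hT : ∃ T, ∀ s ≥ T, ∀ e' < e, ¬ ActsAt U e' s by
    refine ⟨Nat.find hT, Nat.find_spec hT, ?_⟩
    rcases h0 : Nat.find hT with _ | s
    · exact Or.inl rfl
    · right
      have hmin := Nat.find_min hT (m := s) (by omega)
      push Not at hmin
      obtain ⟨s', hs', e', he', ha'⟩ := hmin
      have : s' = s := by
        by_contra hne
        exact Nat.find_spec hT s' (by omega) e' he' ha'
      exact ⟨e', he', s, rfl, this ▸ ha'⟩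
  induction e with
  | zero => exact ⟨0, fun s _ e' he' => by omega⟩
  | succ e ih =>
    obtain ⟨T, hT⟩ := ih
    by_cases hact : ∃ s ≥ T, ActsAt U e s
    · obtain ⟨s, hs, ha⟩ := hact
      refine ⟨s + 1, fun s' hs' e' he' ha' => ?_⟩
      rcases Nat.lt_succ_iff_lt_or_eq.1 he' with he' | rfl
      · exact hT s' (by omega) e' he' ha'
      · refine ha'.not_satisfied (satisfied_iff.2 ⟨s, by omega, ha, fun e2 he2 s2 _ ha2 => ?_⟩)
        by_contra hc
        exact hT s2 (by omega) e2 he2 ha2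
    · push Not at hact
      refine ⟨T, fun s' hs' e' he' ha' => ?_⟩
      rcases Nat.lt_succ_iff_lt_or_eq.1 he' with he' | rfl
      · exact hT s' (by omega) e' he' ha'
      · exact hact s' hs' ha'

/-- From `T` on only requirements `f ≥ e` act. If `T = s + 1` with a last higher-priority action at
`s`, they respect `(f + s + 2) ^ 2 ≥ (e + T + 1) ^ 2`; if `T = 0`, the unconditional restraint `(f +
1) ^ 2` is enough. -/
theorem Quiet.freeze {e T t x y : ℕ} (h : Quiet U e T) (hx : x < (e + T + 1) ^ 2)
    (hy : y < (e + T + 1) ^ 2) (ht : T ≤ t) (hxy : eqv (gstate U t).1 x y) :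
    eqv (gstate U T).1 x y := by
  induction ht with
  | refl => exact hxy
  | @step t ht ih =>
    simp only [Nat.succ_eq_add_one] at *
    refine ih ?_
    rw [gstate_succ] at hxy
    cases ha : gact U t with
    | none => rw [ha] at hxy; exact hxy
    | some q =>
      rw [ha] at hxy
      have hf : e ≤ t.unpair.1 := by
        by_contra hc
        exact h.1 t ht _ (by omega) ⟨rfl, q, ha⟩
      obtain ⟨-, -, -, -, -, -, hr0, hr⟩ := (gact_eq_some ha).2
      rcases h.2 with rfl | ⟨e', he', s, rfl, rfl, q', hq'⟩
      · have hle : (e + 0 + 1) ^ 2 ≤ (t.unpair.1 + 1) ^ 2 := Nat.pow_le_pow_left (by omega) 2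
        exact hr0 x (by omega) y (by omega) hxy
      · have hle : (e + (s + 1) + 1) ^ 2 ≤ (t.unpair.1 + s + 2) ^ 2 :=
          Nat.pow_le_pow_left (by omega) 2
        exact hr (s.unpair.1, s, q') (mem_log.2 ⟨ht, rfl, hq'⟩) 
          (show s.unpair.1 < t.unpair.1 by omega) x (hx.trans_le hle) y (hy.trans_le hle) hxy

/-- The limit of the construction. -/
def limitRel (U : ℕ × ℕ × ℕ → Bool) : Setoid ℕ where
  r x y := ∃ t, eqv (gstate U t).1 x y
  iseqv := ⟨fun _ => ⟨0, rfl⟩, fun ⟨t, h⟩ => ⟨t, h.symm⟩, fun ⟨t, h⟩ ⟨t', h'⟩ =>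
    ⟨max t t', (eqv_gstate_mono (le_max_left _ _) h).trans
      (eqv_gstate_mono (le_max_right _ _) h')⟩⟩

theorem Quiet.limit {e T x y : ℕ} (h : Quiet U e T) (hx : x < (e + T + 1) ^ 2)
    (hy : y < (e + T + 1) ^ 2) (hxy : limitRel U x y) : eqv (gstate U T).1 x y := by
  obtain ⟨t, ht⟩ := hxy
  rcases le_total T t with hT | hT
  · exact h.freeze hx hy hT ht
  · exact eqv_gstate_mono hT ht

theorem limitRel_of_mem {t : ℕ} {q : Req} (h : gact U t = some q) {p : ℕ × ℕ} (hp : p ∈ q.L) :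
    limitRel U p.1 p.2 := by
  refine ⟨t + 1, ?_⟩
  rw [gstate_succ, h]
  exact eqv_addAll_of_mem _ hp

/-- The action at `t` makes `t + 1` the quiet stage of `e + 1`. All pairs in the clauses lie below
`t`, hence in the frozen range, so pairs kept apart at `t` stay apart. -/
theorem limitRel_clause {e T t : ℕ} {q : Req} (h : Quiet U e T) (ht : T ≤ t)
    (he : t.unpair.1 = e) (ha : gact U t = some q) {κ : List (ℕ × ℕ)} (hκ : κ ∈ q.K) :
    ∃ p ∈ κ, ¬ limitRel U p.1 p.2 := by
  obtain ⟨p, hp, h1, h2, h3⟩ := (gact_eq_some ha).2.2.2.2.2.2.1 κ hκ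
  refine ⟨p, hp, fun hlim => h3 ?_⟩
  have hle : t ≤ (e + 1 + (t + 1) + 1) ^ 2 := by nlinarith
  have := (h.succ ht ⟨he, q, ha⟩).limit (x := p.1) (y := p.2) (by omega) (by omega) hlim
  rw [gstate_succ, ha] at this
  exact this

/-- With `T` quiet for `c + r + 1`, the `r + 1` points `⟨c, T + i⟩` with `i ≤ r` are alone at stage
`T` and lie in the frozen range, so they stay pairwise inequivalent. They cannot all be equivalent
to one of the `r` numbers below `r`. -/
theorem limitRel_infinite (c r : ℕ) : ∃ x, ∀ p < r, ¬ limitRel U (Nat.pair c x) p := by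
  by_contra hcon
  push Not at hcon
  choose f hf hfr using hcon
  obtain ⟨T, hT⟩ := exists_quiet (U := U) (c + r + 1)
  obtain ⟨a, ha, b, hb, hne, hab⟩ := Finset.exists_ne_map_eq_of_card_lt_of_maps_to
    (s := Finset.range (r + 1)) (t := Finset.range r) (f := fun i => f (T + i)) (by simp)
    (fun i _ => by simpa using hf _)
  have hlim : limitRel U (Nat.pair c (T + a)) (Nat.pair c (T + b)) := by
    refine Setoid.trans' _ (hfr _) (Setoid.symm' _ ?_)
    rw [show f (T + a) = f (T + b) from hab]
    exact hfr _
  simp only [Finset.mem_range] at ha hb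
  have hbound : ∀ i < r + 1, Nat.pair c (T + i) < (c + r + 1 + T + 1) ^ 2 := fun i hi => by
    refine lt_of_lt_of_le (Nat.pair_lt_max_add_one_sq _ _) (Nat.pow_le_pow_left ?_ 2)
    omega
  rcases eqv_gstate_col (hT.limit (hbound a ha) (hbound b hb) hlim) with h | h
  · exact hne (by have := (Nat.pair_eq_pair.1 h).2; omega)
  · have := Nat.right_le_pair c (T + a)
    omega

end verification

/-! ### Existence of a generic relation -/

theorem exists_universal : ∃ U : ℕ × ℕ × ℕ → Bool, Computable U ∧
    (∀ w c s s', s ≤ s' → U (w, c, s) = true → U (w, c, s') = true) ∧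
    ∀ p : Req → Prop, REPred p → ∃ w, ∀ q, p q ↔ ∃ s, U (w, Encodable.encode q, s) = true := by
  refine ⟨fun x => (Nat.Partrec.Code.evaln x.2.2 (Denumerable.ofNat Nat.Partrec.Code x.1)
    x.2.1).isSome, ?_, ?_, ?_⟩
  · have h := (Primrec.ofNat Nat.Partrec.Code).to_comp
    refine computable_isSome (Computable.comp
      (g := fun x : ℕ × ℕ × ℕ => ((x.2.2, Denumerable.ofNat Nat.Partrec.Code x.1), x.2.1))
      Nat.Partrec.Code.primrec_evaln.to_comp (by fun_prop))
  · intro w c s s' hs h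
    rw [Option.isSome_iff_exists] at h ⊢
    obtain ⟨x, h⟩ := h
    exact ⟨x, Nat.Partrec.Code.evaln_mono hs h⟩
  · intro p hp
    obtain ⟨c, hc⟩ := Nat.Partrec.Code.exists_code.1 hp
    refine ⟨Encodable.encode c, fun a => ?_⟩
    have h1 : p a ↔ (Nat.Partrec.Code.eval c (Encodable.encode a)).Dom := by
      rw [hc]
      simp only [Encodable.encodek, Part.coe_some, Part.bind_some, Part.map_Dom]
      exact ⟨fun h => ⟨h, trivial⟩, fun h => h.1⟩
    rw [h1, Part.dom_iff_mem]
    simp only [Nat.Partrec.Code.evaln_complete, Option.isSome_iff_exists,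
      Denumerable.ofNat_encode]
    exact ⟨fun ⟨x, k, h⟩ => ⟨k, x, h⟩, fun ⟨k, x, h⟩ => ⟨x, k, h⟩⟩

/-- Merging `L` identifies two numbers below `r` which are not equivalent. -/
def Viol (R : ℕ → ℕ → Prop) (r : ℕ) (L : List (ℕ × ℕ)) : Prop :=
  ∃ u < r, ∃ v < r, ¬ R u v ∧ mergeAll R L u v

/-- The generic behaviour of a c.e. equivalence relation towards c.e. sets of requests. -/
structure IsGeneric (R : Setoid ℕ) : Prop where
  re : REPred fun p : ℕ × ℕ => R p.1 p.2
  col_eq : ∀ x y, R x y → col x = col y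
  infinite : ∀ c r, ∃ x, ∀ p < r, ¬ R (Nat.pair c x) p
  gen : ∀ Cd : Req → Prop, REPred Cd → (∀ q, Cd q → ∀ p ∈ q.L, col p.1 = col p.2) →
    ∃ act : ℕ → Option (ℕ × Req), Computable act ∧
      (∀ t k q, act t = some (k, q) → Cd q ∧ ∀ p ∈ q.L, R p.1 p.2) ∧
      (∀ t t' k k' q q', t < t' → act t = some (k, q) → act t' = some (k', q') → q'.d ∉ q.B) ∧
      ((∀ k, ∃ t q, act t = some (k, q) ∧ ∀ κ ∈ q.K, ∃ p ∈ κ, ¬ R p.1 p.2) ∨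
        ∃ (Γ : List ℕ) (r : ℕ), (∀ x ∈ Γ, ∃ q, Cd q ∧ x ∈ q.B) ∧ ∀ q, Cd q →
          q.d ∈ Γ ∨ Viol R r q.L ∨ ∃ κ ∈ q.K, ∀ p ∈ κ, mergeAll R q.L p.1 p.2)

theorem exists_bound (L : List (ℕ × ℕ)) : ∃ n, ∀ p ∈ L, p.1 < n ∧ p.2 < n := by
  induction L with
  | nil => exact ⟨0, by simp⟩
  | cons q L ih =>
    obtain ⟨n, hn⟩ := ih
    refine ⟨n + q.1 + q.2 + 1, fun p hp => ?_⟩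
    rcases List.mem_cons.1 hp with rfl | hp
    · omega
    · have := hn p hp
      omega

theorem eq_encode_of_decode {n : ℕ} {q : Req} (h : Encodable.decode n = some q) :
    n = Encodable.encode q := by
  rw [Denumerable.decode_eq_ofNat, Option.some_inj] at h
  rw [← h, Denumerable.encode_ofNat]

theorem exists_isGeneric : ∃ R : Setoid ℕ, IsGeneric R := by
  obtain ⟨U, hU, hmono, huniv⟩ := exists_universal
  have hst := computable_gstate hU
  have hact := computable_gact hU
  refine ⟨limitRel U, ?_, ?_, limitRel_infinite, ?_⟩
  · exact repred_exists_nat (p := fun (a : ℕ × ℕ) t => eqv (gstate U t).1 a.1 a.2) (by fun_prop)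
  · rintro x y ⟨t, h⟩
    rcases eqv_gstate_col h with rfl | h
    · rfl
    · exact h.2.2
  intro Cd hCd hcol
  obtain ⟨w, hw⟩ := huniv Cd hCd
  have hsome : ∀ {t k q}, (if t.unpair.1.unpair.1 = w then (gact U t).elim none
      fun q => some (t.unpair.1.unpair.2, q) else none) = some (k, q) →
      t.unpair.1 = Nat.pair w k ∧ gact U t = some q := by
    intro t k q h
    split_ifs at h with h1
    cases h2 : gact U t with
    | none => simp [h2] at h
    | some q' =>
      simp only [h2, Option.elim_some, Option.some.injEq, Prod.mk.injEq] at h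
      rw [← h1, ← h.1, Nat.pair_unpair, h.2]
      exact ⟨rfl, rfl⟩
  have hsome' : ∀ {t k q}, t.unpair.1 = Nat.pair w k → gact U t = some q →
      (if t.unpair.1.unpair.1 = w then (gact U t).elim none
      fun q => some (t.unpair.1.unpair.2, q) else none) = some (k, q) := by
    intro t k q h1 h2
    simp [h1, h2]
  refine ⟨fun t => if t.unpair.1.unpair.1 = w then (gact U t).elim none
      fun q => some (t.unpair.1.unpair.2, q) else none, by fun_prop, ?_, ?_, ?_⟩
  · intro t k q h
    obtain ⟨h1, h2⟩ := hsome h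
    refine ⟨(hw q).2 ?_, fun p hp => limitRel_of_mem h2 hp⟩
    obtain ⟨h3, h4⟩ := gact_eq_some h2
    have h5 := h4.1
    have h6 := eq_encode_of_decode h3
    rw [h1, Nat.unpair_pair, h6] at h5
    exact ⟨_, h5⟩
  · intro t t' k k' q q' htt h h'
    obtain ⟨h1, h2⟩ := hsome h
    obtain ⟨h1', h2'⟩ := hsome h'
    have := (gact_eq_some h2').2.2.2.2.1 (t.unpair.1, t, q) (mem_log.2 ⟨htt, rfl, h2⟩)
      (by rw [h1, h1']; simp)
    exact fun hmem => this _ hmem rfl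
  -- Either every instance of `w` acts after its last injury, so its clauses survive to the limit,
  -- or there is a least instance `k` that does not.
  by_cases hps : ∀ k, ∃ T, Quiet U (Nat.pair w k) T ∧ ∃ t ≥ T, ActsAt U (Nat.pair w k) t
  · left
    intro k
    obtain ⟨T, hT, t, ht, he, q, hq⟩ := hps k
    exact ⟨t, q, hsome' he hq, fun κ hκ => limitRel_clause hT ht he hq hκ⟩
  right
  classical
  push Not at hps
  obtain ⟨T, hT⟩ := exists_quiet (U := U) (Nat.pair w (Nat.find hps))
  have hno := Nat.find_spec hps T hT
  have hyes : ∀ k' < Nat.find hps, ∀ t ≥ T, Satisfied (gstate U t).2 (Nat.pair w k') := by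
    intro k' hk' t ht
    have := Nat.find_min hps hk'
    push Not at this
    obtain ⟨T', hT', s, hs, ha⟩ := this
    refine hT'.satisfied hs ha (lt_of_lt_of_le ?_ ht)
    by_contra hc
    exact hT.1 s (by omega) _ (Nat.pair_lt_pair_right w hk') ha
  set k := Nat.find hps with hk
  set e := Nat.pair w k with he
  have hnsat : ∀ t ≥ T, ¬ Satisfied (gstate U t).2 e := by
    intro t ht hsat
    obtain ⟨s, hs, ha, hlt⟩ := satisfied_iff.1 hsat
    refine hno s ?_ ha
    rcases hT.2 with rfl | ⟨e', he', s', rfl, ha'⟩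
    · omega
    · exact hlt e' he' s' (by omega) ha'
  have hend : ∀ t ≥ T, ∀ k' q, t.unpair.1 = Nat.pair w k' → gact U t = some q → False := by
    intro t ht k' q h1 h2
    rcases lt_trichotomy k' k with hlt | rfl | hlt
    · exact hT.1 t ht _ (Nat.pair_lt_pair_right w hlt) ⟨h1, q, h2⟩
    · exact hno t ht ⟨h1, q, h2⟩
    · have := (gact_eq_some h2).2.2.2.1 k (by rw [h1]; simpa using hlt)
      rw [h1, Nat.unpair_pair] at this
      exact hnsat t ht this
  -- `Γ` collects the columns blocked by the finitely many actions of `w`, all before `T`; `r` is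
  -- the bound of the frozen range.
  refine ⟨(List.range T).flatMap fun t => if t.unpair.1.unpair.1 = w then
    (gact U t).elim [] Req.B else [], (e + T + 1) ^ 2, ?_, ?_⟩
  · intro x hx
    obtain ⟨t, -, hx⟩ := List.mem_flatMap.1 hx
    split_ifs at hx with h1
    · cases h2 : gact U t with
      | none => simp [h2] at hx
      | some q =>
        rw [h2] at hx
        refine ⟨q, (hw q).2 ?_, hx⟩
        obtain ⟨h3, h4⟩ := gact_eq_some h2
        have h5 := h4.1
        have h6 := eq_encode_of_decode h3
        rw [h1, h6] at h5
        exact ⟨_, h5⟩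
    · simp at hx
  · intro q hq
    by_contra hcon
    push Not at hcon
    obtain ⟨hd, hv, hκ⟩ := hcon
    obtain ⟨s, hs⟩ := (hw q).1 hq
    obtain ⟨n₁, hn₁⟩ := exists_bound q.L
    obtain ⟨n₂, hn₂⟩ := exists_bound q.K.flatten
    -- A stage that offers `q` to instance `k` after `q` is enumerated, after `T`, and beyond all
    -- numbers in `q`. A request violating the second alternative would act here, contradicting
    -- `hend`.
    set t := Nat.pair e (Nat.pair (Encodable.encode q) (s + n₁ + n₂ + T)) with ht
    have htge : s + n₁ + n₂ + T ≤ t := (Nat.right_le_pair _ _).trans (Nat.right_le_pair _ _)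
    have hsub : ∀ {x y}, eqv (addAll (gstate U t).1 q.L) x y → mergeAll (limitRel U) q.L x y := by
      intro x y hxy
      rw [eqv_addAll] at hxy
      exact mergeAll_mono (fun x y h => ⟨t, h⟩) _ hxy
    have hresp : Respects (gstate U t).1 q.L ((e + T + 1) ^ 2) := by
      intro x hx y hy hxy
      by_contra hne
      refine hv ⟨x, hx, y, hy, fun hlim => hne ?_, hsub hxy⟩
      exact eqv_gstate_mono (by omega) (hT.limit hx hy hlim)
    have hacts : Acts U t (gstate U t) q := by
      have e1 : t.unpair.1 = e := by simp [ht]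
      have e2 : t.unpair.1.unpair.1 = w := by simp [ht, he]
      have e3 : t.unpair.1.unpair.2 = k := by simp [ht, he]
      have e4 : t.unpair.2.unpair.1 = Encodable.encode q := by simp [ht]
      have e5 : t.unpair.2.unpair.2 = s + n₁ + n₂ + T := by simp [ht]
      rw [Acts, e2, e3, e4, e5, e1]
      refine ⟨hmono _ _ _ _ (by omega) hs, hnsat t (by omega),
        fun k' hk' => hyes k' hk' t (by omega), ?_, ?_, ?_, ?_, ?_⟩
      · rintro ⟨e', s', q'⟩ hen hew b hb rfl
        obtain ⟨h1, h2, h3⟩ := mem_log.1 hen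
        simp only at h1 h2 h3 hew hb
        refine hd (List.mem_flatMap.2 ⟨s', ?_, ?_⟩)
        · rw [List.mem_range]
          by_contra hc
          refine hend s' (by omega) s'.unpair.1.unpair.2 q' ?_ h3
          rw [← hew, h2, Nat.pair_unpair]
        · rw [← h2, if_pos hew, h3]
          exact hb
      · intro p hp
        have := hn₁ p hp
        exact ⟨by omega, by omega, hcol q hq p hp⟩
      · intro κ hκm
        obtain ⟨p, hp, hpn⟩ := hκ κ hκm
        have := hn₂ p (List.mem_flatten.2 ⟨κ, hκm, hp⟩)
        exact ⟨p, hp, by omega, by omega, fun h => hpn (hsub h)⟩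
      · intro x hx y hy
        have hle : (e + 1) ^ 2 ≤ (e + T + 1) ^ 2 := Nat.pow_le_pow_left (by omega) 2
        exact hresp x (by omega) y (by omega)
      · rintro ⟨e', s', q'⟩ hen hlt x hx y hy
        obtain ⟨h1, h2, h3⟩ := mem_log.1 hen
        simp only at h1 h2 h3 hlt hx hy
        have hsT : s' < T := by
          by_contra hc
          exact hT.1 s' (by omega) e' hlt ⟨h2.symm, q', h3⟩
        have hle : (e + s' + 2) ^ 2 ≤ (e + T + 1) ^ 2 := Nat.pow_le_pow_left (by omega) 2
        exact hresp x (by omega) y (by omega)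
    refine hend t (by omega) k q (by simp [ht, he]) (gact_of_acts ?_ hacts)
    rw [ht, Nat.unpair_pair, Nat.unpair_pair, Encodable.encodek]

end CeerDegrees

namespace CeerDegrees

section
variable {α : Type} [Primcodable α]

@[fun_prop] theorem computable_decide {p : α → Prop} [∀ a, Decidable (p a)]
    (hp : ComputablePred p) : Computable fun a => decide (p a) := hp.decide

@[fun_prop] theorem computable_toNat {f : α → Bool} (hf : Computable f) :
    Computable fun a => (f a).toNat := (Primrec.dom_bool _).to_comp.comp hf

end

/-! ### Consequences of genericity -/

theorem viol_single {R : Setoid ℕ} {r x a : ℕ} (h : Viol R r [(x, a)]) :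
    (∃ p < r, R x p) ∧ ∃ p < r, R a p := by
  obtain ⟨u, hu, v, hv, hn, h | h | h⟩ := h
  · exact (hn h).elim
  · exact ⟨⟨u, hu, R.symm' h.1⟩, v, hv, h.2⟩
  · exact ⟨⟨v, hv, h.2⟩, u, hu, R.symm' h.1⟩

/-- Requests that block nothing: `B = []` forces `Γ` to be empty, and the single instance `k = 0` is
enough in the first alternative. -/
theorem IsGeneric.static {R : Setoid ℕ} (hR : IsGeneric R)
    {S : List (ℕ × ℕ) × List (List (ℕ × ℕ)) → Prop} (hS : REPred S)
    (hcol : ∀ x, S x → ∀ p ∈ x.1, col p.1 = col p.2) :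
    (∃ x, S x ∧ (∀ p ∈ x.1, R p.1 p.2) ∧ ∀ κ ∈ x.2, ∃ p ∈ κ, ¬ R p.1 p.2) ∨
      ∃ r, ∀ x, S x → Viol R r x.1 ∨ ∃ κ ∈ x.2, ∀ p ∈ κ, mergeAll R x.1 p.1 p.2 := by
  obtain ⟨act, -, h1, -, h3⟩ := hR.gen (fun q => q.B = [] ∧ S (q.L, q.K)) (by fun_prop)
    fun q hq => hcol _ hq.2
  rcases h3 with h3 | ⟨Γ, r, hΓ, h3⟩
  · obtain ⟨t, q, ht, hq⟩ := h3 0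
    exact Or.inl ⟨_, (h1 _ _ _ ht).1.2, (h1 _ _ _ ht).2, hq⟩
  · refine Or.inr ⟨r, fun x hx => ?_⟩
    rcases h3 (0, [], x.1, x.2, 0, 0) ⟨rfl, hx⟩ with h | h
    · obtain ⟨q, hq, hm⟩ := hΓ _ h
      rw [hq.1] at hm
      simp at hm
    · exact h

/-- A c.e. subset of a column meets finitely many classes or all of them. -/
theorem IsGeneric.finite_or_full {R : Setoid ℕ} (hR : IsGeneric R) {W : ℕ → Prop}
    (hW : REPred W) {c : ℕ} (hc : ∀ x, W x → col x = c) :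
    (∃ r, ∀ x, W x → ∃ p < r, R x p) ∨ ∀ a, col a = c → ∃ x, W x ∧ R x a := by
  by_contra! h
  obtain ⟨h1, a, ha, h2⟩ := h
  -- The requests ask to merge some point of `W` with the missed point `a`. Such a request can fail
  -- only by a violation, which puts `w` into one of finitely many classes.
  rcases hR.static (S := fun x => ∃ w, W w ∧ x = ([(w, a)], [])) (by fun_prop)
    (by rintro _ ⟨w, hw, rfl⟩ p hp; obtain rfl := List.mem_singleton.1 hp
        exact (hc w hw).trans ha.symm) with ⟨_, ⟨w, hw, rfl⟩, h3, -⟩ | ⟨r, hr⟩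
  · exact h2 w hw (h3 (w, a) (by simp))
  · obtain ⟨w, hw, hwr⟩ := h1 r
    rcases hr _ ⟨w, hw, rfl⟩ with h | ⟨κ, hκ, -⟩
    · obtain ⟨⟨p, hp, hp'⟩, -⟩ := viol_single h
      exact hwr p hp hp'
    · simp at hκ

/-- No infinite c.e. subset of a column consists of pairwise inequivalent points. -/
theorem IsGeneric.finite_of_transversal {R : Setoid ℕ} (hR : IsGeneric R) {W : ℕ → Prop}
    (hW : REPred W) {c : ℕ} (hc : ∀ x, W x → col x = c)
    (ht : ∀ x y, W x → W y → R x y → x = y) : {x | W x}.Finite := by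
  have fin : ∀ W' : ℕ → Prop, (∀ x, W' x → W x) → (∃ r, ∀ x, W' x → ∃ p < r, R x p) →
      {x | W' x}.Finite := by
    rintro W' hW' ⟨r, hr⟩
    choose! f hf hfr using hr
    refine Set.Finite.of_finite_image (f := f) ((Set.finite_lt_nat r).subset ?_) ?_
    · rintro _ ⟨x, hx, rfl⟩
      exact hf x hx
    · intro x hx y hy hxy
      refine ht x y (hW' x hx) (hW' y hy) (R.trans' (hfr x hx) (R.symm' ?_))
      rw [hxy]
      exact hfr y hy
  by_cases hne : ∃ x, W x
  · obtain ⟨x₀, hx₀⟩ := hne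
    -- Without `x₀` the transversal misses the class of `x₀`, so it meets only finitely many
    -- classes.
    have hW' : REPred fun x => W x ∧ ¬ x = x₀ := by fun_prop
    rcases hR.finite_or_full hW' (fun x hx => hc x hx.1) with h | h
    · have := (fin _ (fun x hx => hx.1) h).union (Set.finite_singleton x₀)
      refine this.subset fun x hx => ?_
      by_cases hxx : x = x₀
      · exact Or.inr hxx
      · exact Or.inl ⟨hx, hxx⟩
    · obtain ⟨x, hx, hr⟩ := h x₀ (hc _ hx₀)
      exact (hx.2 (ht _ _ hx.1 hx₀ hr)).elim
  · push Not at hne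
    convert Set.finite_empty
    ext x
    simpa using hne x

/-! ### The ceer assembled from blocks -/

/-- A generic equivalence relation together with a computable graph on `ℕ`. -/
structure Setup where
  R : Setoid ℕ
  gen : IsGeneric R
  E : ℕ → ℕ → Prop
  hE : ComputablePred fun p : ℕ × ℕ => E p.1 p.2
  irrefl : ∀ c, ¬ E c c
  symm : ∀ c d, E c d → E d c

/-- A side of a block. -/
abbrev Side : Type := ℕ × Bool

/-- The column of the generic relation which is copied on a side. -/
def styp (σ : Side) : ℕ := if σ.2 = true then σ.1.unpair.2 else σ.1.unpair.1

/-- The element of a side with a given index. -/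
def elt (σ : Side) (x : ℕ) : ℕ := 2 * Nat.pair σ.1 (2 * x + σ.2.toNat) + 1

def sideOf (n : ℕ) : Side := ((n / 2).unpair.1, decide ((n / 2).unpair.2 % 2 = 1))

def idx (n : ℕ) : ℕ := (n / 2).unpair.2 / 2

/-- The point of the generic relation copied at an odd `n`. The companion `zp n` is the base point
of that side, the only place where a glued block is joined. -/
def pt (n : ℕ) : ℕ := Nat.pair (styp (sideOf n)) (idx n)

def zp (n : ℕ) : ℕ := Nat.pair (styp (sideOf n)) 0

/-- The block of a number; even numbers are blocks of their own. -/
def blk (n : ℕ) : ℕ := if n % 2 = 0 then n else 2 * (sideOf n).1 + 1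

section
variable {α : Type} [Primcodable α]

@[fun_prop] theorem computable_styp {f : α → Side} (hf : Computable f) :
    Computable fun a => styp (f a) := by unfold styp; fun_prop

@[fun_prop] theorem computable_elt {f : α → Side} {g : α → ℕ} (hf : Computable f)
    (hg : Computable g) : Computable fun a => elt (f a) (g a) := by unfold elt; fun_prop

@[fun_prop] theorem computable_sideOf {f : α → ℕ} (hf : Computable f) :
    Computable fun a => sideOf (f a) := by unfold sideOf; fun_prop

@[fun_prop] theorem computable_idx {f : α → ℕ} (hf : Computable f) :
    Computable fun a => idx (f a) := by unfold idx; fun_prop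

@[fun_prop] theorem computable_pt {f : α → ℕ} (hf : Computable f) :
    Computable fun a => pt (f a) := by unfold pt; fun_prop

@[fun_prop] theorem computable_zp {f : α → ℕ} (hf : Computable f) :
    Computable fun a => zp (f a) := by unfold zp; fun_prop

@[fun_prop] theorem computable_blk {f : α → ℕ} (hf : Computable f) :
    Computable fun a => blk (f a) := by unfold blk; fun_prop

end

@[simp] theorem elt_mod (σ : Side) (x : ℕ) : elt σ x % 2 = 1 := by unfold elt; omega

@[simp] theorem sideOf_elt (σ : Side) (x : ℕ) : sideOf (elt σ x) = σ := by
  obtain ⟨q, i⟩ := σ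
  have : elt (q, i) x / 2 = Nat.pair q (2 * x + i.toNat) := by unfold elt; simp only; omega
  rw [sideOf, this, Nat.unpair_pair]
  cases i <;> simp

@[simp] theorem idx_elt (σ : Side) (x : ℕ) : idx (elt σ x) = x := by
  obtain ⟨q, i⟩ := σ
  have : elt (q, i) x / 2 = Nat.pair q (2 * x + i.toNat) := by unfold elt; simp only; omega
  rw [idx, this, Nat.unpair_pair]
  cases i <;> simp
  omega

@[simp] theorem pt_elt (σ : Side) (x : ℕ) : pt (elt σ x) = Nat.pair (styp σ) x := by simp [pt]

@[simp] theorem zp_elt (σ : Side) (x : ℕ) : zp (elt σ x) = Nat.pair (styp σ) 0 := by simp [zp]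

@[simp] theorem blk_elt (σ : Side) (x : ℕ) : blk (elt σ x) = 2 * σ.1 + 1 := by simp [blk]

@[simp] theorem blk_even (k : ℕ) : blk (2 * k) = 2 * k := by simp [blk]

@[simp] theorem col_pair (c x : ℕ) : col (Nat.pair c x) = c := by simp [col]

theorem eq_elt_of_odd {n : ℕ} (h : n % 2 = 1) : n = elt (sideOf n) (idx n) := by
  have h2 : 2 * idx n + (sideOf n).2.toNat = (n / 2).unpair.2 := by
    unfold idx sideOf
    rcases Nat.mod_two_eq_zero_or_one (n / 2).unpair.2 with h | h <;> simp [h] <;> omega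
  rw [elt, h2]
  unfold sideOf
  rw [Nat.pair_unpair]
  omega

theorem even_or_elt (n : ℕ) : (∃ k, n = 2 * k) ∨ ∃ σ x, n = elt σ x := by
  rcases Nat.mod_two_eq_zero_or_one n with h | h
  · exact Or.inl ⟨n / 2, by omega⟩
  · exact Or.inr ⟨_, _, eq_elt_of_odd h⟩

theorem pair_idx_of_col {a c : ℕ} (h : col a = c) : Nat.pair c a.unpair.2 = a := by
  rw [← h, col, Nat.pair_unpair]

namespace Setup

variable (S : Setup)

/-- The two sides of a block are glued. -/
def Glued (σ : Side) : Prop := S.E σ.1.unpair.1 σ.1.unpair.2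

/-- Even numbers are alone; each side carries a column of `S.R`; the classes with index `0` of the
two sides of a glued block are identified. -/
def C : Setoid ℕ where
  r n m := (n % 2 = 0 ∧ n = m) ∨ (n % 2 = 1 ∧ m % 2 = 1 ∧
    ((sideOf n = sideOf m ∧ S.R (pt n) (pt m)) ∨
      ((sideOf n).1 = (sideOf m).1 ∧ (sideOf n).2 ≠ (sideOf m).2 ∧ S.Glued (sideOf n) ∧
        S.R (pt n) (zp n) ∧ S.R (pt m) (zp m))))
  iseqv := by
    refine ⟨fun n => ?_, ?_, ?_⟩
    · rcases Nat.mod_two_eq_zero_or_one n with h | h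
      · exact Or.inl ⟨h, rfl⟩
      · exact Or.inr ⟨h, h, Or.inl ⟨rfl, S.R.refl' _⟩⟩
    · rintro n m (⟨h, rfl⟩ | ⟨h1, h2, h | ⟨h3, h4, h5, h6, h7⟩⟩)
      · exact Or.inl ⟨h, rfl⟩
      · exact Or.inr ⟨h2, h1, Or.inl ⟨h.1.symm, S.R.symm' h.2⟩⟩
      · refine Or.inr ⟨h2, h1, Or.inr ⟨h3.symm, h4.symm, ?_, h7, h6⟩⟩
        unfold Glued at *
        rwa [← h3]
    · rintro n m l (⟨h, rfl⟩ | ⟨h1, h2, h⟩) (⟨h', rfl⟩ | ⟨h1', h2', h'⟩)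
      · exact Or.inl ⟨h, rfl⟩
      · omega
      · omega
      · refine Or.inr ⟨h1, h2', ?_⟩
        have hz : ∀ {a b : ℕ}, sideOf a = sideOf b → zp a = zp b := fun h => by simp [zp, h]
        rcases h with ⟨h3, h4⟩ | ⟨h3, h4, h5, h6, h7⟩ <;>
          rcases h' with ⟨h3', h4'⟩ | ⟨h3', h4', h5', h6', h7'⟩
        · exact Or.inl ⟨h3.trans h3', S.R.trans' h4 h4'⟩
        · refine Or.inr ⟨by rw [h3, h3'], by rwa [h3], by rwa [h3], ?_, h7'⟩
          rw [hz h3]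
          exact S.R.trans' h4 h6'
        · refine Or.inr ⟨by rw [h3, h3'], by rwa [← h3'], h5, h6, ?_⟩
          rw [← hz h3']
          exact S.R.trans' (S.R.symm' h4') h7
        -- Changing sides twice inside a block returns to the first side.
        · have : sideOf n = sideOf l := by
            refine Prod.ext (h3.trans h3') ?_
            revert h4 h4'
            cases (sideOf n).2 <;> cases (sideOf m).2 <;> cases (sideOf l).2 <;> simp
          refine Or.inl ⟨this, S.R.trans' h6 (S.R.symm' ?_)⟩
          rw [hz this]
          exact h7'

theorem computablePred_glued : ComputablePred S.Glued := by
  have := S.hE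
  unfold Glued
  exact computablePred_comp (f := fun σ : Side => (σ.1.unpair.1, σ.1.unpair.2)) this (by fun_prop)

theorem re_C : REPred fun p : ℕ × ℕ => S.C p.1 p.2 := by
  have h1 := S.computablePred_glued
  have h2 := S.gen.re
  have h3 : ∀ {f g : ℕ × ℕ → ℕ}, Computable f → Computable g →
      REPred fun p => S.R (f p) (g p) := fun {f g} hf hg =>
    repred_comp (f := fun p => (f p, g p)) h2 (by fun_prop)
  change REPred fun p : ℕ × ℕ => _ ∨ _
  refine repred_or (by fun_prop) (repred_and (by fun_prop) (repred_and (by fun_prop)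
    (repred_or (repred_and (by fun_prop) (h3 (by fun_prop) (by fun_prop)))
    (repred_and (by fun_prop) (repred_and (by fun_prop) (repred_and (by fun_prop)
    (repred_and (h3 (by fun_prop) (by fun_prop)) (h3 (by fun_prop) (by fun_prop)))))))))

@[fun_prop] theorem re_R {α : Type} [Primcodable α] {f g : α → ℕ} (hf : Computable f)
    (hg : Computable g) : REPred fun a => S.R (f a) (g a) :=
  repred_comp (f := fun p => (f p, g p)) S.gen.re (by fun_prop)

@[fun_prop] theorem re_C' {α : Type} [Primcodable α] {f g : α → ℕ} (hf : Computable f)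
    (hg : Computable g) : REPred fun a => S.C (f a) (g a) :=
  repred_comp (f := fun p => (f p, g p)) S.re_C (by fun_prop)

variable {S}

theorem C_even_left {k m : ℕ} : S.C (2 * k) m ↔ 2 * k = m := by
  change (_ ∨ _) ↔ _
  constructor
  · rintro (h | h)
    · exact h.2
    · omega
  · exact fun h => Or.inl ⟨by omega, h⟩

theorem C_even_right {k m : ℕ} : S.C m (2 * k) ↔ m = 2 * k :=
  ⟨fun h => (C_even_left.1 (S.C.symm' h)).symm, fun h => S.C.symm' (C_even_left.2 h.symm)⟩

theorem C_elt {σ τ : Side} {x y : ℕ} : S.C (elt σ x) (elt τ y) ↔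
    (σ = τ ∧ S.R (Nat.pair (styp σ) x) (Nat.pair (styp τ) y)) ∨
    (σ.1 = τ.1 ∧ σ.2 ≠ τ.2 ∧ S.Glued σ ∧ S.R (Nat.pair (styp σ) x) (Nat.pair (styp σ) 0) ∧
      S.R (Nat.pair (styp τ) y) (Nat.pair (styp τ) 0)) := by
  change (_ ∨ _) ↔ _
  simp

theorem C_elt_same {σ : Side} {x y : ℕ} : S.C (elt σ x) (elt σ y) ↔
    S.R (Nat.pair (styp σ) x) (Nat.pair (styp σ) y) := by
  rw [C_elt]
  simp

theorem blk_eq_of_C {n m : ℕ} (h : S.C n m) : blk n = blk m := by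
  rcases even_or_elt n with ⟨k, rfl⟩ | ⟨σ, x, rfl⟩
  · rw [C_even_left.1 h]
  · rcases even_or_elt m with ⟨k, rfl⟩ | ⟨τ, y, rfl⟩
    · rw [C_even_right.1 h]
    · rcases C_elt.1 h with h | h <;> simp [h.1]

/-! ### Pullbacks of the block relation -/

variable (S) in
/-- The relation pulled back from the block relation. -/
def pull (φ : ℕ → ℕ) : Setoid ℕ := Setoid.comap φ S.C

theorem pull_apply {φ : ℕ → ℕ} {x y : ℕ} : S.pull φ x y ↔ S.C (φ x) (φ y) := Iff.rfl

/-- Since `C` is c.e., an argument of `ψ` with an equivalent value can be found by search. -/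
theorem reducible_pull {φ ψ : ℕ → ℕ} (hφ : Computable φ) (hψ : Computable ψ)
    (h : ∀ x, ∃ y, S.C (φ x) (ψ y)) : Reducible (S.pull φ) (S.pull ψ) := by
  obtain ⟨f, hf, hfc⟩ := exists_computable_select (p := fun x y => S.C (φ x) (ψ y))
    (by fun_prop) h
  refine ⟨f, hf, fun x y => ⟨fun hxy => ?_, fun hxy => ?_⟩⟩
  · exact S.C.trans' (S.C.symm' (hfc x)) (S.C.trans' hxy (hfc y))
  · exact S.C.trans' (hfc x) (S.C.trans' hxy (S.C.symm' (hfc y)))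

/-- Even numbers are singletons, so the even values of `g` can be shifted by `2 * (k + 1)` and the
classes of `Id_{k+1}` placed on the even numbers thus freed. Equality of relations, not merely
equivalence of degrees, results. -/
theorem exists_pull_of_reducibleI {X : Setoid ℕ} {g : ℕ → ℕ} (hg : Computable g)
    (h : ReducibleI X (S.pull g)) : ∃ φ : ℕ → ℕ, Computable φ ∧ X = S.pull φ ∧
      ∀ x, φ x % 2 = 0 ∨ ∃ y, φ x = g y := by
  obtain ⟨k, f, hf, hfr⟩ := h.exists_succ
  refine ⟨fun x => if f x % 2 = 0 then (if g (f x / 2) % 2 = 0 then g (f x / 2) + 2 * (k + 1)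
    else g (f x / 2)) else 2 * (f x / 2 % (k + 1)), by fun_prop, ?_, ?_⟩
  · ext x y
    rw [hfr, pull_apply]
    have hlt : ∀ u, u % (k + 1) < k + 1 := fun u => Nat.mod_lt _ (by omega)
    have key : ∀ u v, S.C (if g u % 2 = 0 then g u + 2 * (k + 1) else g u)
        (if g v % 2 = 0 then g v + 2 * (k + 1) else g v) ↔ S.C (g u) (g v) := by
      intro u v
      rcases even_or_elt (g u) with ⟨a, ha⟩ | ⟨σ, a, ha⟩ <;>
        rcases even_or_elt (g v) with ⟨b, hb⟩ | ⟨τ, b, hb⟩ <;> simp only [ha, hb]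
      · simp [← Nat.mul_add, C_even_left]
      · simp only [Nat.mul_mod_right, if_true, ← Nat.mul_add, C_even_left, elt_mod]
        have := elt_mod τ b
        constructor <;> intro h <;> split_ifs at * <;> omega
      · simp only [Nat.mul_mod_right, if_true, ← Nat.mul_add, C_even_right, elt_mod]
        have := elt_mod σ a
        constructor <;> intro h <;> split_ifs at * <;> omega
      · simp
    have key2 : ∀ u v, ¬ S.C (if g u % 2 = 0 then g u + 2 * (k + 1) else g u)
        (2 * (v % (k + 1))) := by
      intro u v h
      rw [C_even_right] at h
      have := hlt v
      split_ifs at h <;> omega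
    rcases Nat.even_or_odd' (f x) with ⟨u, hu | hu⟩ <;>
      rcases Nat.even_or_odd' (f y) with ⟨v, hv | hv⟩ <;> rw [hu, hv]
    · simp only [join_even, pull_apply, Nat.mul_mod_right, if_true,
        Nat.mul_div_cancel_left _ (Nat.zero_lt_two), key]
    · have h1 : (2 * v + 1) % 2 ≠ 0 := by omega
      simp only [not_join_even_odd, Nat.mul_mod_right, if_true, if_neg h1,
        Nat.mul_div_cancel_left _ (Nat.zero_lt_two), key2]
    · have h1 : (2 * u + 1) % 2 ≠ 0 := by omega
      simp only [not_join_odd_even, Nat.mul_mod_right, if_true, if_neg h1,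
        Nat.mul_div_cancel_left _ (Nat.zero_lt_two), false_iff]
      exact fun h => key2 _ _ (S.C.symm' h)
    · have h1 : (2 * u + 1) % 2 ≠ 0 := by omega
      have h2 : (2 * v + 1) % 2 ≠ 0 := by omega
      have h3 : (2 * u + 1) / 2 = u := by omega
      have h4 : (2 * v + 1) / 2 = v := by omega
      simp only [join_odd, if_neg h1, if_neg h2, h3, h4, C_even_left]
      change u % (k + 1) = v % (k + 1) ↔ _
      omega
  · intro x
    simp only
    split_ifs with h1 h2
    · left; omega
    · exact Or.inr ⟨_, rfl⟩
    · left; omega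

/-- Every class on the side `σ` meets the range of `φ`. -/
def Hits (S : Setup) (φ : ℕ → ℕ) (σ : Side) : Prop := ∀ y, ∃ x, S.C (φ x) (elt σ y)

theorem hits_or_bounded {φ : ℕ → ℕ} (hφ : Computable φ) {D : ℕ → Prop} (hD : REPred D) (σ : Side)
    (hσ : ∀ x, D x → φ x % 2 = 1 ∧ sideOf (φ x) = σ) :
    (∀ y, ∃ x, D x ∧ S.C (φ x) (elt σ y)) ∨
      ∃ r, ∀ x, D x → ∃ p < r, S.R (pt (φ x)) p := by
  have hel : ∀ x, D x → φ x = elt σ (idx (φ x)) := fun x hx => by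
    obtain ⟨h1, h2⟩ := hσ x hx
    have := eq_elt_of_odd h1
    rwa [h2] at this
  have hpt : ∀ x, D x → pt (φ x) = Nat.pair (styp σ) (idx (φ x)) := fun x hx => by
    rw [hel x hx]
    simp
  rcases S.gen.finite_or_full (W := fun p => ∃ x, D x ∧ p = pt (φ x)) (by fun_prop)
    (c := styp σ) (by rintro _ ⟨x, hx, rfl⟩; rw [hpt x hx]; simp) with ⟨r, hr⟩ | h
  · exact Or.inr ⟨r, fun x hx => hr _ ⟨x, hx, rfl⟩⟩
  · left
    intro y
    obtain ⟨_, ⟨x, hx, rfl⟩, h⟩ := h (Nat.pair (styp σ) y) (by simp)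
    refine ⟨x, hx, ?_⟩
    rw [hel x hx, C_elt_same, ← hpt x hx]
    exact h

theorem hits_or_finite {φ : ℕ → ℕ} (hφ : Computable φ) {D : ℕ → Prop} (hD : REPred D) (σ : Side)
    (hσ : ∀ x, D x → φ x % 2 = 1 ∧ sideOf (φ x) = σ) :
    (∀ y, ∃ x, D x ∧ S.C (φ x) (elt σ y)) ∨
      ∃ L : List ℕ, ∀ x, D x → ∃ a ∈ L, S.C (φ x) a := by
  refine (hits_or_bounded hφ hD σ hσ).imp_right ?_
  rintro ⟨r, hr⟩
  refine ⟨(List.range r).map fun p => elt σ p.unpair.2, fun x hx => ?_⟩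
  obtain ⟨p, hp, hpr⟩ := hr x hx
  refine ⟨_, List.mem_map.2 ⟨p, List.mem_range.2 hp, rfl⟩, ?_⟩
  obtain ⟨h1, h2⟩ := hσ x hx
  have hel := eq_elt_of_odd h1
  rw [h2] at hel
  rw [hel, pt_elt] at hpr
  rw [hel, C_elt_same, pair_idx_of_col]
  · exact hpr
  · rw [← S.gen.col_eq _ _ hpr, col_pair]

/-- A computable set of arguments on which `φ` meets finitely many classes can be moved to even
numbers and to values on other arguments. -/
theorem exists_pull_remove {φ : ℕ → ℕ} (hφ : Computable φ) {D : ℕ → Prop}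
    (hD : ComputablePred D) {L : List ℕ} (hL : ∀ x, D x → ∃ a ∈ L, S.C (φ x) a) :
    ∃ φ' : ℕ → ℕ, Computable φ' ∧ S.pull φ = S.pull φ' ∧
      ∀ x, φ' x % 2 = 0 ∨ ∃ y, ¬ D y ∧ φ' x = φ y := by
  classical
  -- Doubling the even numbers preserves `C` and frees the numbers `≡ 2 mod 4` for classes that are
  -- met only on `D`.
  let sh : ℕ → ℕ := fun n => if n % 2 = 0 then 2 * n else n
  have hsh : Computable sh := by change Computable fun n => if n % 2 = 0 then 2 * n else n; fun_prop
  have shC : ∀ n m, S.C (sh n) (sh m) ↔ S.C n m := by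
    intro n m
    rcases even_or_elt n with ⟨a, rfl⟩ | ⟨σ, a, rfl⟩ <;>
      rcases even_or_elt m with ⟨b, rfl⟩ | ⟨τ, b, rfl⟩
    · simp [sh, C_even_left]
    · have := elt_mod τ b
      simp only [sh, Nat.mul_mod_right, if_true, C_even_left, elt_mod]
      constructor <;> intro h <;> split_ifs at * <;> omega
    · have := elt_mod σ a
      simp only [sh, Nat.mul_mod_right, if_true, C_even_right, elt_mod]
      constructor <;> intro h <;> split_ifs at * <;> omega
    · simp [sh]
  let out : ℕ → ℕ := fun a => Quotient.out (s := S.C) (Quotient.mk S.C a)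
  have hout : ∀ a b, S.C a b → out a = out b := fun a b h => by
    simp only [out]
    rw [Quotient.sound (s := S.C) h]
  have hout' : ∀ a, S.C (out a) a := fun a => Quotient.mk_out (s := S.C) a
  -- `N` is chosen noncomputably, but only its finitely many values on `L` enter the definition of
  -- `φ'`. A class also met outside `D` keeps such a value; any other class gets a new even number.
  let N : ℕ → ℕ := fun a => if h : ∃ y, ¬ D y ∧ S.C (φ y) a then sh (φ h.choose)
    else 2 * (2 * out a + 1)
  have N1 : ∀ a, (∃ y, ¬ D y ∧ S.C (φ y) a) → ∃ y, ¬ D y ∧ N a = sh (φ y) ∧ S.C (φ y) a :=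
    fun a h => ⟨h.choose, h.choose_spec.1, by simp only [N, dif_pos h], h.choose_spec.2⟩
  have N2 : ∀ a, ¬ (∃ y, ¬ D y ∧ S.C (φ y) a) → N a = 2 * (2 * out a + 1) :=
    fun a h => by simp only [N, dif_neg h]
  have shne : ∀ n k, ¬ S.C (sh n) (2 * (2 * k + 1)) := by
    intro n k h
    rw [C_even_right] at h
    simp only [sh] at h
    split_ifs at h <;> omega
  have key : ∀ a b, S.C (N a) (N b) ↔ S.C a b := by
    intro a b
    by_cases ha : ∃ y, ¬ D y ∧ S.C (φ y) a <;> by_cases hb : ∃ y, ¬ D y ∧ S.C (φ y) b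
    · obtain ⟨y, -, h1, h2⟩ := N1 a ha
      obtain ⟨z, -, h3, h4⟩ := N1 b hb
      rw [h1, h3, shC]
      exact ⟨fun h => S.C.trans' (S.C.symm' h2) (S.C.trans' h h4),
        fun h => S.C.trans' h2 (S.C.trans' h (S.C.symm' h4))⟩
    · obtain ⟨y, hy, h1, h2⟩ := N1 a ha
      rw [h1, N2 b hb]
      exact ⟨fun h => (shne _ _ h).elim, fun h => (hb ⟨y, hy, S.C.trans' h2 h⟩).elim⟩
    · obtain ⟨y, hy, h1, h2⟩ := N1 b hb
      rw [h1, N2 a ha]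
      exact ⟨fun h => (shne _ _ (S.C.symm' h)).elim,
        fun h => (ha ⟨y, hy, S.C.trans' h2 (S.C.symm' h)⟩).elim⟩
    · rw [N2 a ha, N2 b hb, C_even_left]
      constructor
      · intro h
        have : out a = out b := by omega
        exact S.C.trans' (S.C.symm' (hout' a)) (this ▸ hout' b)
      · intro h
        rw [hout a b h]
  have key2 : ∀ a y, ¬ D y → (S.C (N a) (sh (φ y)) ↔ S.C a (φ y)) := by
    intro a y hy
    by_cases ha : ∃ y, ¬ D y ∧ S.C (φ y) a
    · obtain ⟨z, -, h1, h2⟩ := N1 a ha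
      rw [h1, shC]
      exact ⟨fun h => S.C.trans' (S.C.symm' h2) h, fun h => S.C.trans' h2 h⟩
    · rw [N2 a ha]
      exact ⟨fun h => (shne _ _ (S.C.symm' h)).elim, fun h => (ha ⟨y, hy, S.C.symm' h⟩).elim⟩
  obtain ⟨φ', hφ', hspec⟩ := exists_computable_select
    (p := fun x b => (D x ∧ ∃ p ∈ L.map (fun a => (a, N a)), S.C (φ x) p.1 ∧ b = p.2) ∨
      (¬ D x ∧ b = sh (φ x)))
    (repred_or (repred_and (by fun_prop) (repred_exists_mem (by fun_prop) (by fun_prop)))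
      (by fun_prop)) (fun x => by
        by_cases hx : D x
        · obtain ⟨a, ha, h⟩ := hL x hx
          exact ⟨N a, Or.inl ⟨hx, (a, N a), List.mem_map.2 ⟨a, ha, rfl⟩, h, rfl⟩⟩
        · exact ⟨_, Or.inr ⟨hx, rfl⟩⟩)
  have hspec' : ∀ x, (D x ∧ ∃ a, S.C (φ x) a ∧ φ' x = N a) ∨ (¬ D x ∧ φ' x = sh (φ x)) := by
    intro x
    rcases hspec x with ⟨hx, p, hp, h1, h2⟩ | h
    · obtain ⟨a, -, rfl⟩ := List.mem_map.1 hp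
      exact Or.inl ⟨hx, a, h1, h2⟩
    · exact Or.inr h
  refine ⟨φ', hφ', ?_, ?_⟩
  · ext x y
    rw [pull_apply, pull_apply]
    rcases hspec' x with ⟨hx, a, ha, h1⟩ | ⟨hx, h1⟩ <;>
      rcases hspec' y with ⟨hy, b, hb, h2⟩ | ⟨hy, h2⟩ <;> rw [h1, h2]
    · rw [key]
      exact ⟨fun h => S.C.trans' (S.C.symm' ha) (S.C.trans' h hb),
        fun h => S.C.trans' ha (S.C.trans' h (S.C.symm' hb))⟩
    · rw [key2 _ _ hy]
      exact ⟨fun h => S.C.trans' (S.C.symm' ha) h, fun h => S.C.trans' ha h⟩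
    · rw [S.C.comm', S.C.comm' (x := sh _), key2 _ _ hx]
      exact ⟨fun h => S.C.trans' (S.C.symm' hb) h, fun h => S.C.trans' hb h⟩
    · rw [shC]
  · intro x
    have hse : ∀ n, sh n % 2 = 0 ∨ sh n = n := fun n => by
      simp only [sh]
      split_ifs
      · left; omega
      · right; rfl
    rcases hspec' x with ⟨hx, a, ha, h1⟩ | ⟨hx, h1⟩
    · by_cases h : ∃ y, ¬ D y ∧ S.C (φ y) a
      · obtain ⟨y, hy, h2, -⟩ := N1 a h
        rcases hse (φ y) with h3 | h3
        · left; rw [h1, h2, h3]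
        · exact Or.inr ⟨y, hy, by rw [h1, h2, h3]⟩
      · left
        rw [h1, N2 a h]
        omega
    · rcases hse (φ x) with h3 | h3
      · left; rw [h1, h3]
      · exact Or.inr ⟨x, hx, by rw [h1, h3]⟩

end Setup

end CeerDegrees

namespace CeerDegrees

/-! ### Light degrees -/

theorem degI_le_degI {X Y : Ceer} : degI X ≤ degI Y ↔ ReducibleI X.rel Y.rel :=
  toAntisymmetrization_le_toAntisymmetrization_iff

theorem Reducible.reducibleI {X Y : Setoid ℕ} (h : Reducible X Y) : ReducibleI X Y := ⟨0, h⟩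

theorem Ceer.IsLight.reducible {X : Ceer} (h : X.IsLight) : Reducible ⊥ X.rel := by
  obtain ⟨W, hinf, hre, ht⟩ := h
  obtain ⟨f, hf, hfp⟩ := exists_computable_history (p := fun (L : List ℕ) x =>
    x ∈ W ∧ ∀ y ∈ L, ¬ y = x) (repred_and (by fun_prop) (repred_forall_mem (by fun_prop)
      (by fun_prop))) (fun L => by
        obtain ⟨x, hx, hxL⟩ := hinf.exists_notMem_finset L.toFinset
        exact ⟨x, hx, fun y hy hyx => hxL (by simpa [← hyx] using hy)⟩)
  have hne : ∀ i j, i < j → f i ≠ f j := fun i j hij =>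
    (hfp j).2 (f i) (List.mem_map.2 ⟨i, List.mem_range.2 hij, rfl⟩)
  refine ⟨f, hf, fun x y => ⟨?_, fun h => ?_⟩⟩
  · rintro rfl
    exact X.rel.refl' _
  · by_contra hxy
    refine ht _ (hfp x).1 _ (hfp y).1 ?_ h
    rcases Nat.lt_or_gt_of_ne (show x ≠ y from hxy) with h1 | h1
    · exact hne _ _ h1
    · exact (hne _ _ h1).symm

theorem Ceer.isLight_of_reducibleI {X : Ceer} (h : ReducibleI ⊥ X.rel) : X.IsLight := by
  obtain ⟨k, f, hf, hfr⟩ := h.exists_succ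
  have hX := X.ce
  have hodd : ∀ x y, f x % 2 = 1 → f y % 2 = 1 → f x / 2 ≡ f y / 2 [MOD k + 1] → x = y := by
    intro x y hx hy hxy
    refine (hfr x y).2 ?_
    rw [show f x = 2 * (f x / 2) + 1 by omega, show f y = 2 * (f y / 2) + 1 by omega, join_odd]
    exact hxy
  refine ⟨{u | ∃ x, f x = 2 * u}, ?_, ?_, ?_⟩
  · intro hfin
    have hfe : {x | f x % 2 = 0}.Finite := by
      refine Set.Finite.of_finite_image (f := fun x => f x / 2) (hfin.subset ?_) ?_
      · rintro _ ⟨x, hx, rfl⟩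
        have hx' : f x % 2 = 0 := hx
        exact ⟨x, by simp only; omega⟩
      · intro x hx y hy hxy
        simp only [Set.mem_ofPred_eq] at hx hy hxy
        refine (hfr x y).2 ?_
        rw [show f x = f y by omega]
    have hfo : {x | f x % 2 = 1}.Finite := by
      refine Set.Finite.of_finite_image (f := fun x => f x / 2 % (k + 1))
        ((Set.finite_lt_nat (k + 1)).subset ?_) ?_
      · rintro _ ⟨x, hx, rfl⟩
        exact Nat.mod_lt _ (by omega)
      · intro x hx y hy hxy
        exact hodd x y hx hy hxy
    refine Set.infinite_univ ((hfe.union hfo).subset fun x _ => ?_)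
    exact Nat.mod_two_eq_zero_or_one (f x)
  · change REPred fun u => ∃ x, f x = 2 * u
    fun_prop
  · rintro u ⟨x, hx⟩ v ⟨y, hy⟩ huv h
    have : x = y := (hfr x y).2 (by rw [hx, hy, join_even]; exact h)
    subst this
    omega

theorem isLight_iff {d : IDegree} : IDegree.IsLight d ↔ degI idCeer ≤ d := by
  constructor
  · rintro ⟨X, hX, rfl⟩
    exact degI_le_degI.2 hX.reducible.reducibleI
  · induction d using Quotient.ind with
    | _ X => exact fun h => ⟨X, Ceer.isLight_of_reducibleI (degI_le_degI.1 h), rfl⟩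

namespace Setup

variable {S : Setup}

/-- Otherwise, by pigeonhole, infinitely many values lie in one even singleton, which is absurd, or
on one side, where they form an infinite c.e. transversal of a column, against
`IsGeneric.finite_of_transversal`. -/
theorem exists_blk_ge_of_transversal {h : ℕ → ℕ} (hh : Computable h)
    (ht : ∀ i j, S.C (h i) (h j) → i = j) (n : ℕ) : ∃ i, n ≤ blk (h i) := by
  by_contra! hlt
  obtain ⟨⟨b, s⟩, hb⟩ := Finite.exists_infinite_fiber
    (fun i => ((⟨blk (h i), hlt i⟩, (sideOf (h i)).2) : Fin n × Bool))
  have hinf := Set.infinite_coe_iff.1 hb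
  have hmem : ∀ {i}, i ∈ (fun i => ((⟨blk (h i), hlt i⟩, (sideOf (h i)).2) : Fin n × Bool)) ⁻¹'
      {(b, s)} → blk (h i) = b ∧ (sideOf (h i)).2 = s := fun {i} hi => by
    have := Set.mem_singleton_iff.1 hi
    rw [Prod.mk.injEq] at this
    exact ⟨by rw [← this.1], this.2⟩
  rcases Nat.even_or_odd' (b : ℕ) with ⟨q, hq | hq⟩
  · obtain ⟨i, hi, j, hj, hij⟩ := hinf.nontrivial
    refine hij (ht i j ?_)
    have : ∀ i, blk (h i) = b → h i = b := fun i hi => by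
      unfold blk at hi
      split_ifs at hi <;> omega
    rw [this i (hmem hi).1, this j (hmem hj).1]
  · have hel : ∀ {i}, blk (h i) = b → (sideOf (h i)).2 = s → ∃ x, h i = elt (q, s) x :=
      fun {i} h1 h2 => by
        rcases even_or_elt (h i) with ⟨k, hk⟩ | ⟨σ, x, hx⟩
        · rw [hk, blk_even] at h1
          omega
        · rw [hx, blk_elt] at h1
          rw [hx, sideOf_elt] at h2
          exact ⟨x, by rw [hx]; congr 1; ext <;> simp; omega; exact h2⟩
    have hinj : ∀ i j, blk (h i) = b → (sideOf (h i)).2 = s → blk (h j) = b →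
        (sideOf (h j)).2 = s → S.R (pt (h i)) (pt (h j)) → i = j := by
      intro i j h1 h2 h3 h4 h5
      obtain ⟨x, hx⟩ := hel h1 h2
      obtain ⟨y, hy⟩ := hel h3 h4
      refine ht i j ?_
      rw [hx, hy] at h5 ⊢
      simpa [C_elt_same] using h5
    have hfin := S.gen.finite_of_transversal
      (W := fun p => ∃ i, (blk (h i) = b ∧ (sideOf (h i)).2 = s) ∧ p = pt (h i)) (by fun_prop)
      (c := styp (q, s)) (by
        rintro _ ⟨i, ⟨h1, h2⟩, rfl⟩
        obtain ⟨x, hx⟩ := hel h1 h2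
        simp [hx]) (by
        rintro _ _ ⟨i, ⟨h1, h2⟩, rfl⟩ ⟨j, ⟨h3, h4⟩, rfl⟩ h5
        rw [hinj i j h1 h2 h3 h4 h5])
    refine hinf (Set.Finite.of_finite_image (f := fun i => pt (h i)) (hfin.subset ?_) ?_)
    · rintro _ ⟨i, hi, rfl⟩
      exact ⟨i, hmem hi, rfl⟩
    · intro i hi j hj hij
      refine hinj i j (hmem hi).1 (hmem hi).2 (hmem hj).1 (hmem hj).2 ?_
      rw [show pt (h i) = pt (h j) from hij]

/-- The values of `φ` lie in arbitrarily late blocks. -/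
def Spread (φ : ℕ → ℕ) : Prop := ∀ n, ∃ x, n ≤ blk (φ x)

theorem Spread.exists_increasing {φ : ℕ → ℕ} (hφ : Computable φ) (h : Spread φ) (M : ℕ) :
    ∃ f : ℕ → ℕ, Computable f ∧ (∀ i, M < blk (φ (f i))) ∧
      ∀ i j, i < j → blk (φ (f i)) < blk (φ (f j)) := by
  obtain ⟨f, hf, hfp⟩ := exists_computable_history (p := fun (L : List ℕ) x =>
    M < blk (φ x) ∧ ∀ y ∈ L, blk (φ y) < blk (φ x)) (repred_and (by fun_prop)
      (repred_forall_mem (by fun_prop) (by fun_prop))) (fun L => by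
        have : ∃ N, ∀ y ∈ L, blk (φ y) < N := by
          induction L with
          | nil => exact ⟨0, by simp⟩
          | cons a L ih =>
            obtain ⟨N, hN⟩ := ih
            refine ⟨N + blk (φ a) + 1, fun y hy => ?_⟩
            rcases List.mem_cons.1 hy with rfl | hy
            · omega
            · have := hN y hy
              omega
        obtain ⟨N, hN⟩ := this
        obtain ⟨x, hx⟩ := h (N + M + 1)
        exact ⟨x, by omega, fun y hy => by have := hN y hy; omega⟩)
  exact ⟨f, hf, fun i => (hfp i).1, fun i j hij =>
    (hfp j).2 (f i) (List.mem_map.2 ⟨i, List.mem_range.2 hij, rfl⟩)⟩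

variable (S) in
/-- The ceer pulled back from the block relation. -/
def ceer (φ : ℕ → ℕ) (hφ : Computable φ) : Ceer where
  rel := S.pull φ
  ce := by
    change REPred fun p : ℕ × ℕ => S.C (φ p.1) (φ p.2)
    fun_prop

variable (S) in
def deg (φ : ℕ → ℕ) (hφ : Computable φ) : IDegree := degI (S.ceer φ hφ)

theorem deg_le_deg {φ ψ : ℕ → ℕ} {hφ : Computable φ} {hψ : Computable ψ} :
    S.deg φ hφ ≤ S.deg ψ hψ ↔ ReducibleI (S.pull φ) (S.pull ψ) := degI_le_degI

theorem exists_deg_eq {d : IDegree} {g : ℕ → ℕ} {hg : Computable g} (h : d ≤ S.deg g hg) :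
    ∃ (φ : ℕ → ℕ) (hφ : Computable φ), d = S.deg φ hφ ∧ ∀ x, φ x % 2 = 0 ∨ ∃ y, φ x = g y := by
  induction d using Quotient.ind with
  | _ X =>
    obtain ⟨φ, hφ, h1, h2⟩ := exists_pull_of_reducibleI hg (degI_le_degI.1 h)
    refine ⟨φ, hφ, ?_, h2⟩
    have : X = S.ceer φ hφ := by
      obtain ⟨r, hr⟩ := X
      simp only [ceer, Ceer.mk.injEq]
      exact h1
    rw [this]
    rfl

theorem isLight_deg_iff {φ : ℕ → ℕ} {hφ : Computable φ} :
    IDegree.IsLight (S.deg φ hφ) ↔ Spread φ := by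
  rw [isLight_iff]
  constructor
  · intro h n
    obtain ⟨f, hf, hfr⟩ := (Ceer.isLight_of_reducibleI (degI_le_degI.1 h)).reducible
    obtain ⟨i, hi⟩ := exists_blk_ge_of_transversal (S := S) (h := fun i => φ (f i)) (by fun_prop)
      (fun i j hij => (hfr i j).2 hij) n
    exact ⟨f i, hi⟩
  · intro h
    obtain ⟨f, hf, -, hlt⟩ := h.exists_increasing hφ 0
    refine degI_le_degI.2 (Reducible.reducibleI ⟨f, hf, fun x y => ⟨?_, fun hxy => ?_⟩⟩)
    · rintro rfl
      exact Setoid.refl' _ _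
    · have hb := blk_eq_of_C (pull_apply.1 hxy)
      by_contra hne
      rcases Nat.lt_or_gt_of_ne (show x ≠ y from hne) with h1 | h1
      · exact (hlt _ _ h1).ne hb
      · exact (hlt _ _ h1).ne hb.symm

/-- A copy of a column inside the block relation lies in a single block and meets every class of
a side which carries the same column. -/
theorem exists_side_of_column {φ : ℕ → ℕ} (hφ : Computable φ) {c : ℕ}
    (h : ∀ x y, S.C (φ x) (φ y) ↔ S.R (Nat.pair c x) (Nat.pair c y)) :
    ∃ σ : Side, styp σ = c ∧ Hits S φ σ ∧ ∀ x, blk (φ x) = 2 * σ.1 + 1 := by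
  -- If `ℕ` is covered by two c.e. sets, one of them meets every class of the column: otherwise both
  -- meet finitely many, although the column has infinitely many.
  have hinf : ∀ {D D' : ℕ → Prop}, REPred D → REPred D' → (∀ x, D x ∨ D' x) →
      (∀ y, ∃ x, D x ∧ S.R (Nat.pair c x) (Nat.pair c y)) ∨
      (∀ y, ∃ x, D' x ∧ S.R (Nat.pair c x) (Nat.pair c y)) := by
    intro D D' hD hD' hor
    have aux : ∀ {D : ℕ → Prop}, REPred D →
        (∀ y, ∃ x, D x ∧ S.R (Nat.pair c x) (Nat.pair c y)) ∨
        ∃ r, ∀ x, D x → ∃ p < r, S.R (Nat.pair c x) p := by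
      intro D hD
      rcases S.gen.finite_or_full (W := fun p => ∃ x, D x ∧ p = Nat.pair c x) (by fun_prop)
        (c := c) (by rintro _ ⟨x, -, rfl⟩; simp) with ⟨r, hr⟩ | h
      · exact Or.inr ⟨r, fun x hx => hr _ ⟨x, hx, rfl⟩⟩
      · refine Or.inl fun y => ?_
        obtain ⟨_, ⟨x, hx, rfl⟩, hxy⟩ := h (Nat.pair c y) (by simp)
        exact ⟨x, hx, hxy⟩
    rcases aux hD with h1 | ⟨r, hr⟩
    · exact Or.inl h1
    rcases aux hD' with h1 | ⟨r', hr'⟩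
    · exact Or.inr h1
    obtain ⟨x, hx⟩ := S.gen.infinite c (max r r')
    rcases hor x with h1 | h1
    · obtain ⟨p, hp, hpr⟩ := hr x h1
      exact (hx p (lt_of_lt_of_le hp (le_max_left _ _)) hpr).elim
    · obtain ⟨p, hp, hpr⟩ := hr' x h1
      exact (hx p (lt_of_lt_of_le hp (le_max_right _ _)) hpr).elim
  -- The arguments sent to the block of `φ 0` and the remaining ones are two decidable sets closed
  -- under equivalence in the column, so one containing representatives of all classes excludes the
  -- other.
  have hblk : ∀ x, blk (φ x) = blk (φ 0) := by
    by_contra! hcon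
    obtain ⟨z, hz⟩ := hcon
    rcases hinf (D := fun x => blk (φ x) = blk (φ 0)) (D' := fun x => ¬ blk (φ x) = blk (φ 0))
      (by fun_prop) (by fun_prop) (fun x => em _) with h1 | h1
    · obtain ⟨x, hx, hxz⟩ := h1 z
      exact hz ((blk_eq_of_C ((h _ _).2 hxz)).symm.trans hx)
    · obtain ⟨x, hx, hx0⟩ := h1 0
      exact hx (blk_eq_of_C ((h _ _).2 hx0))
  have hodd : ∀ x, φ x % 2 = 1 := by
    intro x
    by_contra hx
    have hall : ∀ z, φ z = φ x := fun z => by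
      have h1 := (hblk z).trans (hblk x).symm
      unfold blk at h1
      split_ifs at h1 <;> omega
    obtain ⟨z, hz⟩ := S.gen.infinite c (Nat.pair c x + 1)
    refine hz (Nat.pair c x) (by omega) ((h z x).1 ?_)
    rw [hall z]
  have hq : ∀ x, blk (φ x) = 2 * (sideOf (φ x)).1 + 1 := fun x => by simp [blk, hodd x]
  have hfst : ∀ x, (sideOf (φ x)).1 = (sideOf (φ 0)).1 := fun x => by
    have := hblk x
    rw [hq, hq] at this
    omega
  obtain ⟨s, hs⟩ : ∃ s : Bool, ∀ y, ∃ x, (sideOf (φ x)).2 = s ∧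
      S.R (Nat.pair c x) (Nat.pair c y) := by
    rcases hinf (D := fun x => (sideOf (φ x)).2 = true) (D' := fun x => (sideOf (φ x)).2 = false)
      (by fun_prop) (by fun_prop) (fun x => by cases (sideOf (φ x)).2 <;> simp) with h1 | h1
    · exact ⟨_, h1⟩
    · exact ⟨_, h1⟩
  set σ : Side := ((sideOf (φ 0)).1, s) with hσ
  have hel : ∀ x, (sideOf (φ x)).2 = s → φ x = elt σ (idx (φ x)) := fun x hx => by
    have h1 := eq_elt_of_odd (hodd x)
    have h2 : sideOf (φ x) = σ := Prod.ext (hfst x) hx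
    rwa [h2] at h1
  have hpt : ∀ x, (sideOf (φ x)).2 = s → pt (φ x) = Nat.pair (styp σ) (idx (φ x)) := fun x hx => by
    rw [hel x hx]
    simp
  have hR : ∀ x y, (sideOf (φ x)).2 = s → (sideOf (φ y)).2 = s →
      (S.R (pt (φ x)) (pt (φ y)) ↔ S.R (Nat.pair c x) (Nat.pair c y)) := by
    intro x y hx hy
    rw [← h, hel x hx, hel y hy, C_elt_same, pt_elt, pt_elt]
  have hmain : ∀ a, ∃ x, (sideOf (φ x)).2 = s ∧ S.R (Nat.pair c a) (pt (φ x)) := by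
    -- Request: merge two points of the column and keep their images apart. No such request can
    -- succeed, since `φ` is an embedding. For fixed `x` and fresh `y`, failure means that merging
    -- `x` with `y` already merges their images, so one image is equivalent to `x`: the side carries
    -- column `c` itself and all of its classes are met.
    rcases S.gen.static (S := fun X => ∃ x y, ((sideOf (φ x)).2 = s ∧ (sideOf (φ y)).2 = s) ∧
        X = ([(Nat.pair c x, Nat.pair c y)], [[(pt (φ x), pt (φ y))]])) (by fun_prop)
      (by rintro _ ⟨x, y, -, rfl⟩ p hp; obtain rfl := List.mem_singleton.1 hp; simp) with
      ⟨_, ⟨x, y, ⟨hx, hy⟩, rfl⟩, h1, h2⟩ | ⟨r, hr⟩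
    · obtain ⟨p, hp, hpn⟩ := h2 _ (List.mem_singleton.2 rfl)
      obtain rfl := List.mem_singleton.1 hp
      exact (hpn ((hR x y hx hy).2 (h1 (Nat.pair c x, Nat.pair c y) (by simp)))).elim
    · intro a
      obtain ⟨x, hx, hxa⟩ := hs a
      obtain ⟨y', hy'⟩ := S.gen.infinite c (max r (Nat.pair c a + 1))
      obtain ⟨y, hy, hyy⟩ := hs y'
      rcases hr _ ⟨x, y, ⟨hx, hy⟩, rfl⟩ with h1 | ⟨κ, hκ, h1⟩
      · obtain ⟨-, p, hp, hpr⟩ := viol_single h1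
        exact (hy' p (lt_of_lt_of_le hp (le_max_left _ _))
          (S.R.trans' (S.R.symm' hyy) hpr)).elim
      · obtain rfl := List.mem_singleton.1 hκ
        rcases h1 _ (List.mem_singleton.2 rfl) with h2 | h2 | h2
        · refine (hy' (Nat.pair c a) (by simp) ?_).elim
          exact S.R.trans' (S.R.symm' hyy) (S.R.trans' (S.R.symm' ((hR x y hx hy).1 h2)) hxa)
        · exact ⟨x, hx, S.R.trans' (S.R.symm' hxa) (S.R.symm' h2.1)⟩
        · exact ⟨y, hy, S.R.trans' (S.R.symm' hxa) h2.2⟩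
  have htyp : styp σ = c := by
    obtain ⟨x, hx, hxr⟩ := hmain 0
    have := S.gen.col_eq _ _ hxr
    rw [hpt x hx, col_pair, col_pair] at this
    exact this.symm
  refine ⟨σ, htyp, fun y => ?_, fun x => (hblk x).trans (hq 0)⟩
  obtain ⟨x, hx, hxr⟩ := hmain y
  refine ⟨x, ?_⟩
  rw [hel x hx, C_elt_same, ← hpt x hx, htyp]
  exact S.R.symm' hxr

/-! ### Degrees generated by two sides -/

/-- Two sides together with a copy of the identity. -/
def tmap (σ τ : Side) (x : ℕ) : ℕ :=
  if x % 3 = 0 then elt σ (x / 3) else if x % 3 = 1 then elt τ (x / 3) else 2 * (x / 3)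

theorem computable_tmap (σ τ : Side) : Computable (tmap σ τ) := by
  unfold tmap
  fun_prop

theorem tmap_zero (σ τ : Side) (x : ℕ) : tmap σ τ (3 * x) = elt σ x := by
  simp [tmap]

theorem tmap_one (σ τ : Side) (x : ℕ) : tmap σ τ (3 * x + 1) = elt τ x := by
  have h1 : (3 * x + 1) % 3 = 1 := by omega
  have h2 : (3 * x + 1) / 3 = x := by omega
  simp [tmap, h1, h2]

theorem tmap_two (σ τ : Side) (x : ℕ) : tmap σ τ (3 * x + 2) = 2 * x := by
  have h1 : (3 * x + 2) % 3 = 2 := by omega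
  have h2 : (3 * x + 2) / 3 = x := by omega
  simp [tmap, h1, h2]

theorem mod_three (x : ℕ) : (∃ y, x = 3 * y) ∨ (∃ y, x = 3 * y + 1) ∨ ∃ y, x = 3 * y + 2 := by
  have : x % 3 = 0 ∨ x % 3 = 1 ∨ x % 3 = 2 := by omega
  rcases this with h | h | h
  · exact Or.inl ⟨x / 3, by omega⟩
  · exact Or.inr (Or.inl ⟨x / 3, by omega⟩)
  · exact Or.inr (Or.inr ⟨x / 3, by omega⟩)

theorem not_C_elt_even {σ : Side} {x k : ℕ} : ¬ S.C (elt σ x) (2 * k) := fun h => by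
  have := C_even_right.1 h
  have := elt_mod σ x
  omega

theorem not_C_even_elt {σ : Side} {x k : ℕ} : ¬ S.C (2 * k) (elt σ x) :=
  fun h => not_C_elt_even (S.C.symm' h)

theorem spread_tmap (σ τ : Side) : Spread (tmap σ τ) := fun n =>
  ⟨3 * n + 2, by rw [tmap_two, blk_even]; omega⟩

theorem hits_tmap_left (σ τ : Side) : Hits S (tmap σ τ) σ := fun y =>
  ⟨3 * y, by rw [tmap_zero]⟩

theorem hits_tmap_right (σ τ : Side) : Hits S (tmap σ τ) τ := fun y =>
  ⟨3 * y + 1, by rw [tmap_one]⟩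

theorem C_even_even {k l : ℕ} : S.C (2 * k) (2 * l) ↔ k = l := by
  rw [C_even_left]
  omega

/-- Preimages of points on the two sides are found by search; for the copy of `Id`, values in
strictly increasing blocks beyond those of `σ` and `τ` are used. -/
theorem Hits.reducible {φ : ℕ → ℕ} (hφ : Computable φ) {σ τ : Side} (hσ : Hits S φ σ)
    (hτ : Hits S φ τ) (hs : Spread φ) : Reducible (S.pull (tmap σ τ)) (S.pull φ) := by
  obtain ⟨f, hf, hfp⟩ := exists_computable_select (p := fun y x => S.C (φ x) (elt σ y))
    (by fun_prop) hσ
  obtain ⟨g, hg, hgp⟩ := exists_computable_select (p := fun y x => S.C (φ x) (elt τ y))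
    (by fun_prop) hτ
  obtain ⟨h, hh, hhM, hhi⟩ := hs.exists_increasing hφ (2 * σ.1 + 2 * τ.1 + 1)
  have hbf : ∀ y, blk (φ (f y)) = 2 * σ.1 + 1 := fun y => by rw [blk_eq_of_C (hfp y), blk_elt]
  have hbg : ∀ y, blk (φ (g y)) = 2 * τ.1 + 1 := fun y => by rw [blk_eq_of_C (hgp y), blk_elt]
  refine ⟨fun x => if x % 3 = 0 then f (x / 3) else if x % 3 = 1 then g (x / 3) else h (x / 3),
    by fun_prop, ?_⟩
  set k : ℕ → ℕ := fun x => if x % 3 = 0 then f (x / 3) else if x % 3 = 1 then g (x / 3)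
    else h (x / 3) with hk
  have k0 : ∀ x, k (3 * x) = f x := fun x => by simp [hk]
  have k1 : ∀ x, k (3 * x + 1) = g x := fun x => by
    have h1 : (3 * x + 1) % 3 = 1 := by omega
    have h2 : (3 * x + 1) / 3 = x := by omega
    simp [hk, h1, h2]
  have k2 : ∀ x, k (3 * x + 2) = h x := fun x => by
    have h1 : (3 * x + 2) % 3 = 2 := by omega
    have h2 : (3 * x + 2) / 3 = x := by omega
    simp [hk, h1, h2]
  have main : ∀ x, ((∃ ρ y, tmap σ τ x = elt ρ y) ∧ S.C (φ (k x)) (tmap σ τ x) ∧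
      blk (φ (k x)) ≤ 2 * σ.1 + 2 * τ.1 + 1) ∨ ∃ y, x = 3 * y + 2 := by
    intro x
    rcases mod_three x with ⟨y, rfl⟩ | ⟨y, rfl⟩ | ⟨y, rfl⟩
    · left
      rw [tmap_zero, k0, hbf]
      exact ⟨⟨_, _, rfl⟩, hfp y, by omega⟩
    · left
      rw [tmap_one, k1, hbg]
      exact ⟨⟨_, _, rfl⟩, hgp y, by omega⟩
    · exact Or.inr ⟨y, rfl⟩
  intro x y
  rw [pull_apply, pull_apply]
  rcases main x with ⟨⟨ρ, a, ha⟩, hx, hbx⟩ | ⟨a, rfl⟩ <;>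
    rcases main y with ⟨⟨ρ', b, hb⟩, hy, hby⟩ | ⟨b, rfl⟩
  · exact ⟨fun h => S.C.trans' hx (S.C.trans' h (S.C.symm' hy)),
      fun h => S.C.trans' (S.C.symm' hx) (S.C.trans' h hy)⟩
  · rw [tmap_two, ha, k2]
    refine ⟨fun h => (not_C_elt_even h).elim, fun h => ?_⟩
    have := blk_eq_of_C h
    have := hhM b
    omega
  · rw [tmap_two, hb, k2]
    refine ⟨fun h => (not_C_even_elt h).elim, fun h => ?_⟩
    have := blk_eq_of_C h
    have := hhM a
    omega
  · rw [tmap_two, tmap_two, k2, k2, C_even_left]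
    constructor
    · intro h
      obtain rfl : a = b := by omega
      exact S.C.refl' _
    · intro h
      have hb := blk_eq_of_C h
      rcases lt_trichotomy a b with h1 | rfl | h1
      · exact absurd hb (hhi _ _ h1).ne
      · rfl
      · exact absurd hb (hhi _ _ h1).ne'

/-- A side of which not all classes are met contributes only finitely many classes, and
`exists_pull_remove` moves these to even numbers or to values used elsewhere. -/
theorem sides_cases {φ : ℕ → ℕ} (hφ : Computable φ) {σ τ : Side}
    (h : ∀ x, φ x % 2 = 0 ∨ ∃ y, φ x = tmap σ τ y) :
    (Hits S φ σ ∧ Hits S φ τ) ∨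
    (Hits S φ σ ∧ Reducible (S.pull φ) (S.pull (tmap σ σ))) ∨
    (Hits S φ τ ∧ Reducible (S.pull φ) (S.pull (tmap τ τ))) ∨
    Reducible (S.pull φ) ⊥ := by
  have h' : ∀ x, (∃ k, φ x = 2 * k) ∨ (∃ k, φ x = elt σ k) ∨ ∃ k, φ x = elt τ k := by
    intro x
    rcases h x with h1 | ⟨y, hy⟩
    · exact Or.inl ⟨φ x / 2, by omega⟩
    · rcases mod_three y with ⟨z, rfl⟩ | ⟨z, rfl⟩ | ⟨z, rfl⟩
      · exact Or.inr (Or.inl ⟨z, by rw [hy, tmap_zero]⟩)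
      · exact Or.inr (Or.inr ⟨z, by rw [hy, tmap_one]⟩)
      · exact Or.inl ⟨z, by rw [hy, tmap_two]⟩
  let D : Side → ℕ → Prop := fun σ x => φ x % 2 = 1 ∧ sideOf (φ x) = σ
  have hD : ∀ σ, ComputablePred (D σ) := fun σ => by
    change ComputablePred fun x => φ x % 2 = 1 ∧ sideOf (φ x) = σ
    fun_prop
  have hDelt : ∀ {σ x k}, φ x = elt σ k → D σ x := fun {σ x k} hx => by simp [D, hx]
  have aux : ∀ σ, Hits S φ σ ∨ ∃ L : List ℕ, ∀ x, D σ x → ∃ a ∈ L, S.C (φ x) a := by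
    intro σ
    rcases hits_or_finite (S := S) hφ (hD σ).to_re σ (fun x hx => hx) with h1 | h1
    · exact Or.inl fun y => (h1 y).imp fun x hx => hx.2
    · exact Or.inr h1
  have key : ∀ {σ τ : Side}, (∀ x, (∃ k, φ x = 2 * k) ∨ (∃ k, φ x = elt σ k) ∨
      ∃ k, φ x = elt τ k) → (∃ L : List ℕ, ∀ x, D τ x → ∃ a ∈ L, S.C (φ x) a) →
      Reducible (S.pull φ) (S.pull (tmap σ σ)) := by
    rintro σ τ h2 ⟨L, hL⟩
    obtain ⟨φ', hφ', he, hr⟩ := exists_pull_remove hφ (hD τ) hL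
    rw [he]
    refine reducible_pull hφ' (computable_tmap σ σ) fun x => ?_
    have h3 : (∃ k, φ' x = 2 * k) ∨ ∃ k, φ' x = elt σ k := by
      rcases hr x with h4 | ⟨y, hy, h4⟩
      · exact Or.inl ⟨φ' x / 2, by omega⟩
      · rw [h4]
        rcases h2 y with h5 | h5 | ⟨k, h5⟩
        · exact Or.inl h5
        · exact Or.inr h5
        · exact (hy (hDelt h5)).elim
    rcases h3 with ⟨k, hk⟩ | ⟨k, hk⟩
    · exact ⟨3 * k + 2, by rw [tmap_two, hk]⟩
    · exact ⟨3 * k, by rw [tmap_zero, hk]⟩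
  rcases aux σ with h1 | ⟨L₁, h1⟩ <;> rcases aux τ with h2 | ⟨L₂, h2⟩
  · exact Or.inl ⟨h1, h2⟩
  · exact Or.inr (Or.inl ⟨h1, key h' ⟨L₂, h2⟩⟩)
  · exact Or.inr (Or.inr (Or.inl ⟨h2, key (fun x => by have := h' x; tauto) ⟨L₁, h1⟩⟩))
  · right; right; right
    obtain ⟨φ', hφ', he, hr⟩ := exists_pull_remove (S := S) hφ (D := fun x => D σ x ∨ D τ x)
      (by have := hD σ; have := hD τ; fun_prop) (L := L₁ ++ L₂) (fun x hx => by
        rcases hx with hx | hx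
        · obtain ⟨a, ha, h3⟩ := h1 x hx
          exact ⟨a, List.mem_append_left _ ha, h3⟩
        · obtain ⟨a, ha, h3⟩ := h2 x hx
          exact ⟨a, List.mem_append_right _ ha, h3⟩)
    rw [he]
    have heven : ∀ x, ∃ k, φ' x = 2 * k := by
      intro x
      rcases hr x with h4 | ⟨y, hy, h4⟩
      · exact ⟨φ' x / 2, by omega⟩
      · rw [h4]
        rcases h' y with h5 | ⟨k, h5⟩ | ⟨k, h5⟩
        · exact h5
        · exact (hy (Or.inl (hDelt h5))).elim
        · exact (hy (Or.inr (hDelt h5))).elim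
    refine ⟨φ', hφ', fun x y => ?_⟩
    rw [pull_apply]
    obtain ⟨k, hk⟩ := heven x
    rw [hk, C_even_left]
    rfl

theorem pull_tmap_congr {σ τ σ' τ' : Side} (hσ : styp σ = styp σ') (hτ : styp τ = styp τ')
    (h : ∀ x y, S.C (elt σ x) (elt τ y) ↔ S.C (elt σ' x) (elt τ' y)) :
    S.pull (tmap σ τ) = S.pull (tmap σ' τ') := by
  ext x y
  rw [pull_apply, pull_apply]
  rcases mod_three x with ⟨a, rfl⟩ | ⟨a, rfl⟩ | ⟨a, rfl⟩ <;>
    rcases mod_three y with ⟨b, rfl⟩ | ⟨b, rfl⟩ | ⟨b, rfl⟩ <;>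
    simp only [tmap_zero, tmap_one, tmap_two, C_elt_same, hσ, hτ, h, not_C_elt_even,
      not_C_even_elt, C_even_even]
  rw [S.C.comm', h, S.C.comm']

variable (S) in
/-- The degree generated by a side. -/
def sideDeg (σ τ : Side) : IDegree := S.deg (tmap σ τ) (computable_tmap σ τ)

theorem deg_congr {φ ψ : ℕ → ℕ} {hφ : Computable φ} {hψ : Computable ψ}
    (h : S.pull φ = S.pull ψ) : S.deg φ hφ = S.deg ψ hψ := by
  unfold deg ceer
  congr 2

theorem sideDeg_self_congr {σ σ' : Side} (h : styp σ = styp σ') :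
    S.sideDeg σ σ = S.sideDeg σ' σ' :=
  deg_congr (pull_tmap_congr h h fun x y => by rw [C_elt_same, C_elt_same, h])

theorem isLight_sideDeg (σ τ : Side) : IDegree.IsLight (S.sideDeg σ τ) :=
  isLight_deg_iff.2 (spread_tmap σ τ)

theorem sideDeg_le_of_hits {φ : ℕ → ℕ} {hφ : Computable φ} {σ τ : Side} (hσ : Hits S φ σ)
    (hτ : Hits S φ τ) (hs : Spread φ) : S.sideDeg σ τ ≤ S.deg φ hφ :=
  deg_le_deg.2 (hσ.reducible hφ hτ hs).reducibleI

theorem eq_of_le_sideDeg {d : IDegree} {σ τ : Side} (h : d ≤ S.sideDeg σ τ)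
    (hd : IDegree.IsLight d) :
    d = S.sideDeg σ τ ∨ d = S.sideDeg σ σ ∨ d = S.sideDeg τ τ ∨ d = degI idCeer := by
  obtain ⟨φ, hφ, rfl, hr⟩ := exists_deg_eq h
  have hs := isLight_deg_iff.1 hd
  rcases sides_cases (S := S) hφ hr with ⟨h1, h2⟩ | ⟨h1, h2⟩ | ⟨h1, h2⟩ | h1
  · exact Or.inl (le_antisymm h (sideDeg_le_of_hits h1 h2 hs))
  · exact Or.inr (Or.inl (le_antisymm (deg_le_deg.2 h2.reducibleI) (sideDeg_le_of_hits h1 h1 hs)))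
  · exact Or.inr (Or.inr (Or.inl (le_antisymm (deg_le_deg.2 h2.reducibleI)
      (sideDeg_le_of_hits h1 h1 hs))))
  · exact Or.inr (Or.inr (Or.inr (le_antisymm (degI_le_degI.2 h1.reducibleI) (isLight_iff.1 hd))))

theorem exists_side_left {φ : ℕ → ℕ} (hφ : Computable φ) {σ τ : Side}
    (h : S.pull (tmap σ τ) = S.pull φ) : ∃ ρ : Side, styp ρ = styp σ ∧
      Hits S (fun x => φ (3 * x)) ρ ∧ ∀ x, blk (φ (3 * x)) = 2 * ρ.1 + 1 := by
  refine exists_side_of_column (φ := fun x => φ (3 * x)) (by fun_prop) fun x y => ?_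
  rw [← pull_apply, ← h, pull_apply, tmap_zero, tmap_zero, C_elt_same]

theorem exists_side_right {φ : ℕ → ℕ} (hφ : Computable φ) {σ τ : Side}
    (h : S.pull (tmap σ τ) = S.pull φ) : ∃ ρ : Side, styp ρ = styp τ ∧
      Hits S (fun x => φ (3 * x + 1)) ρ ∧ ∀ x, blk (φ (3 * x + 1)) = 2 * ρ.1 + 1 := by
  refine exists_side_of_column (φ := fun x => φ (3 * x + 1)) (by fun_prop) fun x y => ?_
  rw [← pull_apply, ← h, pull_apply, tmap_one, tmap_one, C_elt_same]

/-- Absorption for degrees generated by sides. -/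
theorem exists_pull_sideDeg {σ τ : Side} {g : ℕ → ℕ} {hg : Computable g}
    (h : S.sideDeg σ τ ≤ S.deg g hg) : ∃ φ : ℕ → ℕ, Computable φ ∧
      S.pull (tmap σ τ) = S.pull φ ∧ ∀ x, φ x % 2 = 0 ∨ ∃ y, φ x = g y :=
  exists_pull_of_reducibleI hg (deg_le_deg.1 h)

/-- The column of `σ` reappears on a whole side of the same type by `exists_side_of_column`. That
side lies in an odd block, so its classes come from `g` and not from the added even numbers. -/
theorem exists_hits_of_le {σ τ : Side} {g : ℕ → ℕ} {hg : Computable g}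
    (h : S.sideDeg σ τ ≤ S.deg g hg) : ∃ ρ : Side, styp ρ = styp σ ∧ Hits S g ρ := by
  obtain ⟨φ, hφ, he, hr⟩ := exists_pull_sideDeg h
  obtain ⟨ρ, h1, h2, h3⟩ := exists_side_left hφ he
  refine ⟨ρ, h1, fun y => ?_⟩
  obtain ⟨x, hx⟩ := h2 y
  rcases hr (3 * x) with h4 | ⟨z, hz⟩
  · have := h3 x
    unfold blk at this
    rw [if_pos h4] at this
    omega
  · exact ⟨z, by rw [← hz]; exact hx⟩

theorem styp_of_hits_tmap {σ τ ρ : Side} (h : Hits S (tmap σ τ) ρ) : ρ.1 = σ.1 ∨ ρ.1 = τ.1 := by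
  obtain ⟨x, hx⟩ := h 0
  have := blk_eq_of_C hx
  rcases mod_three x with ⟨z, rfl⟩ | ⟨z, rfl⟩ | ⟨z, rfl⟩
  · rw [tmap_zero, blk_elt, blk_elt] at this
    left; omega
  · rw [tmap_one, blk_elt, blk_elt] at this
    right; omega
  · rw [tmap_two, blk_elt, blk_even] at this
    omega

/-! ### Column degrees and their strongly minimal covers -/

/-- A side carrying the column `c`, in a block carrying only `c`. -/
def diag (c : ℕ) : Side := (Nat.pair c c, false)

theorem styp_diag (c : ℕ) : styp (diag c) = c := by simp [styp, diag]

theorem styp_of_fst_eq_diag {ρ : Side} {c : ℕ} (h : ρ.1 = (diag c).1) : styp ρ = c := by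
  simp [styp, h, diag]

variable (S) in
/-- The light minimal degree given by a column. -/
def vdeg (c : ℕ) : IDegree := S.sideDeg (diag c) (diag c)

theorem sideDeg_self (σ : Side) : S.sideDeg σ σ = S.vdeg (styp σ) :=
  sideDeg_self_congr (styp_diag _).symm

/-- A reduction must use a side of type `c`, but the only odd block available below `vdeg d` is `⟨d,
d⟩`, both of whose sides have type `d`. -/
theorem vdeg_le_iff {c d : ℕ} : S.vdeg c ≤ S.vdeg d ↔ c = d := by
  refine ⟨fun h => ?_, fun h => h ▸ le_rfl⟩
  obtain ⟨ρ, h1, h2⟩ := exists_hits_of_le h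
  rw [← styp_diag c, ← h1]
  rcases styp_of_hits_tmap h2 with h3 | h3 <;> exact styp_of_fst_eq_diag h3

theorem not_vdeg_le_id (c : ℕ) : ¬ S.vdeg c ≤ degI idCeer := by
  intro h
  have hc : Computable fun x : ℕ => 2 * x := by fun_prop
  have hid : degI idCeer = S.deg (fun x => 2 * x) hc := by
    unfold deg ceer idCeer
    congr 2
    ext x y
    rw [pull_apply, C_even_left]
    change x = y ↔ _
    omega
  rw [hid] at h
  obtain ⟨ρ, -, h2⟩ := exists_hits_of_le h
  obtain ⟨x, hx⟩ := h2 0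
  exact not_C_even_elt hx

theorem isLightMinimal_vdeg (c : ℕ) : IsLightMinimal (S.vdeg c) := by
  have hl : IDegree.IsLight (S.vdeg c) := isLight_sideDeg _ _
  refine ⟨hl, lt_of_le_not_ge (isLight_iff.1 hl) (not_vdeg_le_id c), fun x ⟨h1, h2⟩ => ?_⟩
  rcases eq_of_le_sideDeg (S := S) h2.le (isLight_iff.2 h1.le) with rfl | rfl | rfl | rfl
  · exact h2.ne rfl
  · exact h2.ne rfl
  · exact h2.ne rfl
  · exact h1.ne rfl

theorem sideDeg_le_top {σ τ : Side} : S.sideDeg σ τ ≤ S.deg id Computable.id :=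
  deg_le_deg.2 (Reducible.reducibleI ⟨tmap σ τ, computable_tmap σ τ, fun _ _ => Iff.rfl⟩)

theorem incompRel_vdeg {c d : ℕ} (h : c ≠ d) : IncompRel (· ≤ ·) (S.vdeg c) (S.vdeg d) :=
  ⟨fun h1 => h (vdeg_le_iff.1 h1), fun h1 => h (vdeg_le_iff.1 h1).symm⟩

theorem vdeg_le_sideDeg_left (σ τ : Side) : S.vdeg (styp σ) ≤ S.sideDeg σ τ := by
  rw [← sideDeg_self]
  exact sideDeg_le_of_hits (hits_tmap_left σ τ) (hits_tmap_left σ τ) (spread_tmap σ τ)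

theorem vdeg_le_sideDeg_right (σ τ : Side) : S.vdeg (styp τ) ≤ S.sideDeg σ τ := by
  rw [← sideDeg_self]
  exact sideDeg_le_of_hits (hits_tmap_right σ τ) (hits_tmap_right σ τ) (spread_tmap σ τ)

theorem isCover_sideDeg {σ τ : Side} (h : styp σ ≠ styp τ) :
    IsLightStronglyMinimalCover (S.sideDeg σ τ) (S.vdeg (styp σ)) (S.vdeg (styp τ)) := by
  have hl := vdeg_le_sideDeg_left (S := S) σ τ
  have hr := vdeg_le_sideDeg_right (S := S) σ τ
  refine ⟨isLight_sideDeg _ _, incompRel_vdeg h, lt_of_le_not_ge hl fun h1 => ?_,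
    lt_of_le_not_ge hr fun h1 => ?_, fun x hx hlt => ?_⟩
  · exact h (vdeg_le_iff.1 (hr.trans h1)).symm
  · exact h (vdeg_le_iff.1 (hl.trans h1))
  · rcases eq_of_le_sideDeg hlt.le hx with h1 | h1 | h1 | h1
    · exact (hlt.ne h1).elim
    · exact Or.inl (h1.trans (sideDeg_self _))
    · exact Or.inr (Or.inl (h1.trans (sideDeg_self _)))
    · exact Or.inr (Or.inr h1)

/-- The strong covers of two column degrees are generated by two sides. -/
theorem eq_sideDeg_of_isCover {c d : ℕ} {a : IDegree} (ha : a ≤ S.deg id Computable.id)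
    (h : IsLightStronglyMinimalCover a (S.vdeg c) (S.vdeg d)) :
    ∃ σ τ : Side, styp σ = c ∧ styp τ = d ∧ a = S.sideDeg σ τ := by
  obtain ⟨φ, hφ, rfl, -⟩ := exists_deg_eq ha
  obtain ⟨hl, hinc, h1, h2, hmin⟩ := h
  obtain ⟨σ, hσ, hσh⟩ := exists_hits_of_le h1.le
  obtain ⟨τ, hτ, hτh⟩ := exists_hits_of_le h2.le
  rw [styp_diag] at hσ hτ
  refine ⟨σ, τ, hσ, hτ, ?_⟩
  have hle : S.sideDeg σ τ ≤ S.deg φ hφ := sideDeg_le_of_hits hσh hτh (isLight_deg_iff.1 hl)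
  have hvc := vdeg_le_sideDeg_left (S := S) σ τ
  have hvd := vdeg_le_sideDeg_right (S := S) σ τ
  rw [hσ] at hvc
  rw [hτ] at hvd
  rcases hle.lt_or_eq with hlt | heq
  · rcases hmin _ (isLight_sideDeg _ _) hlt with h3 | h3 | h3
    · exact (hinc.2 (hvd.trans h3.le)).elim
    · exact (hinc.1 (hvc.trans h3.le)).elim
    · exact (not_vdeg_le_id c (hvc.trans h3.le)).elim
  · exact heq.symm

/-- Without gluing the generated relation is the disjoint sum of two columns and `Id`, so only the
types matter. -/
theorem sideDeg_congr {σ τ σ' τ' : Side} (hσ : styp σ = styp σ') (hτ : styp τ = styp τ')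
    (hne : styp σ ≠ styp τ) (h1 : σ.1 = τ.1 → ¬ S.Glued σ) (h2 : σ'.1 = τ'.1 → ¬ S.Glued σ') :
    S.sideDeg σ τ = S.sideDeg σ' τ' := by
  refine deg_congr (pull_tmap_congr hσ hτ fun x y => ?_)
  rw [C_elt, C_elt]
  constructor
  · rintro (⟨rfl, -⟩ | ⟨h3, -, h4, -⟩)
    · exact (hne rfl).elim
    · exact (h1 h3 h4).elim
  · rintro (⟨rfl, -⟩ | ⟨h3, -, h4, -⟩)
    · exact (hne (hσ.trans hτ.symm)).elim
    · exact (h2 h3 h4).elim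

/-- Any reduction carries each column onto all classes of a side of the same type. From the unglued
to the glued relation, both columns then meet the joined base class, although no two of their points
are equivalent. In the other direction, equivalent base points would have to be sent to the
different blocks `⟨c, c⟩` and `⟨d, d⟩`. -/
theorem incompRel_sideDeg {c d : ℕ} (hne : c ≠ d) (hE : S.E c d) :
    IncompRel (· ≤ ·) (S.sideDeg (diag c) (diag d))
      (S.sideDeg (Nat.pair c d, false) (Nat.pair c d, true)) := by
  have hglue : S.C (elt (Nat.pair c d, false) 0) (elt (Nat.pair c d, true) 0) := by
    rw [C_elt]
    refine Or.inr ⟨rfl, by simp, ?_, S.R.refl' _, S.R.refl' _⟩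
    simpa [Glued] using hE
  have hdd : (diag c).1 ≠ (diag d).1 := fun h => hne (by
    rw [← styp_diag c]
    exact styp_of_fst_eq_diag h)
  constructor
  · intro h
    obtain ⟨φ, hφ, he, hr⟩ := exists_pull_sideDeg h
    have hblk : ∀ ρ : Side, ∀ x, blk (φ x) = 2 * ρ.1 + 1 → ρ.1 = Nat.pair c d := by
      intro ρ x hx
      rcases hr x with h4 | ⟨y, hy⟩
      · unfold blk at hx
        rw [if_pos h4] at hx
        omega
      · rw [hy] at hx
        rcases mod_three y with ⟨z, rfl⟩ | ⟨z, rfl⟩ | ⟨z, rfl⟩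
        · rw [tmap_zero, blk_elt] at hx
          simp only at hx
          omega
        · rw [tmap_one, blk_elt] at hx
          simp only at hx
          omega
        · rw [tmap_two, blk_even] at hx
          omega
    obtain ⟨⟨q, i⟩, h1, h2, h3⟩ := exists_side_left hφ he
    obtain ⟨⟨q', i'⟩, h1', h2', h3'⟩ := exists_side_right hφ he
    obtain rfl : q = Nat.pair c d := hblk _ _ (h3 0)
    obtain rfl : q' = Nat.pair c d := hblk _ _ (h3' 0)
    rw [styp_diag] at h1 h1'
    have hi : i = false := by
      cases i
      · rfl
      · simp [styp] at h1
        exact (hne h1.symm).elim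
    have hi' : i' = true := by
      cases i'
      · simp [styp] at h1'
        exact (hne h1').elim
      · rfl
    subst hi hi'
    obtain ⟨x, hx⟩ := h2 0
    obtain ⟨y, hy⟩ := h2' 0
    have hc : S.pull φ (3 * x) (3 * y + 1) :=
      S.C.trans' hx (S.C.trans' hglue (S.C.symm' hy))
    rw [← he, pull_apply, tmap_zero, tmap_one] at hc
    have := blk_eq_of_C hc
    rw [blk_elt, blk_elt] at this
    exact hdd (by omega)
  · intro h
    obtain ⟨φ, hφ, he, hr⟩ := exists_pull_sideDeg h
    have hblk : ∀ ρ : Side, ∀ x, blk (φ x) = 2 * ρ.1 + 1 → ρ.1 = (diag (styp ρ)).1 := by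
      intro ρ x hx
      have : ρ.1 = (diag c).1 ∨ ρ.1 = (diag d).1 := by
        rcases hr x with h4 | ⟨y, hy⟩
        · unfold blk at hx
          rw [if_pos h4] at hx
          omega
        · rw [hy] at hx
          rcases mod_three y with ⟨z, rfl⟩ | ⟨z, rfl⟩ | ⟨z, rfl⟩
          · rw [tmap_zero, blk_elt] at hx
            left; omega
          · rw [tmap_one, blk_elt] at hx
            right; omega
          · rw [tmap_two, blk_even] at hx
            omega
      rcases this with h5 | h5
      · rw [styp_of_fst_eq_diag h5, h5]
      · rw [styp_of_fst_eq_diag h5, h5]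
    obtain ⟨ρ, h1, -, h3⟩ := exists_side_left hφ he
    obtain ⟨ρ', h1', -, h3'⟩ := exists_side_right hφ he
    have hc : S.pull φ (3 * 0) (3 * 0 + 1) := by
      rw [← he, pull_apply, tmap_zero, tmap_one]
      exact hglue
    have hb := blk_eq_of_C (pull_apply.1 hc)
    rw [h3, h3'] at hb
    have e1 := hblk _ _ (h3 0)
    have e2 := hblk _ _ (h3' 0)
    have t1 : styp ρ = c := by rw [h1]; simp [styp]
    have t2 : styp ρ' = d := by rw [h1']; simp [styp]
    rw [t1] at e1
    rw [t2] at e2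
    exact hdd (by rw [← e1, ← e2]; omega)

end Setup

end CeerDegrees

namespace CeerDegrees

/-! ### Comparable pairs -/

/-- The point on whose equivalence to `cv n m` that of `n` and `m` depends. -/
def cu (n m : ℕ) : ℕ := if (sideOf n).2 = (sideOf m).2 then pt n else zp n

def cv (n m : ℕ) : ℕ := if (sideOf n).2 = (sideOf m).2 then pt m else pt n

/-- The pairs which have to be merged before `n` and `m` can be equivalent. -/
def cL (n m : ℕ) : List (ℕ × ℕ) := if (sideOf n).2 = (sideOf m).2 then [] else [(pt m, zp m)]

/-- A merge which makes `cu n m` equivalent to the point with index `0`. -/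
def cM (n m : ℕ) : ℕ × ℕ :=
  if (sideOf n).2 = (sideOf m).2 then (pt n, zp n) else (pt m, zp m)

section
variable {α : Type} [Primcodable α] {f g : α → ℕ}

@[fun_prop] theorem computable_cu (hf : Computable f) (hg : Computable g) :
    Computable fun a => cu (f a) (g a) := by unfold cu; fun_prop

@[fun_prop] theorem computable_cv (hf : Computable f) (hg : Computable g) :
    Computable fun a => cv (f a) (g a) := by unfold cv; fun_prop

@[fun_prop] theorem computable_cL (hf : Computable f) (hg : Computable g) :
    Computable fun a => cL (f a) (g a) := by unfold cL; fun_prop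

@[fun_prop] theorem computable_cM (hf : Computable f) (hg : Computable g) :
    Computable fun a => cM (f a) (g a) := by unfold cM; fun_prop

end

namespace Setup

variable {S : Setup}

variable (S) in
/-- `n` and `m` are odd numbers whose equivalence depends on the generic relation. -/
def Comp (n m : ℕ) : Prop := n % 2 = 1 ∧ m % 2 = 1 ∧ (sideOf n).1 = (sideOf m).1 ∧
  ((sideOf n).2 = (sideOf m).2 ∨ S.Glued (sideOf n))

@[fun_prop] theorem computablePred_comp' {α : Type} [Primcodable α] {f g : α → ℕ}
    (hf : Computable f) (hg : Computable g) : ComputablePred fun a => S.Comp (f a) (g a) := by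
  have := S.computablePred_glued
  unfold Comp
  fun_prop

@[fun_prop] theorem repred_merged {α : Type} [Primcodable α] {f g : α → ℕ}
    (hf : Computable f) (hg : Computable g) :
    REPred fun a => ∀ p ∈ cL (f a) (g a), S.R p.1 p.2 :=
  repred_forall_mem (by fun_prop) (by fun_prop)

theorem styp_ne_of_glued {q : ℕ} {s : Bool} (h : S.Glued (q, s)) : styp (q, s) ≠ styp (q, !s) := by
  intro he
  have h' : S.E q.unpair.1 q.unpair.2 := h
  cases s <;> simp [styp] at he
  · rw [he] at h'
    exact S.irrefl _ h'
  · rw [he] at h'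
    exact S.irrefl _ h'

theorem Comp.cases {n m : ℕ} (h : S.Comp n m) :
    (∃ σ x y, n = elt σ x ∧ m = elt σ y ∧ cu n m = Nat.pair (styp σ) x ∧
      cv n m = Nat.pair (styp σ) y ∧ cL n m = [] ∧
      cM n m = (Nat.pair (styp σ) x, Nat.pair (styp σ) 0)) ∨
    (∃ q s x y, n = elt (q, s) x ∧ m = elt (q, !s) y ∧ S.Glued (q, s) ∧
      cu n m = Nat.pair (styp (q, s)) 0 ∧ cv n m = Nat.pair (styp (q, s)) x ∧
      cL n m = [(Nat.pair (styp (q, !s)) y, Nat.pair (styp (q, !s)) 0)] ∧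
      cM n m = (Nat.pair (styp (q, !s)) y, Nat.pair (styp (q, !s)) 0)) := by
  obtain ⟨h1, h2, h3, h4⟩ := h
  have hn := eq_elt_of_odd h1
  have hm := eq_elt_of_odd h2
  by_cases hs : (sideOf n).2 = (sideOf m).2
  · left
    have hσ : sideOf n = sideOf m := Prod.ext h3 hs
    rw [← hσ] at hm
    refine ⟨sideOf n, idx n, idx m, hn, hm, ?_, ?_, ?_, ?_⟩
    · simp only [cu, if_pos hs, pt]
    · rw [cv, if_pos hs, pt, hσ]
    · simp only [cL, if_pos hs]
    · simp only [cM, if_pos hs, pt, zp]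
  · right
    have hσ : sideOf m = ((sideOf n).1, !(sideOf n).2) := by
      refine Prod.ext h3.symm ?_
      revert hs
      cases (sideOf n).2 <;> cases (sideOf m).2 <;> simp
    refine ⟨(sideOf n).1, (sideOf n).2, idx n, idx m, hn, hσ ▸ hm, h4.resolve_left hs, ?_, ?_,
      ?_, ?_⟩
    · simp only [cu, if_neg hs, zp]
    · simp only [cv, if_neg hs, pt]
    · rw [cL, if_neg hs, pt, zp, hσ]
    · rw [cM, if_neg hs, pt, zp, hσ]

theorem comp_same {σ : Side} {x y : ℕ} : S.Comp (elt σ x) (elt σ y) := by simp [Comp]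

theorem comp_cross {q : ℕ} {s : Bool} {x y : ℕ} (h : S.Glued (q, s)) :
    S.Comp (elt (q, s) x) (elt (q, !s) y) := by simp [Comp, h]

theorem eq_or_comp_of_C {n m : ℕ} (h : S.C n m) : n = m ∨ S.Comp n m := by
  rcases even_or_elt n with ⟨k, rfl⟩ | ⟨σ, x, rfl⟩
  · exact Or.inl (C_even_left.1 h)
  · rcases even_or_elt m with ⟨k, rfl⟩ | ⟨τ, y, rfl⟩
    · exact Or.inl (C_even_right.1 h)
    · right
      rcases C_elt.1 h with ⟨rfl, -⟩ | ⟨h1, -, h2, -⟩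
      · exact comp_same
      · simp [Comp, h1, h2]

theorem C_cross {q : ℕ} {s : Bool} {x y : ℕ} (h : S.Glued (q, s)) :
    S.C (elt (q, s) x) (elt (q, !s) y) ↔
      S.R (Nat.pair (styp (q, s)) x) (Nat.pair (styp (q, s)) 0) ∧
      S.R (Nat.pair (styp (q, !s)) y) (Nat.pair (styp (q, !s)) 0) := by
  rw [C_elt]
  simp [h]

/-- On opposite sides, equivalence requires both points to be equivalent to their base points. Once
the condition for `m` is fulfilled through `cL`, a single question about the column of `n` remains.
-/
theorem Comp.C_iff {n m : ℕ} (h : S.Comp n m) (hL : ∀ p ∈ cL n m, S.R p.1 p.2) :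
    S.C n m ↔ S.R (cu n m) (cv n m) := by
  rcases h.cases with ⟨σ, x, y, rfl, rfl, h1, h2, -, -⟩ | ⟨q, s, x, y, rfl, rfl, hg, h1, h2, h3, -⟩
  · rw [h1, h2, C_elt_same]
  · rw [h1, h2, C_cross hg, S.R.comm']
    rw [h3] at hL
    exact and_iff_left (hL _ (List.mem_singleton.2 rfl))

theorem Comp.blk_eq {n m : ℕ} (h : S.Comp n m) : blk n = blk m := by
  obtain ⟨h1, h2, h3, -⟩ := h
  simp [blk, h1, h2, h3]

theorem Comp.col_cu {n m : ℕ} (h : S.Comp n m) : col (cu n m) = styp (sideOf n) := by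
  rcases h.cases with ⟨σ, x, y, rfl, rfl, h1, -⟩ | ⟨q, s, x, y, rfl, rfl, -, h1, -⟩ <;>
    rw [h1] <;> simp

theorem Comp.col_cv {n m : ℕ} (h : S.Comp n m) : col (cv n m) = styp (sideOf n) := by
  rcases h.cases with ⟨σ, x, y, rfl, rfl, -, h1, -⟩ | ⟨q, s, x, y, rfl, rfl, -, -, h1, -⟩ <;>
    rw [h1] <;> simp

theorem col_of_mem_cL {n m : ℕ} {p : ℕ × ℕ} (h : p ∈ cL n m) : col p.1 = col p.2 := by
  unfold cL at h
  split_ifs at h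
  · simp at h
  · obtain rfl := List.mem_singleton.1 h
    simp [pt, zp]

theorem col_cM (n m : ℕ) : col (cM n m).1 = col (cM n m).2 := by
  unfold cM
  split_ifs <;> simp [pt, zp]

/-- The two columns carried by the block of `n`. -/
def btypes (n : ℕ) : List ℕ := [(sideOf n).1.unpair.1, (sideOf n).1.unpair.2]

theorem styp_mem_btypes (n : ℕ) : styp (sideOf n) ∈ btypes n := by
  unfold styp btypes
  split_ifs <;> simp

/-! ### Incomparable parts from infinitely many separated pairs -/

/-- The values of `n` and `m` at the arguments given by `T`, interleaved. -/
def zig (n m T : ℕ → ℕ) (x : ℕ) : ℕ := if x % 2 = 0 then n (T (x / 2)) else m (T (x / 2))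

theorem zig_even (n m T : ℕ → ℕ) (x : ℕ) : zig n m T (2 * x) = n (T x) := by simp [zig]

theorem zig_odd (n m T : ℕ → ℕ) (x : ℕ) : zig n m T (2 * x + 1) = m (T x) := by
  have h1 : (2 * x + 1) % 2 = 1 := by omega
  have h2 : (2 * x + 1) / 2 = x := by omega
  simp [zig, h1, h2]

theorem zig_eq (n m T : ℕ → ℕ) (x : ℕ) :
    zig n m T x = n (T (x / 2)) ∨ zig n m T x = m (T (x / 2)) := by
  unfold zig
  split_ifs
  · exact Or.inl rfl
  · exact Or.inr rfl

variable {n m : ℕ → ℕ} {A : ℕ → Prop}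

theorem computable_zig {T : ℕ → ℕ} (hn : Computable n) (hm : Computable m) (hT : Computable T) :
    Computable (zig n m T) := by
  unfold zig
  fun_prop

/-- Pairs with separate columns whose merging conditions are fulfilled. -/
structure Separated (S : Setup) (n m : ℕ → ℕ) (A : ℕ → Prop) : Prop where
  comp : ∀ t, A t → S.Comp (n t) (m t)
  merged : ∀ t, A t → ∀ p ∈ cL (n t) (m t), S.R p.1 p.2
  sep : ∀ t t', A t → A t' → t < t' → styp (sideOf (n t')) ∉ btypes (n t)

theorem Separated.styp_inj (h : Separated S n m A) {t t' : ℕ} (ht : A t) (ht' : A t')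
    (he : styp (sideOf (n t)) = styp (sideOf (n t'))) : t = t' := by
  rcases lt_trichotomy t t' with h1 | h1 | h1
  · exact (h.sep t t' ht ht' h1 (he ▸ styp_mem_btypes _)).elim
  · exact h1
  · exact (h.sep t' t ht' ht h1 (he ▸ styp_mem_btypes _)).elim

theorem Separated.blk_inj (h : Separated S n m A) {t t' : ℕ} (ht : A t) (ht' : A t')
    (he : blk (n t) = blk (n t')) : t = t' := by
  have hb : btypes (n t) = btypes (n t') := by
    have h1 := (h.comp t ht).1
    have h2 := (h.comp t' ht').1
    simp only [blk, h1, h2] at he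
    have : (sideOf (n t)).1 = (sideOf (n t')).1 := by
      simp only [one_ne_zero, if_false] at he
      omega
    simp [btypes, this]
  rcases lt_trichotomy t t' with h1 | h1 | h1
  · exact (h.sep t t' ht ht' h1 (hb ▸ styp_mem_btypes _)).elim
  · exact h1
  · exact (h.sep t' t ht' ht h1 (hb ▸ styp_mem_btypes _)).elim

theorem Separated.spread (h : Separated S n m A) {T : ℕ → ℕ} (hT : ∀ x, A (T x))
    (hv : ∀ r, ∃ x, r ≤ T x) : Spread (zig n m T) := by
  intro N
  by_contra! hcon
  have hfin : (Set.range T).Finite := by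
    refine Set.Finite.of_finite_image (f := fun t => blk (n t))
      ((Set.finite_lt_nat N).subset ?_) ?_
    · rintro _ ⟨_, ⟨x, rfl⟩, rfl⟩
      have := hcon (2 * x)
      rwa [zig_even] at this
    · rintro _ ⟨x, rfl⟩ _ ⟨y, rfl⟩ hxy
      exact h.blk_inj (hT x) (hT y) hxy
  obtain ⟨b, hb⟩ := hfin.bddAbove
  obtain ⟨x, hx⟩ := hv (b + 1)
  have := hb ⟨x, rfl⟩
  omega

/-- A reduction would make the question at `T x` equivalent to a question at some `T' y`, or to a
trivial one. Since `T x ≠ T' y` gives different columns, genericity can answer the first positively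
without answering the second. -/
theorem Separated.not_reducibleI (h : Separated S n m A) (hn : Computable n) (hm : Computable m)
    {T T' : ℕ → ℕ} (hTc : Computable T) (hTc' : Computable T') (hT : ∀ x, A (T x))
    (hT' : ∀ x, A (T' x)) (hd : ∀ x y, T x ≠ T' y)
    (hv : ∀ r, ∃ x, r ≤ T x ∧ ¬ S.R (cu (n (T x)) (m (T x))) (cv (n (T x)) (m (T x)))) :
    ¬ ReducibleI (S.pull (zig n m T)) (S.pull (zig n m T')) := by
  intro hred
  obtain ⟨ψ, hψ, he, hr⟩ := exists_pull_of_reducibleI (computable_zig hn hm hTc') hred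
  have hC : ∀ x, S.C (ψ (2 * x)) (ψ (2 * x + 1)) ↔
      S.R (cu (n (T x)) (m (T x))) (cv (n (T x)) (m (T x))) := by
    intro x
    rw [← pull_apply, ← he, pull_apply, zig_even, zig_odd]
    exact (h.comp _ (hT x)).C_iff (h.merged _ (hT x))
  -- Request: merge the pair at `T x`. If its images lie in different blocks nothing has to be kept
  -- apart; if they are the pair at `T' y`, that pair has to be kept apart. Success contradicts the
  -- reduction at once.
  rcases S.gen.static (S := fun X => ∃ x, X.1 = [(cu (n (T x)) (m (T x)), cv (n (T x)) (m (T x)))] ∧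
      ((¬ blk (ψ (2 * x)) = blk (ψ (2 * x + 1)) ∧ X.2 = []) ∨
        ∃ y, ((ψ (2 * x) = n (T' y) ∧ ψ (2 * x + 1) = m (T' y)) ∨
          (ψ (2 * x) = m (T' y) ∧ ψ (2 * x + 1) = n (T' y))) ∧
          X.2 = [[(cu (n (T' y)) (m (T' y)), cv (n (T' y)) (m (T' y)))]]))
    (by fun_prop) (by
      rintro X ⟨x, hx, -⟩ p hp
      rw [hx] at hp
      obtain rfl := List.mem_singleton.1 hp
      exact (h.comp _ (hT x)).col_cu.trans (h.comp _ (hT x)).col_cv.symm) with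
    ⟨X, ⟨x, hx, hX⟩, h1, h2⟩ | ⟨r, hrr⟩
  · rw [hx] at h1
    have h3 := (hC x).2 (h1 _ (List.mem_singleton.2 rfl))
    rcases hX with ⟨h4, -⟩ | ⟨y, h4, h5⟩
    · exact h4 (blk_eq_of_C h3)
    · rw [h5] at h2
      obtain ⟨p, hp, hpn⟩ := h2 _ (List.mem_singleton.2 rfl)
      obtain rfl := List.mem_singleton.1 hp
      refine hpn (((h.comp _ (hT' y)).C_iff (h.merged _ (hT' y))).1 ?_)
      rcases h4 with ⟨h6, h7⟩ | ⟨h6, h7⟩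
      · rwa [h6, h7] at h3
      · rw [h6, h7] at h3
        exact S.C.symm' h3
  -- Distinct stages use distinct columns, so only finitely many meet a column of a number below
  -- `r`. An undecided pair at a later stage causes no violation.
  · obtain ⟨x, hx, hnR⟩ : ∃ x, (∀ p < r, ¬ styp (sideOf (n (T x))) = col p) ∧
        ¬ S.R (cu (n (T x)) (m (T x))) (cv (n (T x)) (m (T x))) := by
      by_contra! hcon
      have hfin : {t | A t ∧ ∃ p < r, styp (sideOf (n t)) = col p}.Finite := by
        refine Set.Finite.of_finite_image (f := fun t => styp (sideOf (n t)))
          (((Set.finite_lt_nat r).image col).subset ?_) ?_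
        · rintro _ ⟨t, ⟨-, p, hp, h1⟩, rfl⟩
          exact ⟨p, hp, h1.symm⟩
        · rintro t ⟨ht, -⟩ t' ⟨ht', -⟩ h1
          exact h.styp_inj ht ht' h1
      obtain ⟨b, hb⟩ := hfin.bddAbove
      obtain ⟨x, hx, hxn⟩ := hv (b + 1)
      have hex : ∃ p < r, styp (sideOf (n (T x))) = col p := by
        by_contra! h1
        exact hxn (hcon x h1)
      have := hb (show T x ∈ _ from ⟨hT x, hex⟩)
      omega
    have hcx := h.comp _ (hT x)
    have hviol : ¬ Viol S.R r [(cu (n (T x)) (m (T x)), cv (n (T x)) (m (T x)))] := by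
      intro hvi
      obtain ⟨⟨p, hp, hpr⟩, -⟩ := viol_single hvi
      exact hx p hp (hcx.col_cu.symm.trans (S.gen.col_eq _ _ hpr))
    have hnC := mt (hC x).1 hnR
    by_cases hb : blk (ψ (2 * x)) = blk (ψ (2 * x + 1))
    · have hodd : ∀ a b, blk a = blk b → ¬ S.C a b → a % 2 = 1 := by
        intro a b hab hne
        rcases even_or_elt a with ⟨k, rfl⟩ | ⟨σ, z, rfl⟩
        · refine (hne ?_).elim
          rcases even_or_elt b with ⟨k', rfl⟩ | ⟨τ, z, rfl⟩
          · rw [blk_even, blk_even] at hab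
            rw [hab]
          · rw [blk_even, blk_elt] at hab
            omega
        · simp
      have ho1 := hodd _ _ hb hnC
      have ho2 := hodd _ _ hb.symm (fun h => hnC (S.C.symm' h))
      obtain ⟨y, hy⟩ := (hr (2 * x)).resolve_left (by omega)
      obtain ⟨y', hy'⟩ := (hr (2 * x + 1)).resolve_left (by omega)
      have hblk : ∀ y, blk (zig n m T' y) = blk (n (T' (y / 2))) := by
        intro y
        rcases zig_eq n m T' y with h1 | h1
        · rw [h1]
        · rw [h1, ← (h.comp _ (hT' _)).blk_eq]
      have hTT : T' (y / 2) = T' (y' / 2) := by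
        refine h.blk_inj (hT' _) (hT' _) ?_
        rw [← hblk, ← hblk, ← hy, ← hy', hb]
      have hpair : ∃ y, (ψ (2 * x) = n (T' y) ∧ ψ (2 * x + 1) = m (T' y)) ∨
          (ψ (2 * x) = m (T' y) ∧ ψ (2 * x + 1) = n (T' y)) := by
        rcases zig_eq n m T' y with h1 | h1 <;> rcases zig_eq n m T' y' with h2 | h2
        · refine (hnC ?_).elim
          rw [hy, hy', h1, h2, hTT]
        · exact ⟨y / 2, Or.inl ⟨hy.trans h1, (hy'.trans h2).trans (by rw [hTT])⟩⟩
        · exact ⟨y / 2, Or.inr ⟨hy.trans h1, (hy'.trans h2).trans (by rw [hTT])⟩⟩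
        · refine (hnC ?_).elim
          rw [hy, hy', h1, h2, hTT]
      obtain ⟨y, hy⟩ := hpair
      have hcy := h.comp _ (hT' y)
      rcases hrr (_, _) ⟨x, rfl, Or.inr ⟨y, hy, rfl⟩⟩ with h1 | ⟨κ, hκ, h1⟩
      · exact hviol h1
      · obtain rfl := List.mem_singleton.1 hκ
        have hne : ∀ {z}, col z = styp (sideOf (n (T x))) →
            ¬ S.R (cu (n (T' y)) (m (T' y))) z := by
          intro z hz hR
          have := S.gen.col_eq _ _ hR
          rw [hcy.col_cu, hz] at this
          exact hd x y (h.styp_inj (hT x) (hT' y) this.symm)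
        rcases h1 _ (List.mem_singleton.2 rfl) with h2 | h2 | h2
        · have h3 := (hcy.C_iff (h.merged _ (hT' y))).2 h2
          refine hnC ?_
          rcases hy with ⟨h4, h5⟩ | ⟨h4, h5⟩
          · rwa [h4, h5]
          · rw [h4, h5]
            exact S.C.symm' h3
        · exact hne hcx.col_cu h2.1
        · exact hne hcx.col_cv h2.1
    · rcases hrr (_, _) ⟨x, rfl, Or.inl ⟨hb, rfl⟩⟩ with h1 | ⟨κ, hκ, -⟩
      · exact hviol h1
      · simp at hκ

/-- If every parity class of stages separates pairs, there are two incomparable light parts. -/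
theorem Separated.exists_incomparable {φ : ℕ → ℕ} (hφ : Computable φ)
    {act : ℕ → Option (ℕ × ℕ × ℕ)} (hact : Computable act)
    (hcomp : ∀ t k i j, act t = some (k, i, j) → S.Comp (φ i) (φ j) ∧
      ∀ p ∈ cL (φ i) (φ j), S.R p.1 p.2)
    (hsep : ∀ t t' k k' i j i' j', t < t' → act t = some (k, i, j) → act t' = some (k', i', j') →
      styp (sideOf (φ i')) ∉ btypes (φ i))
    (hinf : ∀ k, ∃ t i j, act t = some (k, i, j) ∧ ¬ S.R (cu (φ i) (φ j)) (cv (φ i) (φ j))) :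
    ∃ (ζ ζ' : ℕ → ℕ) (_ : Computable ζ) (_ : Computable ζ'),
      (∀ x, ∃ y, ζ x = φ y) ∧ (∀ x, ∃ y, ζ' x = φ y) ∧ Spread ζ ∧ Spread ζ' ∧
      ¬ ReducibleI (S.pull ζ) (S.pull ζ') ∧ ¬ ReducibleI (S.pull ζ') (S.pull ζ) := by
  classical
  let n : ℕ → ℕ := fun t => φ ((act t).getD (0, 0, 0)).2.1
  let m : ℕ → ℕ := fun t => φ ((act t).getD (0, 0, 0)).2.2
  let par : ℕ → ℕ := fun t => ((act t).getD (0, 0, 0)).1 % 2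
  have hn : Computable n := by change Computable fun t => φ ((act t).getD (0, 0, 0)).2.1; fun_prop
  have hm : Computable m := by change Computable fun t => φ ((act t).getD (0, 0, 0)).2.2; fun_prop
  have hpar : Computable par := by
    change Computable fun t => ((act t).getD (0, 0, 0)).1 % 2
    fun_prop
  let A : ℕ → Prop := fun t => (act t).isSome = true
  have hA : ∀ t, A t → ∃ k i j, act t = some (k, i, j) ∧ n t = φ i ∧ m t = φ j := by
    intro t ht
    obtain ⟨⟨k, i, j⟩, h⟩ := Option.isSome_iff_exists.1 ht
    exact ⟨k, i, j, h, by simp [n, h], by simp [m, h]⟩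
  have hs : Separated S n m A := by
    refine ⟨fun t ht => ?_, fun t ht => ?_, fun t t' ht ht' hlt => ?_⟩
    · obtain ⟨k, i, j, h, h1, h2⟩ := hA t ht
      rw [h1, h2]
      exact (hcomp t k i j h).1
    · obtain ⟨k, i, j, h, h1, h2⟩ := hA t ht
      rw [h1, h2]
      exact (hcomp t k i j h).2
    · obtain ⟨k, i, j, h, h1, -⟩ := hA t ht
      obtain ⟨k', i', j', h', h1', -⟩ := hA t' ht'
      rw [h1, h1']
      exact hsep t t' k k' i j i' j' hlt h h'
  have hval : ∀ e < 2, ∀ r, ∃ t, A t ∧ par t = e ∧ r ≤ t ∧ ¬ S.R (cu (n t) (m t)) (cv (n t) (m t)) := by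
    intro e he r
    choose f i j hf hfR using fun k => hinf (2 * k + e)
    have hinj : Function.Injective f := by
      intro k k' h
      have h1 := hf k
      rw [h, hf k'] at h1
      have := congrArg (fun o : Option (ℕ × ℕ × ℕ) => (o.getD (0, 0, 0)).1) h1
      simp only [Option.getD_some] at this
      omega
    obtain ⟨k, hk⟩ := (Set.infinite_range_of_injective hinj).exists_gt r
    obtain ⟨⟨k, rfl⟩, hk⟩ := hk
    refine ⟨f k, by simp [A, hf k], ?_, hk.le, ?_⟩
    · simp only [par, hf k, Option.getD_some]
      omega
    · simp only [n, m, hf k, Option.getD_some]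
      exact hfR k
  choose! t₀ ht₀ using hval
  -- The stages are split by the parity of the instance they serve. Elsewhere a fixed stage `t₀ e 0`
  -- is repeated, which keeps `T e` total without adding new pairs.
  let T : ℕ → ℕ → ℕ := fun e x => if (act x).isSome = true ∧ par x = e then x else t₀ e 0
  have hTc : ∀ e, Computable (T e) := fun e => by
    change Computable fun x => if (act x).isSome = true ∧ par x = e then x else t₀ e 0
    fun_prop
  have hT : ∀ e < 2, ∀ x, A (T e x) ∧ par (T e x) = e := by
    intro e he x
    simp only [T]
    split_ifs with h
    · exact h
    · exact ⟨(ht₀ e he 0).1, (ht₀ e he 0).2.1⟩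
  have hTv : ∀ e < 2, ∀ r, ∃ x, r ≤ T e x ∧
      ¬ S.R (cu (n (T e x)) (m (T e x))) (cv (n (T e x)) (m (T e x))) := by
    intro e he r
    obtain ⟨h1, h2, h3, h4⟩ := ht₀ e he r
    have : T e (t₀ e r) = t₀ e r := if_pos ⟨h1, h2⟩
    exact ⟨t₀ e r, by rw [this]; exact ⟨h3, h4⟩⟩
  have hrange : ∀ e < 2, ∀ x, ∃ y, zig n m (T e) x = φ y := by
    intro e he x
    rcases zig_eq n m (T e) x with h | h
    · exact ⟨_, h⟩
    · exact ⟨_, h⟩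
  have hd : ∀ e < 2, ∀ e' < 2, e ≠ e' → ∀ x y, T e x ≠ T e' y := by
    intro e he e' he' hne x y h
    refine hne ?_
    rw [← (hT e he x).2, h, (hT e' he' y).2]
  have hmain : ∀ e < 2, ∀ e' < 2, e ≠ e' →
      ¬ ReducibleI (S.pull (zig n m (T e))) (S.pull (zig n m (T e'))) := fun e he e' he' hne =>
    hs.not_reducibleI hn hm (hTc e) (hTc e') (fun x => (hT e he x).1) (fun x => (hT e' he' x).1)
      (hd e he e' he' hne) (hTv e he)
  exact ⟨zig n m (T 0), zig n m (T 1), computable_zig hn hm (hTc 0), computable_zig hn hm (hTc 1),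
    hrange 0 (by omega), hrange 1 (by omega),
    hs.spread (fun x => (hT 0 (by omega) x).1) (fun r => (hTv 0 (by omega) r).imp fun _ h => h.1),
    hs.spread (fun x => (hT 1 (by omega) x).1) (fun r => (hTv 1 (by omega) r).imp fun _ h => h.1),
    hmain 0 (by omega) 1 (by omega) (by omega), hmain 1 (by omega) 0 (by omega) (by omega)⟩

end Setup

end CeerDegrees

namespace CeerDegrees

theorem exists_bound_list {α : Type} (f : α → ℕ) (l : List α) : ∃ M, ∀ c ∈ l, f c ≤ M := by
  induction l with
  | nil => exact ⟨0, by simp⟩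
  | cons a l ih =>
    obtain ⟨M, hM⟩ := ih
    refine ⟨M + f a, fun c hc => ?_⟩
    rcases List.mem_cons.1 hc with rfl | hc
    · omega
    · have := hM c hc
      omega

namespace Setup

variable {S : Setup}

/-! ### Pairs in pairwise different blocks -/

/-- With the pairs in distinct blocks, the pulled-back relation records nothing but which pairs are
equivalent. This is why degrees built from such pairs do not depend on the blocks used. -/
theorem zig_rel {l r : ℕ → ℕ} (hb : ∀ n, blk (l n) = blk (r n))
    (hi : ∀ n n', blk (l n) = blk (l n') → n = n') {x y : ℕ} :
    S.C (zig l r id x) (zig l r id y) ↔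
      x = y ∨ (x / 2 = y / 2 ∧ S.C (l (x / 2)) (r (x / 2))) := by
  have hblk : ∀ x, blk (zig l r id x) = blk (l (x / 2)) := fun x => by
    rcases zig_eq l r id x with h | h
    · rw [h]; rfl
    · rw [h, hb]; rfl
  constructor
  · intro h
    have hxy : x / 2 = y / 2 := hi _ _ (by rw [← hblk, ← hblk, blk_eq_of_C h])
    rcases Nat.even_or_odd' x with ⟨u, rfl | rfl⟩ <;> rcases Nat.even_or_odd' y with ⟨v, rfl | rfl⟩
    · left; omega
    · right
      obtain rfl : u = v := by omega
      rw [zig_even, zig_odd] at h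
      refine ⟨hxy, ?_⟩
      rw [show 2 * u / 2 = u by omega]
      exact h
    · right
      obtain rfl : u = v := by omega
      rw [zig_even, zig_odd] at h
      refine ⟨hxy, ?_⟩
      rw [show (2 * u + 1) / 2 = u by omega]
      exact S.C.symm' h
    · left; omega
  · rintro (rfl | ⟨h1, h2⟩)
    · exact S.C.refl' _
    · have key : ∀ z, z / 2 = x / 2 → S.C (zig l r id z) (l (x / 2)) := by
        intro z hz
        rw [← hz] at h2 ⊢
        unfold zig
        split_ifs
        · exact S.C.refl' _
        · exact S.C.symm' h2
      exact S.C.trans' (key x rfl) (S.C.symm' (key y h1.symm))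

theorem pull_zig_congr {l r l' r' : ℕ → ℕ} (hb : ∀ n, blk (l n) = blk (r n))
    (hi : ∀ n n', blk (l n) = blk (l n') → n = n') (hb' : ∀ n, blk (l' n) = blk (r' n))
    (hi' : ∀ n n', blk (l' n) = blk (l' n') → n = n')
    (h : ∀ n, S.C (l n) (r n) ↔ S.C (l' n) (r' n)) :
    S.pull (zig l r id) = S.pull (zig l' r' id) := by
  ext x y
  rw [pull_apply, pull_apply, zig_rel hb hi, zig_rel hb' hi', h]

/-- For each number `n` a block with two elements, which are equivalent if and only if `a` and
`⟨col a, n⟩` are. -/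
def ymap (a : ℕ) : ℕ → ℕ :=
  zig (fun n => elt (Nat.pair (col a) n, false) a.unpair.2)
    (fun n => elt (Nat.pair (col a) n, false) n) id

theorem computable_ymap (a : ℕ) : Computable (ymap a) :=
  computable_zig (by fun_prop) (by fun_prop) Computable.id

theorem ymap_even (a n : ℕ) : ymap a (2 * n) = elt (Nat.pair (col a) n, false) a.unpair.2 :=
  zig_even _ _ _ n

theorem ymap_odd (a n : ℕ) : ymap a (2 * n + 1) = elt (Nat.pair (col a) n, false) n :=
  zig_odd _ _ _ n

theorem blk_ymap (a x : ℕ) : blk (ymap a x) = 2 * Nat.pair (col a) (x / 2) + 1 := by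
  rcases Nat.even_or_odd' x with ⟨u, rfl | rfl⟩
  · rw [ymap_even, blk_elt]
    rw [show 2 * u / 2 = u by omega]
  · rw [ymap_odd, blk_elt]
    rw [show (2 * u + 1) / 2 = u by omega]

theorem C_ymap (a n : ℕ) : S.C (elt (Nat.pair (col a) n, false) a.unpair.2)
    (elt (Nat.pair (col a) n, false) n) ↔ S.R a (Nat.pair (col a) n) := by
  have : styp (Nat.pair (col a) n, false) = col a := by simp [styp]
  rw [C_elt_same, this, pair_idx_of_col rfl]

variable (S) in
def ydeg (a : ℕ) : IDegree := S.deg (ymap a) (computable_ymap a)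

theorem ymap_eq_of_data {a : ℕ} {l r : ℕ → ℕ} (hb : ∀ n, blk (l n) = blk (r n))
    (hi : ∀ n n', blk (l n) = blk (l n') → n = n')
    (h : ∀ n, S.C (l n) (r n) ↔ S.R a (Nat.pair (col a) n)) :
    S.pull (ymap a) = S.pull (zig l r id) := by
  refine pull_zig_congr (by simp) (fun n n' hn => ?_) hb hi fun n => by rw [C_ymap, h]
  simpa using hn

theorem spread_ymap (a : ℕ) : Spread (ymap a) := fun n => ⟨2 * n, by
  have := Nat.right_le_pair (col a) (2 * n / 2)
  rw [blk_ymap]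
  omega⟩

/-- Otherwise the class of `a` would be decidable within its column. Its complement is then a c.e.
set meeting infinitely many classes but not that of `a`, against `IsGeneric.finite_or_full`. -/
theorem not_ydeg_le_id (a : ℕ) : ¬ S.ydeg a ≤ degI idCeer := by
  intro h
  have hc : Computable fun x : ℕ => 2 * x := by fun_prop
  have hid : degI idCeer = S.deg (fun x => 2 * x) hc := by
    unfold deg ceer idCeer
    congr 2
    ext x y
    rw [pull_apply, C_even_left]
    change x = y ↔ _
    omega
  rw [hid] at h
  obtain ⟨ψ, hψ, he, hr⟩ := exists_pull_of_reducibleI hc (deg_le_deg.1 h)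
  have heven : ∀ x, ∃ k, ψ x = 2 * k := fun x => by
    rcases hr x with h1 | h1
    · exact ⟨ψ x / 2, by omega⟩
    · exact h1
  have hdec : ∀ n, S.R a (Nat.pair (col a) n) ↔ ψ (2 * n) = ψ (2 * n + 1) := by
    intro n
    rw [← C_ymap, ← ymap_even, ← ymap_odd, ← pull_apply, he, pull_apply]
    obtain ⟨k, hk⟩ := heven (2 * n)
    rw [hk, C_even_left]
  rcases S.gen.finite_or_full (W := fun p => ∃ n, ¬ ψ (2 * n) = ψ (2 * n + 1) ∧
    p = Nat.pair (col a) n) (by fun_prop) (c := col a) (by rintro _ ⟨n, -, rfl⟩; simp) with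
    ⟨r, hr⟩ | h1
  · obtain ⟨x, hx⟩ := S.gen.infinite (col a) (max r (a + 1))
    have hxa : ¬ ψ (2 * x) = ψ (2 * x + 1) := fun h1 =>
      hx a (by simp) (S.R.symm' ((hdec x).2 h1))
    obtain ⟨p, hp, hpr⟩ := hr _ ⟨x, hxa, rfl⟩
    exact hx p (lt_of_lt_of_le hp (le_max_left _ _)) hpr
  · obtain ⟨_, ⟨n, hn, rfl⟩, h2⟩ := h1 a rfl
    exact hn ((hdec n).1 (S.R.symm' h2))

/-! ### Comparable pairs without separation -/

theorem reducible_bot_of_computable {φ : ℕ → ℕ}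
    (h : ComputablePred fun p : ℕ × ℕ => S.C (φ p.1) (φ p.2)) : Reducible (S.pull φ) ⊥ := by
  classical
  have h' : ComputablePred fun p : ℕ × ℕ => S.C (φ p.1) (φ p.2) ∧
      ∀ z < p.2, ¬ S.C (φ p.1) (φ z) :=
    computablePred_and h (computablePred_forall_lt (by fun_prop) (computablePred_not
      (computablePred_comp (f := fun x : (ℕ × ℕ) × ℕ => (x.1.1, x.2)) h (by fun_prop))))
  obtain ⟨f, hf, hfp⟩ := exists_computable_select (p := fun x y => S.C (φ x) (φ y) ∧
    ∀ z < y, ¬ S.C (φ x) (φ z)) h'.to_re (fun x => by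
      have hex : ∃ y, S.C (φ x) (φ y) := ⟨x, S.C.refl' _⟩
      exact ⟨Nat.find hex, Nat.find_spec hex, fun z hz => Nat.find_min hex hz⟩)
  refine ⟨f, hf, fun x y => ⟨fun hxy => ?_, fun hxy => ?_⟩⟩
  · change f x = f y
    rw [pull_apply] at hxy
    rcases lt_trichotomy (f x) (f y) with h1 | h1 | h1
    · exact ((hfp y).2 _ h1 (S.C.trans' (S.C.symm' hxy) (hfp x).1)).elim
    · exact h1
    · exact ((hfp x).2 _ h1 (S.C.trans' hxy (hfp y).1)).elim
  · have hxy' : f x = f y := hxy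
    have h1 := (hfp y).1
    rw [← hxy'] at h1
    exact S.C.trans' (hfp x).1 (S.C.symm' h1)

/-- The first alternative fails if no comparable pair can be separated and the points which can be
compared to a fixed point meet finitely many classes. -/
theorem computable_of_bounded {φ : ℕ → ℕ} (hφ : Computable φ) (Γ : List ℕ) (r₀ : ℕ)
    (hmain : ∀ i j, S.Comp (φ i) (φ j) → styp (sideOf (φ i)) ∈ Γ ∨
      Viol S.R r₀ (cL (φ i) (φ j)) ∨
      mergeAll S.R (cL (φ i) (φ j)) (cu (φ i) (φ j)) (cv (φ i) (φ j)))
    (hU : ∀ a, ∃ r, ∀ i j, S.Comp (φ i) (φ j) → (∀ p ∈ cL (φ i) (φ j), S.R p.1 p.2) →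
      S.R (cu (φ i) (φ j)) a → ∃ p < r, S.R (cv (φ i) (φ j)) p) :
    ComputablePred fun p : ℕ × ℕ => S.C (φ p.1) (φ p.2) := by
  classical
  choose rU hrU using hU
  obtain ⟨r, hr⟩ := exists_bound_list (fun c => rU (Nat.pair c 0)) Γ
  -- Merging `cM` fulfils `cL` and makes `cu` equivalent to a base point in a column of `Γ`. By `hU`
  -- and the choice of `r`, `cv` is then equivalent to a number below `r`, so no request keeping it
  -- away from all of these succeeds.
  have hstat := S.gen.static (S := fun X => ∃ i j, (S.Comp (φ i) (φ j) ∧ styp (sideOf (φ i)) ∈ Γ) ∧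
    X = ([cM (φ i) (φ j)], (List.range r).map fun p => [(cv (φ i) (φ j), p)]))
    (by
      have hΓ : ComputablePred fun c : ℕ => c ∈ Γ :=
        (computablePred_exists_mem (f := fun _ : ℕ => Γ) (p := fun c b => b = c) (by fun_prop)
          (by fun_prop)).of_eq fun c => by simp
      fun_prop)
    (by
      rintro _ ⟨i, j, -, rfl⟩ p hp
      obtain rfl := List.mem_singleton.1 hp
      exact col_cM _ _)
  obtain ⟨r₁, hr₁⟩ : ∃ r₁, ∀ i j, S.Comp (φ i) (φ j) → styp (sideOf (φ i)) ∈ Γ →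
      Viol S.R r₁ [cM (φ i) (φ j)] ∨ ∃ p < r, mergeAll S.R [cM (φ i) (φ j)] (cv (φ i) (φ j)) p := by
    rcases hstat with ⟨_, ⟨i, j, ⟨hc, hΓ⟩, rfl⟩, h1, h2⟩ | ⟨r₁, h1⟩
    · exfalso
      have h3 := h1 _ (List.mem_singleton.2 rfl)
      have h4 : ∀ p < r, ¬ S.R (cv (φ i) (φ j)) p := fun p hp => by
        obtain ⟨p', hp', hn⟩ := h2 [(cv (φ i) (φ j), p)]
          (List.mem_map.2 ⟨p, List.mem_range.2 hp, rfl⟩)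
        obtain rfl := List.mem_singleton.1 hp'
        exact hn
      have h5 : ∃ p < rU (Nat.pair (styp (sideOf (φ i))) 0), S.R (cv (φ i) (φ j)) p := by
        refine hrU _ i j hc ?_ ?_
        · rcases hc.cases with ⟨σ, x, y, -, -, -, -, e1, -⟩ | ⟨q, s, x, y, -, -, -, -, -, e1, e2⟩
          · simp [e1]
          · rw [e1, ← e2]
            intro p hp
            obtain rfl := List.mem_singleton.1 hp
            exact h3
        · rcases hc.cases with ⟨σ, x, y, e0, -, e1, -, -, e2⟩ | ⟨q, s, x, y, e0, -, -, e1, -⟩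
          · rw [e2] at h3
            rw [e1, e0, sideOf_elt]
            exact h3
          · rw [e1, e0, sideOf_elt]
      obtain ⟨p, hp, hpr⟩ := h5
      exact h4 p (lt_of_lt_of_le hp (hr _ hΓ)) hpr
    · refine ⟨r₁, fun i j hc hΓ => ?_⟩
      rcases h1 _ ⟨i, j, ⟨hc, hΓ⟩, rfl⟩ with h2 | ⟨κ, hκ, h2⟩
      · exact Or.inl h2
      · obtain ⟨p, hp, rfl⟩ := List.mem_map.1 hκ
        exact Or.inr ⟨p, List.mem_range.1 hp, h2 _ (List.mem_singleton.2 rfl)⟩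
  obtain ⟨zΓ, hzΓ⟩ := exists_bound_list (fun c => Nat.pair c 0) Γ
  -- Below `R₁` one point of an inequivalent pair can be located; `R₂` also leaves room for its
  -- partner, which `hU` bounds.
  set R₁ := r₀ + r₁ + r + zΓ + 1 with hR₁
  obtain ⟨r₂, hr₂⟩ := exists_bound_list rU (List.range R₁)
  have hr₂' : ∀ p < R₁, rU p ≤ r₂ := fun p hp => hr₂ p (List.mem_range.2 hp)
  set R₂ := R₁ + r₂ with hR₂
  have hsame : ∀ i j σ x y, φ i = elt σ x → φ j = elt σ y →
      ¬ S.R (Nat.pair (styp σ) x) (Nat.pair (styp σ) y) →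
      (∃ p < R₂, S.R (Nat.pair (styp σ) x) p) ∧ ∃ p < R₂, S.R (Nat.pair (styp σ) y) p := by
    intro i j σ x y hi hj hn
    have hc : S.Comp (φ i) (φ j) := by rw [hi, hj]; exact comp_same
    have hc' : S.Comp (φ j) (φ i) := by rw [hi, hj]; exact comp_same
    have e1 : cu (φ i) (φ j) = Nat.pair (styp σ) x := by simp [hi, hj, cu]
    have e2 : cv (φ i) (φ j) = Nat.pair (styp σ) y := by simp [hi, hj, cv]
    have e3 : cL (φ i) (φ j) = [] := by simp [hi, hj, cL]
    have e4 : cM (φ i) (φ j) = (Nat.pair (styp σ) x, Nat.pair (styp σ) 0) := by simp [hi, hj, cM]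
    have e1' : cu (φ j) (φ i) = Nat.pair (styp σ) y := by simp [hi, hj, cu]
    have e2' : cv (φ j) (φ i) = Nat.pair (styp σ) x := by simp [hi, hj, cv]
    have e3' : cL (φ j) (φ i) = [] := by simp [hi, hj, cL]
    have hΓ : styp σ ∈ Γ := by
      rcases hmain i j hc with h1 | h1 | h1
      · rwa [hi, sideOf_elt] at h1
      · rw [e3] at h1
        obtain ⟨u, -, v, -, h2, h3⟩ := h1
        exact (h2 h3).elim
      · rw [e1, e2, e3] at h1
        exact (hn h1).elim
    have hfst : (∃ p < R₁, S.R (Nat.pair (styp σ) x) p) ∨ ∃ p < R₁, S.R (Nat.pair (styp σ) y) p := by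
      have h1 := hr₁ i j hc (by rwa [hi, sideOf_elt])
      rw [e2, e4] at h1
      have hz := hzΓ _ hΓ
      rcases h1 with h1 | ⟨p, hp, h1 | h1 | h1⟩
      · obtain ⟨⟨p, hp, h2⟩, -⟩ := viol_single h1
        exact Or.inl ⟨p, by omega, h2⟩
      · exact Or.inr ⟨p, by omega, h1⟩
      · exact (hn (S.R.symm' h1.1)).elim
      · exact Or.inr ⟨_, by omega, h1.1⟩
    rcases hfst with ⟨p, hp, h1⟩ | ⟨p, hp, h1⟩
    · obtain ⟨p', hp', h2⟩ := hrU p i j hc (by simp [e3]) (by rwa [e1])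
      rw [e2] at h2
      have := hr₂' p hp
      exact ⟨⟨p, by omega, h1⟩, ⟨p', by omega, h2⟩⟩
    · obtain ⟨p', hp', h2⟩ := hrU p j i hc' (by simp [e3']) (by rwa [e1'])
      rw [e2'] at h2
      have := hr₂' p hp
      exact ⟨⟨p', by omega, h2⟩, ⟨p, by omega, h1⟩⟩
  -- Across a glued block it is enough to locate one of the two points, provided that point is not
  -- equivalent to its base point.
  have hcross : ∀ i j q s x y, φ i = elt (q, s) x → φ j = elt (q, !s) y → S.Glued (q, s) →
      ¬ S.R (Nat.pair (styp (q, s)) x) (Nat.pair (styp (q, s)) 0) →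
      (∃ p < R₂, S.R (Nat.pair (styp (q, s)) x) p) ∨
      ((∃ p < R₂, S.R (Nat.pair (styp (q, !s)) y) p) ∧
        ¬ S.R (Nat.pair (styp (q, !s)) y) (Nat.pair (styp (q, !s)) 0)) := by
    intro i j q s x y hi hj hg hn
    have hne := styp_ne_of_glued hg
    have hc : S.Comp (φ i) (φ j) := by rw [hi, hj]; exact comp_cross hg
    have e1 : cu (φ i) (φ j) = Nat.pair (styp (q, s)) 0 := by simp [hi, hj, cu]
    have e2 : cv (φ i) (φ j) = Nat.pair (styp (q, s)) x := by simp [hi, hj, cv]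
    have e3 : cL (φ i) (φ j) = [(Nat.pair (styp (q, !s)) y, Nat.pair (styp (q, !s)) 0)] := by
      simp [hi, hj, cL]
    have e4 : cM (φ i) (φ j) = (Nat.pair (styp (q, !s)) y, Nat.pair (styp (q, !s)) 0) := by
      simp [hi, hj, cM]
    have hcol : ∀ {u v}, ¬ S.R (Nat.pair (styp (q, s)) u) (Nat.pair (styp (q, !s)) v) := by
      intro u v h
      have := S.gen.col_eq _ _ h
      rw [col_pair, col_pair] at this
      exact hne this
    by_cases hm : S.R (Nat.pair (styp (q, !s)) y) (Nat.pair (styp (q, !s)) 0)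
    · left
      have hΓ : styp (q, s) ∈ Γ := by
        rcases hmain i j hc with h1 | h1 | h1
        · rwa [hi, sideOf_elt] at h1
        · rw [e3] at h1
          obtain ⟨u, -, v, -, h2, h3 | h3 | h3⟩ := h1
          · exact (h2 h3).elim
          · exact (h2 (S.R.trans' h3.1 (S.R.trans' hm h3.2))).elim
          · exact (h2 (S.R.trans' h3.1 (S.R.trans' (S.R.symm' hm) h3.2))).elim
        · rw [e1, e2, e3] at h1
          rcases h1 with h1 | h1 | h1
          · exact (hn (S.R.symm' h1)).elim
          · exact (hcol h1.1).elim
          · exact (hcol (v := 0) h1.1).elim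
      obtain ⟨p, hp, h1⟩ := hrU (Nat.pair (styp (q, s)) 0) i j hc
        (by
          rw [e3]
          intro p hp
          obtain rfl := List.mem_singleton.1 hp
          exact hm)
        (by rw [e1])
      rw [e2] at h1
      have : rU (Nat.pair (styp (q, s)) 0) ≤ r := hr _ hΓ
      exact ⟨p, by omega, h1⟩
    · rcases hmain i j hc with h1 | h1 | h1
      · rw [hi, sideOf_elt] at h1
        have h2 := hr₁ i j hc (by rwa [hi, sideOf_elt])
        rw [e2, e4] at h2
        rcases h2 with h2 | ⟨p, hp, h2 | h2 | h2⟩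
        · obtain ⟨⟨p, hp, h3⟩, -⟩ := viol_single h2
          exact Or.inr ⟨⟨p, by omega, h3⟩, hm⟩
        · exact Or.inl ⟨p, by omega, h2⟩
        · exact (hcol h2.1).elim
        · exact (hcol (v := 0) h2.1).elim
      · rw [e3] at h1
        obtain ⟨⟨p, hp, h3⟩, -⟩ := viol_single h1
        exact Or.inr ⟨⟨p, by omega, h3⟩, hm⟩
      · rw [e1, e2, e3] at h1
        rcases h1 with h1 | h1 | h1
        · exact (hn (S.R.symm' h1)).elim
        · exact (hcol h1.1).elim
        · exact (hcol (v := 0) h1.1).elim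
  -- Finite tables of inequivalences below `R₂`. By `hsame` and `hcross`, equivalences with table
  -- entries witness every inequivalence of a comparable pair, so the complement of the relation is
  -- c.e. as well.
  let T₁ : List (ℕ × ℕ) := ((List.range R₂).flatMap fun p => (List.range R₂).map fun p' =>
    (p, p')).filter fun t => ¬ S.R t.1 t.2
  let T₂ : List ℕ := (List.range R₂).filter fun p => ¬ S.R p (Nat.pair (col p) 0)
  have hT₁ : ∀ t, t ∈ T₁ ↔ (t.1 < R₂ ∧ t.2 < R₂) ∧ ¬ S.R t.1 t.2 := by
    rintro ⟨p, p'⟩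
    simp [T₁]
  have hT₂ : ∀ p, p ∈ T₂ ↔ p < R₂ ∧ ¬ S.R p (Nat.pair (col p) 0) := by
    intro p
    simp [T₂]
  refine computablePred_of_repred (by fun_prop) (REPred.of_eq (p := fun a : ℕ × ℕ =>
    (¬ φ a.1 = φ a.2 ∧ ¬ S.Comp (φ a.1) (φ a.2)) ∨
    ((S.Comp (φ a.1) (φ a.2) ∧ (sideOf (φ a.1)).2 = (sideOf (φ a.2)).2) ∧
      ∃ t ∈ T₁, S.R (pt (φ a.1)) t.1 ∧ S.R (pt (φ a.2)) t.2) ∨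
    ((S.Comp (φ a.1) (φ a.2) ∧ ¬ (sideOf (φ a.1)).2 = (sideOf (φ a.2)).2) ∧
      ∃ p ∈ T₂, S.R (pt (φ a.1)) p ∨ S.R (pt (φ a.2)) p))
    (repred_or (by fun_prop) (repred_or (repred_and (by fun_prop)
      (repred_exists_mem (by fun_prop) (by fun_prop))) (repred_and (by fun_prop)
      (repred_exists_mem (by fun_prop) (by fun_prop))))) ?_)
  rintro ⟨i, j⟩
  simp only
  by_cases hc : S.Comp (φ i) (φ j)
  · rcases hc.cases with ⟨σ, x, y, hi, hj, -⟩ | ⟨q, s, x, y, hi, hj, hg, -⟩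
    · have hs : (sideOf (φ i)).2 = (sideOf (φ j)).2 := by simp [hi, hj]
      simp only [hc, hs, not_true_eq_false, and_false, false_or, and_true, false_and, or_false,
        true_and]
      rw [hi, hj, C_elt_same, pt_elt, pt_elt]
      constructor
      · rintro ⟨t, ht, h1, h2⟩ h3
        exact ((hT₁ t).1 ht).2 (S.R.trans' (S.R.symm' h1) (S.R.trans' h3 h2))
      · intro hn
        obtain ⟨⟨p, hp, h1⟩, ⟨p', hp', h2⟩⟩ := hsame i j σ x y hi hj hn
        exact ⟨(p, p'), (hT₁ _).2 ⟨⟨hp, hp'⟩, fun h3 =>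
          hn (S.R.trans' h1 (S.R.trans' h3 (S.R.symm' h2)))⟩, h1, h2⟩
    · have hs : (sideOf (φ i)).2 ≠ (sideOf (φ j)).2 := by simp [hi, hj]
      simp only [hc, hs, not_true_eq_false, and_false, false_or, false_and, true_and,
        not_false_eq_true]
      rw [hi, hj, C_cross hg, pt_elt, pt_elt]
      have hT : ∀ {c x p}, S.R (Nat.pair c x) p →
          (S.R p (Nat.pair (col p) 0) ↔ S.R (Nat.pair c x) (Nat.pair c 0)) := by
        intro c x p h
        have h1 := S.gen.col_eq _ _ h
        rw [col_pair] at h1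
        rw [← h1]
        exact ⟨fun h2 => S.R.trans' h h2, fun h2 => S.R.trans' (S.R.symm' h) h2⟩
      constructor
      · rintro ⟨p, hp, h1 | h1⟩ ⟨h2, h3⟩
        · exact ((hT₂ p).1 hp).2 ((hT h1).2 h2)
        · exact ((hT₂ p).1 hp).2 ((hT h1).2 h3)
      · intro hn
        have hfin : ∀ p < R₂, S.R (Nat.pair (styp (q, s)) x) p →
            ¬ S.R (Nat.pair (styp (q, s)) x) (Nat.pair (styp (q, s)) 0) → p ∈ T₂ :=
          fun p hp h1 h2 => (hT₂ p).2 ⟨hp, mt (hT h1).1 h2⟩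
        have hfin' : ∀ p < R₂, S.R (Nat.pair (styp (q, !s)) y) p →
            ¬ S.R (Nat.pair (styp (q, !s)) y) (Nat.pair (styp (q, !s)) 0) → p ∈ T₂ :=
          fun p hp h1 h2 => (hT₂ p).2 ⟨hp, mt (hT h1).1 h2⟩
        by_cases hx : S.R (Nat.pair (styp (q, s)) x) (Nat.pair (styp (q, s)) 0)
        · have hy : ¬ S.R (Nat.pair (styp (q, !s)) y) (Nat.pair (styp (q, !s)) 0) :=
            fun hy => hn ⟨hx, hy⟩
          have hg' : S.Glued (q, !s) := hg
          rcases hcross j i q (!s) y x hj (by simpa using hi) hg' hy with ⟨p, hp, h1⟩ | ⟨-, h1⟩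
          · exact ⟨p, hfin' p hp h1 hy, Or.inr h1⟩
          · rw [Bool.not_not] at h1
            exact (h1 hx).elim
        · rcases hcross i j q s x y hi hj hg hx with ⟨p, hp, h1⟩ | ⟨⟨p, hp, h1⟩, h2⟩
          · exact ⟨p, hfin p hp h1 hx, Or.inl h1⟩
          · exact ⟨p, hfin' p hp h1 h2, Or.inr h1⟩
  · simp only [hc, not_false_eq_true, and_true, false_and, or_false]
    refine not_congr ⟨fun h => ?_, fun h => (eq_or_comp_of_C h).resolve_right hc⟩
    rw [h]

/-- If infinitely many classes can be compared to `a`, and no side is covered, then infinitely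
many blocks carry comparisons to `a`. -/
theorem reducible_ymap {φ : ℕ → ℕ} (hφ : Computable φ) (hno : ∀ σ, ¬ Hits S φ σ) {a : ℕ}
    (hU : ∀ r, ∃ i j, S.Comp (φ i) (φ j) ∧ (∀ p ∈ cL (φ i) (φ j), S.R p.1 p.2) ∧
      S.R (cu (φ i) (φ j)) a ∧ ∀ p < r, ¬ S.R (cv (φ i) (φ j)) p) :
    Reducible (S.pull (ymap a)) (S.pull φ) := by
  have hside : ∀ σ : Side, ∃ r, ∀ x, φ x % 2 = 1 ∧ sideOf (φ x) = σ → ∃ p < r,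
      S.R (pt (φ x)) p := by
    intro σ
    rcases hits_or_bounded (S := S) hφ (D := fun x => φ x % 2 = 1 ∧ sideOf (φ x) = σ)
      (by fun_prop) σ (fun x hx => hx) with h | h
    · exact (hno σ fun y => (h y).imp fun x hx => hx.2).elim
    · exact h
  choose rs hrs using hside
  -- The blocks up to `b` contribute finitely many classes, because no side is exhausted. Hence the
  -- comparisons to `a` in later blocks meet infinitely many classes, and therefore all classes of
  -- the column.
  have hstep : ∀ b y, ∃ i j, S.Comp (φ i) (φ j) ∧ (∀ p ∈ cL (φ i) (φ j), S.R p.1 p.2) ∧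
      S.R (cu (φ i) (φ j)) a ∧ b < blk (φ i) ∧ S.R (cv (φ i) (φ j)) (Nat.pair (col a) y) := by
    intro b y
    rcases S.gen.finite_or_full (W := fun v => ∃ i j, (S.Comp (φ i) (φ j) ∧
      (∀ p ∈ cL (φ i) (φ j), S.R p.1 p.2) ∧ S.R (cu (φ i) (φ j)) a ∧ b < blk (φ i)) ∧
      v = cv (φ i) (φ j)) (by fun_prop) (c := col a) (by
        rintro _ ⟨i, j, ⟨h1, -, h2, -⟩, rfl⟩
        rw [h1.col_cv, ← h1.col_cu]
        exact S.gen.col_eq _ _ h2) with ⟨r, hr⟩ | h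
    · exfalso
      obtain ⟨M, hM⟩ := exists_bound_list (fun q => rs (q, true) + rs (q, false))
        (List.range (b + 1))
      obtain ⟨i, j, h1, h2, h3, h4⟩ := hU (r + M)
      by_cases hb : b < blk (φ i)
      · obtain ⟨p, hp, hpr⟩ := hr _ ⟨i, j, ⟨h1, h2, h3, hb⟩, rfl⟩
        exact h4 p (by omega) hpr
      · have hle : ∀ k, φ k % 2 = 1 → blk (φ k) ≤ b → ∃ p < r + M, S.R (pt (φ k)) p := by
          intro k hk hkb
          obtain ⟨p, hp, hpr⟩ := hrs (sideOf (φ k)) k ⟨hk, rfl⟩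
          refine ⟨p, ?_, hpr⟩
          have hq : (sideOf (φ k)).1 < b + 1 := by
            simp only [blk, hk, one_ne_zero, if_false] at hkb
            omega
          have := hM _ (List.mem_range.2 hq)
          rcases hs : sideOf (φ k) with ⟨q, s⟩
          rw [hs] at hp this
          simp only at this
          cases s <;> omega
        have hv : cv (φ i) (φ j) = pt (φ i) ∨ cv (φ i) (φ j) = pt (φ j) := by
          unfold cv
          split_ifs
          · exact Or.inr rfl
          · exact Or.inl rfl
        rcases hv with hv | hv
        · obtain ⟨p, hp, hpr⟩ := hle i h1.1 (by omega)
          exact h4 p hp (hv ▸ hpr)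
        · obtain ⟨p, hp, hpr⟩ := hle j h1.2.1 (by rw [← h1.blk_eq]; omega)
          exact h4 p hp (hv ▸ hpr)
    · obtain ⟨_, ⟨i, j, ⟨h1, h2, h3, h4⟩, rfl⟩, h5⟩ := h (Nat.pair (col a) y) (by simp)
      exact ⟨i, j, h1, h2, h3, h4, h5⟩
  -- The length of the history is the index `n` of the pair being chosen: the `n`-th pair asks
  -- whether `a` and `⟨col a, n⟩` are equivalent, in a block later than all earlier ones.
  obtain ⟨f, hf, hfp⟩ := exists_computable_history (p := fun (L : List (ℕ × ℕ)) t =>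
    (S.Comp (φ t.1) (φ t.2) ∧ (∀ p ∈ cL (φ t.1) (φ t.2), S.R p.1 p.2) ∧
      S.R (cu (φ t.1) (φ t.2)) a ∧ S.R (cv (φ t.1) (φ t.2)) (Nat.pair (col a) L.length)) ∧
      ∀ t' ∈ L, blk (φ t'.1) < blk (φ t.1))
    (repred_and (by fun_prop) (repred_forall_mem (by fun_prop) (by fun_prop))) (fun L => by
      obtain ⟨b, hb⟩ := exists_bound_list (fun t : ℕ × ℕ => blk (φ t.1)) L
      obtain ⟨i, j, h1, h2, h3, h4, h5⟩ := hstep b L.length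
      exact ⟨(i, j), ⟨h1, h2, h3, h5⟩, fun t' ht' => (hb t' ht').trans_lt h4⟩)
  have hlt : ∀ n n', n < n' → blk (φ (f n).1) < blk (φ (f n').1) := fun n n' h =>
    (hfp n').2 (f n) (List.mem_map.2 ⟨n, List.mem_range.2 h, rfl⟩)
  have heq : S.pull (ymap a) = S.pull (zig (fun n => φ (f n).1) (fun n => φ (f n).2) id) := by
    refine ymap_eq_of_data (fun n => (hfp n).1.1.blk_eq) (fun n n' h => ?_) fun n => ?_
    · rcases lt_trichotomy n n' with h1 | h1 | h1
      · exact absurd h (hlt _ _ h1).ne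
      · exact h1
      · exact absurd h (hlt _ _ h1).ne'
    · obtain ⟨h1, h2, h3, h4⟩ := (hfp n).1
      rw [List.length_map, List.length_range] at h4
      rw [h1.C_iff h2]
      exact ⟨fun h => S.R.trans' (S.R.symm' h3) (S.R.trans' h h4),
        fun h => S.R.trans' h3 (S.R.trans' h (S.R.symm' h4))⟩
  rw [heq]
  refine reducible_pull (computable_zig (by fun_prop) (by fun_prop) Computable.id) hφ fun x => ?_
  rcases zig_eq (fun n => φ (f n).1) (fun n => φ (f n).2) id x with h | h
  · exact ⟨_, by rw [h]⟩
  · exact ⟨_, by rw [h]⟩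

/-! ### Classification of the light minimal degrees -/

theorem _root_.CeerDegrees.IsLightMinimal.eq_or_eq {d x : IDegree} (hd : IsLightMinimal d)
    (hx : IDegree.IsLight x) (hxd : x ≤ d) : x = degI idCeer ∨ x = d := by
  by_contra! h
  exact hd.2.2 x ⟨lt_of_le_of_ne (isLight_iff.1 hx) h.1.symm, lt_of_le_of_ne hxd h.2⟩

/-- By minimality it suffices to find some `vdeg c` or `ydeg a` below `d`. If no side is exhausted,
genericity is applied to all comparable pairs; success at every instance would give two incomparable
light degrees below `d`, and bounded comparisons would make the relation decidable. -/
theorem eq_vdeg_or_ydeg {d : IDegree} (hd : IsLightMinimal d)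
    (htop : d ≤ S.deg id Computable.id) : (∃ c, d = S.vdeg c) ∨ ∃ a, d = S.ydeg a := by
  obtain ⟨φ, hφ, rfl, -⟩ := exists_deg_eq htop
  have hs : Spread φ := isLight_deg_iff.1 hd.1
  by_cases hno : ∃ σ, Hits S φ σ
  · obtain ⟨σ, hσ⟩ := hno
    have hle := sideDeg_le_of_hits (hφ := hφ) hσ hσ hs
    rw [sideDeg_self] at hle
    rcases hd.eq_or_eq (isLight_sideDeg _ _) hle with h | h
    · exact (not_vdeg_le_id _ h.le).elim
    · exact Or.inl ⟨_, h.symm⟩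
  push Not at hno
  -- Each request fulfils the merging condition of a pair and keeps the pair itself undecided. It
  -- blocks both columns of its block, so later requests ask about other columns; the tag records
  -- the arguments.
  obtain ⟨act, hact, h1, h2, h3⟩ := S.gen.gen (fun q => ∃ i j, S.Comp (φ i) (φ j) ∧
    q = (styp (sideOf (φ i)), btypes (φ i), cL (φ i) (φ j),
      [[(cu (φ i) (φ j), cv (φ i) (φ j))]], i, j))
    (by unfold btypes; fun_prop) (by
      rintro _ ⟨i, j, -, rfl⟩ p hp
      exact col_of_mem_cL hp)
  rcases h3 with h3 | ⟨Γ, r₀, -, h3⟩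
  · exfalso
    have hact' : ∀ {t k i j}, ((act t).elim none fun x => some (x.1, x.2.tag)) = some (k, i, j) →
        act t = some (k, (styp (sideOf (φ i)), btypes (φ i), cL (φ i) (φ j),
          [[(cu (φ i) (φ j), cv (φ i) (φ j))]], i, j)) ∧ S.Comp (φ i) (φ j) := by
      intro t k i j h
      cases ha : act t with
      | none => rw [ha] at h; cases h
      | some x =>
        obtain ⟨k', q⟩ := x
        obtain ⟨⟨i', j', hc, rfl⟩, -⟩ := h1 t k' q ha
        rw [ha] at h
        simp only [Option.elim_some, Option.some.injEq, Prod.mk.injEq] at h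
        obtain ⟨rfl, rfl, rfl⟩ := h
        exact ⟨rfl, hc⟩
    obtain ⟨ζ, ζ', hζ, hζ', hr, hr', hsp, hsp', hn, hn'⟩ := Separated.exists_incomparable (S := S) hφ
      (act := fun t => (act t).elim none fun x => some (x.1, x.2.tag)) (by fun_prop)
      (fun t k i j h => ⟨(hact' h).2, (h1 _ _ _ (hact' h).1).2⟩)
      (fun t t' k k' i j i' j' hlt h h' =>
        h2 t t' k k' _ _ hlt (hact' h).1 (hact' h').1) (fun k => by
        obtain ⟨t, q, ht, hκ⟩ := h3 k
        obtain ⟨⟨i, j, hc, rfl⟩, -⟩ := h1 t k q ht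
        obtain ⟨p, hp, hpn⟩ := hκ _ (List.mem_singleton.2 rfl)
        obtain rfl := List.mem_singleton.1 hp
        exact ⟨t, i, j, by simp [ht], hpn⟩)
    have hle : ∀ {ζ : ℕ → ℕ} (hζ : Computable ζ), (∀ x, ∃ y, ζ x = φ y) →
        S.deg ζ hζ ≤ S.deg φ hφ := fun hζ hr =>
      deg_le_deg.2 (reducible_pull hζ hφ fun x => (hr x).imp fun y hy => by
        rw [hy]).reducibleI
    have hn1 : ¬ S.deg ζ hζ ≤ S.deg ζ' hζ' := fun h => hn (deg_le_deg.1 h)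
    have hn2 : ¬ S.deg ζ' hζ' ≤ S.deg ζ hζ := fun h => hn' (deg_le_deg.1 h)
    rcases hd.eq_or_eq (isLight_deg_iff.2 hsp) (hle hζ hr) with h | h
    · exact hn1 (h ▸ isLight_iff.1 (isLight_deg_iff.2 hsp'))
    · exact hn2 (h ▸ hle hζ' hr')
  · by_cases hU : ∀ a, ∃ r, ∀ i j, S.Comp (φ i) (φ j) → (∀ p ∈ cL (φ i) (φ j), S.R p.1 p.2) →
        S.R (cu (φ i) (φ j)) a → ∃ p < r, S.R (cv (φ i) (φ j)) p
    · exfalso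
      have hcomp := computable_of_bounded (S := S) hφ Γ r₀ (fun i j hc => by
        rcases h3 _ ⟨i, j, hc, rfl⟩ with h | h | ⟨κ, hκ, h⟩
        · exact Or.inl h
        · exact Or.inr (Or.inl h)
        · obtain rfl := List.mem_singleton.1 hκ
          exact Or.inr (Or.inr (h _ (List.mem_singleton.2 rfl)))) hU
      exact hd.2.1.not_ge (degI_le_degI.2 (reducible_bot_of_computable hcomp).reducibleI)
    · push Not at hU
      obtain ⟨a, ha⟩ := hU
      have hle : S.ydeg a ≤ S.deg φ hφ := deg_le_deg.2 (reducible_ymap hφ hno ha).reducibleI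
      rcases hd.eq_or_eq (isLight_deg_iff.2 (spread_ymap a)) hle with h | h
      · exact (not_ydeg_le_id _ h.le).elim
      · exact Or.inr ⟨_, h.symm⟩

end Setup

end CeerDegrees

namespace CeerDegrees
namespace Setup
variable {S : Setup}

/-! ### Uniqueness of covers of the degrees `ydeg a` -/

/-- Cofinally many blocks carry, for each `n`, a pair of elements of the range of `φ` whose
equivalence codes the equivalence of `a` and `⟨col a, n⟩`. -/
theorem exists_select_of_ydeg_le {φ : ℕ → ℕ} {hφ : Computable φ} {a : ℕ}
    (h : S.ydeg a ≤ S.deg φ hφ) : ∃ P : ℕ × ℕ → ℕ × ℕ, Computable P ∧ ∀ n b,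
      b < blk (φ (P (n, b)).1) ∧ blk (φ (P (n, b)).1) = blk (φ (P (n, b)).2) ∧
      (S.C (φ (P (n, b)).1) (φ (P (n, b)).2) ↔ S.R a (Nat.pair (col a) n)) := by
  obtain ⟨ψ, hψ, he, hr⟩ := exists_pull_of_reducibleI hφ (deg_le_deg.1 h)
  have hC : ∀ n, S.C (ψ (2 * n)) (ψ (2 * n + 1)) ↔ S.R a (Nat.pair (col a) n) := fun n => by
    rw [← C_ymap, ← ymap_even, ← ymap_odd, ← pull_apply, ← pull_apply, he]
  have hinj : ∀ n m, S.C (ψ (2 * n)) (ψ (2 * m)) → n = m := fun n m h1 => by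
    rw [← pull_apply, ← he, pull_apply] at h1
    have h2 := blk_eq_of_C h1
    rw [blk_ymap, blk_ymap] at h2
    have h3 := (Nat.pair_eq_pair.1 (show Nat.pair (col a) (2 * n / 2) =
      Nat.pair (col a) (2 * m / 2) by omega)).2
    omega
  -- Otherwise infinitely many of the pairwise inequivalent values `ψ (2 * n)` would lie in early
  -- blocks, and a computable increasing choice of such `n` contradicts
  -- `exists_blk_ge_of_transversal`.
  have hfin : ∀ b, ∃ N, ∀ n, N ≤ n → b < blk (ψ (2 * n)) := by
    intro b
    by_contra! hcon
    obtain ⟨g, hg, hgp⟩ := exists_computable_select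
      (p := fun N n : ℕ => N < n ∧ blk (ψ (2 * n)) ≤ b) (by fun_prop) fun N => by
        obtain ⟨n, hn, hb⟩ := hcon (N + 1)
        exact ⟨n, hn, hb⟩
    let f : ℕ → ℕ := fun i => Nat.rec (g 0) (fun _ y => g y) i
    have hf : Computable f := Computable.nat_rec Computable.id (Computable.const _)
      (show Computable fun x : ℕ × ℕ × ℕ => g x.2.2 by fun_prop).to₂
    have hmono : StrictMono f := strictMono_nat_of_lt_succ fun i => (hgp (f i)).1
    have hle : ∀ i, blk (ψ (2 * f i)) ≤ b := fun i => by
      cases i with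
      | zero => exact (hgp 0).2
      | succ i => exact (hgp (f i)).2
    obtain ⟨i, hi⟩ := exists_blk_ge_of_transversal (h := fun i => ψ (2 * f i)) (by fun_prop)
      (fun i j hij => hmono.injective (hinj _ _ hij)) (b + 1)
    have := hle i
    omega
  let D : ℕ → ℕ → Prop := fun b n => b < blk (ψ (2 * n)) ∧
    blk (ψ (2 * n)) = blk (ψ (2 * n + 1)) ∧ ψ (2 * n) % 2 = 1 ∧ ψ (2 * n + 1) % 2 = 1
  -- The late arguments outside `D` whose two values differ give inequivalent pairs, so they miss
  -- the class of `a` and meet only finitely many classes. Arguments with equal values lie in the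
  -- class of `a`, so `D` must meet infinitely many classes, hence all.
  have hfull : ∀ b n, ∃ n', D b n' ∧ S.R (Nat.pair (col a) n) (Nat.pair (col a) n') := by
    intro b n
    rcases S.gen.finite_or_full (W := fun p => ∃ n, D b n ∧ p = Nat.pair (col a) n) (by fun_prop)
      (c := col a) (by rintro _ ⟨n, -, rfl⟩; simp) with ⟨r, hr⟩ | h1
    · exfalso
      rcases S.gen.finite_or_full (W := fun p => ∃ n, ((¬ D b n ∧ b < blk (ψ (2 * n))) ∧
        ψ (2 * n) ≠ ψ (2 * n + 1)) ∧ p = Nat.pair (col a) n) (by fun_prop)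
        (c := col a) (by rintro _ ⟨n, -, rfl⟩; simp) with ⟨r', hr'⟩ | h1
      · obtain ⟨N, hN⟩ := hfin b
        obtain ⟨x, hx⟩ := S.gen.infinite (col a) (max (max r r') (max (a + 1) (Nat.pair (col a) N)))
        by_cases hxN : N ≤ x
        · by_cases hD : D b x
          · obtain ⟨p, hp, hpr⟩ := hr _ ⟨x, hD, rfl⟩
            exact hx p (by omega) hpr
          · by_cases heq : ψ (2 * x) = ψ (2 * x + 1)
            · refine hx a (by omega) (S.R.symm' ((hC x).1 ?_))
              rw [heq]
            · obtain ⟨p, hp, hpr⟩ := hr' _ ⟨x, ⟨⟨hD, hN x hxN⟩, heq⟩, rfl⟩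
              exact hx p (by omega) hpr
        · have := Nat.pair_lt_pair_right (col a) (not_le.1 hxN)
          exact hx _ (by omega) (S.R.refl' _)
      · obtain ⟨_, ⟨n, ⟨⟨hD, hb⟩, hne⟩, rfl⟩, h2⟩ := h1 a rfl
        have h3 := (hC n).2 (S.R.symm' h2)
        rcases even_or_elt (ψ (2 * n)) with ⟨k, hk⟩ | ⟨σ, x, hx⟩
        · rw [hk, C_even_left] at h3
          exact hne (hk.trans h3)
        · rcases even_or_elt (ψ (2 * n + 1)) with ⟨k, hk⟩ | ⟨τ, y, hy⟩
          · rw [hk, C_even_right] at h3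
            exact hne (h3.trans hk.symm)
          · exact hD ⟨hb, blk_eq_of_C h3, by rw [hx, elt_mod], by rw [hy, elt_mod]⟩
    · obtain ⟨_, ⟨n', hn', rfl⟩, h2⟩ := h1 (Nat.pair (col a) n) (by simp)
      exact ⟨n', hn', S.R.symm' h2⟩
  obtain ⟨P, hP, hPp⟩ := exists_computable_select (p := fun (x s : ℕ × ℕ) => ∃ n',
      D x.2 n' ∧ S.R (Nat.pair (col a) x.1) (Nat.pair (col a) n') ∧ φ s.1 = ψ (2 * n') ∧
      φ s.2 = ψ (2 * n' + 1)) (by fun_prop) fun x => by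
    obtain ⟨n', hD, hR⟩ := hfull x.2 x.1
    obtain ⟨y, hy⟩ := (hr (2 * n')).resolve_left (by have := hD.2.2.1; omega)
    obtain ⟨z, hz⟩ := (hr (2 * n' + 1)).resolve_left (by have := hD.2.2.2; omega)
    exact ⟨(y, z), n', hD, hR, hy.symm, hz.symm⟩
  refine ⟨P, hP, fun n b => ?_⟩
  obtain ⟨n', hD, hR, h1, h2⟩ := hPp (n, b)
  rw [h1, h2]
  exact ⟨hD.1, hD.2.1, (hC n').trans ⟨fun h => S.R.trans' h (S.R.symm' hR),
    fun h => S.R.trans' h hR⟩⟩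

/-- A selection of pairs from cofinally many blocks can be thinned out to distinct blocks. -/
theorem exists_pieces {φ : ℕ → ℕ} (hφ : Computable φ) {P : ℕ × ℕ → ℕ × ℕ} (hP : Computable P)
    {Q : ℕ → Prop} (h : ∀ n b, b < blk (φ (P (n, b)).1) ∧
      blk (φ (P (n, b)).1) = blk (φ (P (n, b)).2) ∧
      (S.C (φ (P (n, b)).1) (φ (P (n, b)).2) ↔ Q n)) (M : ℕ) :
    ∃ f : ℕ → ℕ × ℕ, Computable f ∧ (∀ n, M < blk (φ (f n).1)) ∧
      (∀ n, blk (φ (f n).1) = blk (φ (f n).2)) ∧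
      (∀ n n', blk (φ (f n).1) = blk (φ (f n').1) → n = n') ∧
      ∀ n, S.C (φ (f n).1) (φ (f n).2) ↔ Q n := by
  let b : ℕ → ℕ := fun n => Nat.rec M (fun k y => blk (φ (P (k, y)).1)) n
  have hb : Computable b := Computable.nat_rec Computable.id (Computable.const _)
    (show Computable fun x : ℕ × ℕ × ℕ => blk (φ (P (x.2.1, x.2.2)).1) by fun_prop).to₂
  have hbs : ∀ n, b (n + 1) = blk (φ (P (n, b n)).1) := fun n => rfl
  have hmono : StrictMono b := strictMono_nat_of_lt_succ fun n => (h n (b n)).1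
  refine ⟨fun n => P (n, b n), by fun_prop, fun n => ?_, fun n => (h n (b n)).2.1,
    fun n n' hn => ?_, fun n => (h n (b n)).2.2⟩
  · exact lt_of_le_of_lt (hmono.monotone (Nat.zero_le n)) (h n (b n)).1
  · have := hmono.injective (a₁ := n + 1) (a₂ := n' + 1) hn
    omega

/-- `κ` on the even numbers and the pairs `(l n, r n)` on the odd numbers. -/
def asm (κ l r : ℕ → ℕ) (x : ℕ) : ℕ := if x % 2 = 0 then κ (x / 2) else zig l r id (x / 2)

theorem asm_even (κ l r : ℕ → ℕ) (x : ℕ) : asm κ l r (2 * x) = κ x := by simp [asm]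

theorem asm_odd (κ l r : ℕ → ℕ) (x : ℕ) : asm κ l r (2 * x + 1) = zig l r id x := by
  have h1 : (2 * x + 1) % 2 = 1 := by omega
  have h2 : (2 * x + 1) / 2 = x := by omega
  simp [asm, h1, h2]

theorem computable_asm {κ l r : ℕ → ℕ} (hκ : Computable κ) (hl : Computable l)
    (hr : Computable r) : Computable (asm κ l r) := by
  have hz := computable_zig hl hr Computable.id
  unfold asm
  fun_prop

theorem not_C_asm {κ l r : ℕ → ℕ} {M : ℕ} (hκ : ∀ x, blk (κ x) ≤ M) (hl : ∀ n, M < blk (l n))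
    (hb : ∀ n, blk (l n) = blk (r n)) (x y : ℕ) : ¬ S.C (κ x) (zig l r id y) := by
  intro h
  have h1 := blk_eq_of_C h
  have h2 := hκ x
  have h3 := hl (y / 2)
  have h4 := hb (y / 2)
  rcases zig_eq l r id y with h5 | h5 <;> rw [h5] at h1 <;> simp only [id] at h1 <;> omega

theorem pull_asm_congr {κ l r κ' l' r' : ℕ → ℕ} {M M' : ℕ}
    (hκ : ∀ x, blk (κ x) ≤ M) (hl : ∀ n, M < blk (l n)) (hb : ∀ n, blk (l n) = blk (r n))
    (hi : ∀ n n', blk (l n) = blk (l n') → n = n')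
    (hκ' : ∀ x, blk (κ' x) ≤ M') (hl' : ∀ n, M' < blk (l' n)) (hb' : ∀ n, blk (l' n) = blk (r' n))
    (hi' : ∀ n n', blk (l' n) = blk (l' n') → n = n')
    (hK : ∀ x y, S.C (κ x) (κ y) ↔ S.C (κ' x) (κ' y))
    (hQ : ∀ n, S.C (l n) (r n) ↔ S.C (l' n) (r' n)) :
    S.pull (asm κ l r) = S.pull (asm κ' l' r') := by
  have hz := pull_zig_congr hb hi hb' hi' hQ
  ext x y
  rw [pull_apply, pull_apply]
  rcases Nat.even_or_odd' x with ⟨u, rfl | rfl⟩ <;> rcases Nat.even_or_odd' y with ⟨v, rfl | rfl⟩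
  · simp only [asm_even, hK]
  · simp only [asm_even, asm_odd, not_C_asm hκ hl hb, not_C_asm hκ' hl' hb']
  · rw [Setoid.comm' S.C, Setoid.comm' S.C (x := asm κ' l' r' _)]
    simp only [asm_even, asm_odd, not_C_asm hκ hl hb, not_C_asm hκ' hl' hb']
  · simp only [asm_odd]
    rw [← pull_apply, ← pull_apply, hz]

theorem ydeg_le_of_pieces {χ : ℕ → ℕ} {hχ : Computable χ} {a : ℕ} {f : ℕ → ℕ × ℕ}
    (hf : Computable f)
    (hb : ∀ n, blk (χ (f n).1) = blk (χ (f n).2))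
    (hi : ∀ n n', blk (χ (f n).1) = blk (χ (f n').1) → n = n')
    (h : ∀ n, S.C (χ (f n).1) (χ (f n).2) ↔ S.R a (Nat.pair (col a) n)) :
    S.ydeg a ≤ S.deg χ hχ := by
  refine deg_le_deg.2 (Reducible.reducibleI ?_)
  rw [ymap_eq_of_data hb hi h]
  refine reducible_pull (computable_zig (by fun_prop) (by fun_prop) Computable.id) hχ fun x => ?_
  rcases zig_eq (fun n => χ (f n).1) (fun n => χ (f n).2) id x with h | h
  · exact ⟨_, by rw [h]⟩
  · exact ⟨_, by rw [h]⟩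

theorem isLight_ydeg (a : ℕ) : IDegree.IsLight (S.ydeg a) := isLight_deg_iff.2 (spread_ymap a)

/-- Two degrees above `ydeg a` and `ydeg b` have a common lower bound above both of these. -/
theorem exists_between_ydeg_ydeg {a b : ℕ} {x y : IDegree} (hx : x ≤ S.deg id Computable.id)
    (hy : y ≤ S.deg id Computable.id) (hax : S.ydeg a ≤ x) (hay : S.ydeg a ≤ y)
    (hbx : S.ydeg b ≤ x) (hby : S.ydeg b ≤ y) :
    ∃ j, S.ydeg a ≤ j ∧ S.ydeg b ≤ j ∧ j ≤ x ∧ j ≤ y := by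
  -- Pairs coding the class of `a` (even `n`) and of `b` (odd `n`) are extracted in distinct blocks.
  -- The resulting relation depends only on `a` and `b`, so the same relation is found below `x` and
  -- below `y`.
  have key : ∀ {x : IDegree}, x ≤ S.deg id Computable.id → S.ydeg a ≤ x → S.ydeg b ≤ x →
      ∃ (φ : ℕ → ℕ) (hφ : Computable φ) (f : ℕ → ℕ × ℕ), x = S.deg φ hφ ∧ Computable f ∧
      (∀ n, blk (φ (f n).1) = blk (φ (f n).2)) ∧
      (∀ n n', blk (φ (f n).1) = blk (φ (f n').1) → n = n') ∧
      ∀ n, S.C (φ (f n).1) (φ (f n).2) ↔ if n % 2 = 0 then S.R a (Nat.pair (col a) (n / 2)) else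
        S.R b (Nat.pair (col b) (n / 2)) := by
    intro x hx ha hb
    obtain ⟨φ, hφ, rfl, -⟩ := exists_deg_eq hx
    obtain ⟨P, hP, hPp⟩ := exists_select_of_ydeg_le ha
    obtain ⟨P', hP', hPp'⟩ := exists_select_of_ydeg_le hb
    obtain ⟨f, hf, -, h⟩ := exists_pieces (S := S) hφ
      (P := fun x => if x.1 % 2 = 0 then P (x.1 / 2, x.2) else P' (x.1 / 2, x.2)) (by fun_prop)
      (Q := fun n => if n % 2 = 0 then S.R a (Nat.pair (col a) (n / 2)) else
        S.R b (Nat.pair (col b) (n / 2))) (fun n k => by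
        by_cases hn : n % 2 = 0
        · simp only [if_pos hn]
          exact hPp _ _
        · simp only [if_neg hn]
          exact hPp' _ _) 0
    exact ⟨φ, hφ, f, rfl, hf, h⟩
  obtain ⟨φ, hφ, f, rfl, hf, hb, hi, hQ⟩ := key hx hax hbx
  obtain ⟨φ', hφ', f', rfl, hf', hb', hi', hQ'⟩ := key hy hay hby
  have hz : Computable (zig (fun n => φ (f n).1) (fun n => φ (f n).2) id) :=
    computable_zig (by fun_prop) (by fun_prop) Computable.id
  have hz' : Computable (zig (fun n => φ' (f' n).1) (fun n => φ' (f' n).2) id) :=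
    computable_zig (by fun_prop) (by fun_prop) Computable.id
  have hle : ∀ {φ : ℕ → ℕ} (hφ : Computable φ) (f : ℕ → ℕ × ℕ)
      (hz : Computable (zig (fun n => φ (f n).1) (fun n => φ (f n).2) id)),
      S.deg _ hz ≤ S.deg φ hφ := fun {φ} hφ f hz =>
    deg_le_deg.2 (reducible_pull hz hφ fun x => by
      rcases zig_eq (fun n => φ (f n).1) (fun n => φ (f n).2) id x with h | h
      · exact ⟨_, by rw [h]⟩
      · exact ⟨_, by rw [h]⟩).reducibleI
  refine ⟨S.deg _ hz, ?_, ?_, hle hφ f hz, ?_⟩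
  · refine ydeg_le_of_pieces (f := fun n => (2 * (2 * n), 2 * (2 * n) + 1)) (by fun_prop) ?_ ?_ ?_
    · intro n
      simp only [zig_even, zig_odd, id, hb]
    · intro n n' h
      simp only [zig_even, id] at h
      have := hi _ _ h
      omega
    · intro n
      simp only [zig_even, zig_odd, id, hQ]
      rw [if_pos (by omega), show 2 * n / 2 = n by omega]
  · refine ydeg_le_of_pieces (f := fun n => (2 * (2 * n + 1), 2 * (2 * n + 1) + 1)) (by fun_prop)
      ?_ ?_ ?_
    · intro n
      simp only [zig_even, zig_odd, id, hb]
    · intro n n' h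
      simp only [zig_even, id] at h
      have := hi _ _ h
      omega
    · intro n
      simp only [zig_even, zig_odd, id, hQ]
      rw [if_neg (by omega), show (2 * n + 1) / 2 = n by omega]
  · rw [deg_congr (hψ := hz') (pull_zig_congr hb hi hb' hi' fun n => by rw [hQ, hQ'])]
    exact hle hφ' f' hz'

/-- Two degrees above `ydeg a` and `vdeg c` have a common lower bound above both of these. -/
theorem exists_between_ydeg_vdeg {a c : ℕ} {x y : IDegree} (hx : x ≤ S.deg id Computable.id)
    (hy : y ≤ S.deg id Computable.id) (hax : S.ydeg a ≤ x) (hay : S.ydeg a ≤ y)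
    (hcx : S.vdeg c ≤ x) (hcy : S.vdeg c ≤ y) :
    ∃ j, S.ydeg a ≤ j ∧ S.vdeg c ≤ j ∧ j ≤ x ∧ j ≤ y := by
  -- A whole side of type `c` is extracted together with pairs coding the class of `a` in blocks
  -- beyond it. Again the relation depends only on `a` and `c`.
  have key : ∀ {x : IDegree}, x ≤ S.deg id Computable.id → S.ydeg a ≤ x → S.vdeg c ≤ x →
      ∃ (φ : ℕ → ℕ) (hφ : Computable φ) (f : ℕ → ℕ × ℕ) (κ : ℕ → ℕ) (ρ : Side),
      x = S.deg φ hφ ∧ Computable f ∧ Computable κ ∧ styp ρ = c ∧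
      (∀ y, S.C (φ (κ y)) (elt ρ y)) ∧ (∀ n, 2 * ρ.1 + 1 < blk (φ (f n).1)) ∧
      (∀ n, blk (φ (f n).1) = blk (φ (f n).2)) ∧
      (∀ n n', blk (φ (f n).1) = blk (φ (f n').1) → n = n') ∧
      ∀ n, S.C (φ (f n).1) (φ (f n).2) ↔ S.R a (Nat.pair (col a) n) := by
    intro x hx ha hc
    obtain ⟨φ, hφ, rfl, -⟩ := exists_deg_eq hx
    obtain ⟨P, hP, hPp⟩ := exists_select_of_ydeg_le ha
    obtain ⟨ρ, hρ, hit⟩ := exists_hits_of_le (σ := diag c) (τ := diag c) hc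
    rw [styp_diag] at hρ
    obtain ⟨κ, hκ, hκp⟩ := exists_computable_select (p := fun y x => S.C (φ x) (elt ρ y))
      (by fun_prop) hit
    obtain ⟨f, hf, h⟩ := exists_pieces (S := S) hφ hP hPp (2 * ρ.1 + 1)
    exact ⟨φ, hφ, f, κ, ρ, rfl, hf, hκ, hρ, hκp, h⟩
  obtain ⟨φ, hφ, f, κ, ρ, rfl, hf, hκ, hρ, hκp, hM, hb, hi, hQ⟩ := key hx hax hcx
  obtain ⟨φ', hφ', f', κ', ρ', rfl, hf', hκ', hρ', hκp', hM', hb', hi', hQ'⟩ := key hy hay hcy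
  have hz : Computable (asm (fun n => φ (κ n)) (fun n => φ (f n).1) (fun n => φ (f n).2)) :=
    computable_asm (by fun_prop) (by fun_prop) (by fun_prop)
  have hz' : Computable (asm (fun n => φ' (κ' n)) (fun n => φ' (f' n).1)
    (fun n => φ' (f' n).2)) := computable_asm (by fun_prop) (by fun_prop) (by fun_prop)
  have hle : ∀ {φ : ℕ → ℕ} (hφ : Computable φ) (κ : ℕ → ℕ) (f : ℕ → ℕ × ℕ)
      (hz : Computable (asm (fun n => φ (κ n)) (fun n => φ (f n).1) (fun n => φ (f n).2))),
      S.deg _ hz ≤ S.deg φ hφ := fun {φ} hφ κ f hz =>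
    deg_le_deg.2 (reducible_pull hz hφ fun x => by
      unfold asm
      split_ifs
      · exact ⟨_, S.C.refl' _⟩
      · rcases zig_eq (fun n => φ (f n).1) (fun n => φ (f n).2) id (x / 2) with h | h
        · exact ⟨_, by rw [h]⟩
        · exact ⟨_, by rw [h]⟩).reducibleI
  have hblk : ∀ {φ κ : ℕ → ℕ} {ρ : Side}, (∀ y, S.C (φ (κ y)) (elt ρ y)) →
      ∀ y, blk (φ (κ y)) ≤ 2 * ρ.1 + 1 := fun h y => by rw [blk_eq_of_C (h y), blk_elt]
  have hcore : ∀ {φ κ : ℕ → ℕ} {ρ : Side}, (∀ y, S.C (φ (κ y)) (elt ρ y)) → styp ρ = c →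
      ∀ x y, S.C (φ (κ x)) (φ (κ y)) ↔ S.R (Nat.pair c x) (Nat.pair c y) := by
    intro φ κ ρ h hρ x y
    rw [← hρ, ← C_elt_same]
    exact ⟨fun h1 => S.C.trans' (S.C.symm' (h x)) (S.C.trans' h1 (h y)),
      fun h1 => S.C.trans' (h x) (S.C.trans' h1 (S.C.symm' (h y)))⟩
  have hya : S.ydeg a ≤ S.deg _ hz := by
    refine ydeg_le_of_pieces (f := fun n => (2 * (2 * n) + 1, 2 * (2 * n + 1) + 1)) (by fun_prop)
      ?_ ?_ ?_
    · intro n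
      simp only [asm_odd, zig_even, zig_odd, id, hb]
    · intro n n' h
      simp only [asm_odd, zig_even, id] at h
      exact hi _ _ h
    · intro n
      simp only [asm_odd, zig_even, zig_odd, id, hQ]
  refine ⟨S.deg _ hz, hya, ?_, hle hφ κ f hz, ?_⟩
  · have hl := isLight_iff.2 ((isLight_iff.1 (isLight_ydeg a)).trans hya)
    rw [← hρ, ← sideDeg_self]
    have hit : Hits S (asm (fun n => φ (κ n)) (fun n => φ (f n).1) (fun n => φ (f n).2)) ρ :=
      fun y => ⟨2 * y, by rw [asm_even]; exact hκp y⟩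
    exact sideDeg_le_of_hits hit hit (isLight_deg_iff.1 hl)
  · rw [deg_congr (hψ := hz') (pull_asm_congr (hblk hκp) hM hb hi (hblk hκp') hM' hb' hi'
      (fun x y => by rw [hcore hκp hρ, hcore hκp' hρ']) fun n => by rw [hQ, hQ'])]
    exact hle hφ' κ' f' hz'

theorem _root_.CeerDegrees.IsLightStronglyMinimalCover.eq_of_le {a d e j : IDegree}
    (h : IsLightStronglyMinimalCover a d e) (hd : IDegree.IsLight d) (he : IDegree.IsLight e)
    (hdj : d ≤ j) (hej : e ≤ j) (hj : j ≤ a) : j = a := by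
  obtain ⟨-, hde, -, -, hx⟩ := h
  by_contra hne
  have hjl := isLight_iff.2 ((isLight_iff.1 hd).trans hdj)
  rcases hx j hjl (lt_of_le_of_ne hj hne) with rfl | rfl | rfl
  · exact hde.2 hej
  · exact hde.1 hdj
  · exact hde.1 (hdj.trans (isLight_iff.1 he))

/-- There are no edges at the vertex `ydeg a`. -/
theorem not_incompRel_of_isCover {a : ℕ} {e x y : IDegree} (he : IsLightMinimal e)
    (htop : e ≤ S.deg id Computable.id) (hx : x ≤ S.deg id Computable.id)
    (hy : y ≤ S.deg id Computable.id) (hcx : IsLightStronglyMinimalCover x (S.ydeg a) e)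
    (hcy : IsLightStronglyMinimalCover y (S.ydeg a) e) : ¬ IncompRel (· ≤ ·) x y := by
  have hj : ∃ j, S.ydeg a ≤ j ∧ e ≤ j ∧ j ≤ x ∧ j ≤ y := by
    rcases eq_vdeg_or_ydeg he htop with ⟨c, rfl⟩ | ⟨b, rfl⟩
    · exact exists_between_ydeg_vdeg hx hy hcx.2.2.1.le hcy.2.2.1.le hcx.2.2.2.1.le
        hcy.2.2.2.1.le
    · exact exists_between_ydeg_ydeg hx hy hcx.2.2.1.le hcy.2.2.1.le hcx.2.2.2.1.le
        hcy.2.2.2.1.le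
  obtain ⟨j, h1, h2, h3, h4⟩ := hj
  have e1 := hcx.eq_of_le (isLight_ydeg a) he.1 h1 h2 h3
  have e2 := hcy.eq_of_le (isLight_ydeg a) he.1 h1 h2 h4
  exact fun h => h.1 (e1.symm.trans e2).le

/-- Adjacency in the graph below the top degree. -/
theorem adj_iff (v w : LightVertex (S.deg id Computable.id)) :
    (lightGraph (S.deg id Computable.id)).Adj v w ↔
      ∃ c d, v.1 = S.vdeg c ∧ w.1 = S.vdeg d ∧ S.E c d := by
  constructor
  · rintro ⟨x, y, hx, hy, hi, hcx, hcy⟩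
    have sw : ∀ {a d e : IDegree}, IsLightStronglyMinimalCover a d e →
        IsLightStronglyMinimalCover a e d := fun ⟨ha, hde, hd, he, h⟩ =>
      ⟨ha, hde.symm, he, hd, fun x hx hxa => or_left_comm.1 (h x hx hxa)⟩
    rcases eq_vdeg_or_ydeg v.2.1 v.2.2 with ⟨c, hc⟩ | ⟨a, ha⟩
    · rcases eq_vdeg_or_ydeg w.2.1 w.2.2 with ⟨d, hd⟩ | ⟨a, ha⟩
      · refine ⟨c, d, hc, hd, ?_⟩
        by_contra hE
        rw [hc, hd] at hcx hcy
        obtain ⟨σ, τ, hσ, hτ, rfl⟩ := eq_sideDeg_of_isCover hx hcx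
        obtain ⟨σ', τ', hσ', hτ', rfl⟩ := eq_sideDeg_of_isCover hy hcy
        have hne : c ≠ d := by
          rintro rfl
          exact hcx.2.1.1 le_rfl
        -- Distinct types in one block force opposite sides, so a glued pair would give `E c d` or
        -- `E d c`. Both covers are therefore unglued and coincide.
        have hgl : ∀ {σ τ : Side}, styp σ = c → styp τ = d → σ.1 = τ.1 → ¬ S.Glued σ := by
          rintro ⟨q, s⟩ ⟨q', t⟩ rfl rfl rfl hG
          simp only [styp] at hE hne
          cases s <;> cases t <;> simp_all [Glued]
          exact hE (S.symm _ _ hG)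
        exact hi.1 (sideDeg_congr (hσ.trans hσ'.symm) (hτ.trans hτ'.symm)
          (by rw [hσ, hτ]; exact hne) (hgl hσ hτ) (hgl hσ' hτ')).le
      · rw [ha] at hcx hcy
        exact (not_incompRel_of_isCover v.2.1 v.2.2 hx hy (sw hcx) (sw hcy) hi).elim
    · rw [ha] at hcx hcy
      exact (not_incompRel_of_isCover w.2.1 w.2.2 hx hy hcx hcy hi).elim
  · rintro ⟨c, d, hc, hd, hE⟩
    have hne : c ≠ d := by
      rintro rfl
      exact S.irrefl _ hE
    have h2 : styp (Nat.pair c d, false) = c := by simp [styp]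
    have h3 : styp (Nat.pair c d, true) = d := by simp [styp]
    refine ⟨_, _, sideDeg_le_top, sideDeg_le_top, incompRel_sideDeg hne hE, ?_, ?_⟩
    · have := isCover_sideDeg (S := S) (σ := diag c) (τ := diag d) (by simpa [styp_diag] using hne)
      rw [styp_diag, styp_diag] at this
      rwa [hc, hd]
    · have := isCover_sideDeg (S := S) (σ := (Nat.pair c d, false)) (τ := (Nat.pair c d, true))
        (by rwa [h2, h3])
      rw [h2, h3] at this
      rwa [hc, hd]

end Setup
end CeerDegrees

/-! ### Coding the given graph -/

theorem mainTheorem7 (V : Set ℕ) (G : SimpleGraph V) (hG : CeerDegrees.IsComputableGraph G) :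
    ∃ c : CeerDegrees.IDegree, CeerDegrees.IDegree.IsLight c ∧
      ∃ (W : Type) (_ : Nonempty W),
        Nonempty (CeerDegrees.lightGraph c ≃g (G ⊕g (⊥ : SimpleGraph W))) := by
  open CeerDegrees Setup in
  obtain ⟨-, hE⟩ := hG
  obtain ⟨R, hR⟩ := exists_isGeneric
  -- A vertex `x` of `G` is represented by column `x + 1`. Column `0` is kept isolated, so the
  -- edgeless summand is nonempty.
  let E : ℕ → ℕ → Prop := fun c d => (0 < c ∧ 0 < d) ∧
    ∃ (h₁ : c - 1 ∈ V) (h₂ : d - 1 ∈ V), G.Adj ⟨c - 1, h₁⟩ ⟨d - 1, h₂⟩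
  have hEc : ComputablePred fun p : ℕ × ℕ => E p.1 p.2 :=
    computablePred_and (by fun_prop)
      (computablePred_comp (f := fun p : ℕ × ℕ => (p.1 - 1, p.2 - 1)) hE (by fun_prop))
  let S : Setup := ⟨R, hR, E, hEc, fun c ⟨_, _, _, h⟩ => G.irrefl h,
    fun c d ⟨h, h₁, h₂, ha⟩ => ⟨h.symm, h₂, h₁, ha.symm⟩⟩
  have hS : ∀ x y, S.E (x + 1) (y + 1) ↔ ∃ (h₁ : x ∈ V) (h₂ : y ∈ V), G.Adj ⟨x, h₁⟩ ⟨y, h₂⟩ :=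
    fun x y => ⟨fun h => h.2, fun h => ⟨⟨by omega, by omega⟩, h⟩⟩
  have hinj : ∀ {c d}, S.vdeg c = S.vdeg d → c = d := fun h => vdeg_le_iff.1 h.le
  let vert : ℕ → LightVertex (S.deg id Computable.id) := fun c =>
    ⟨S.vdeg c, isLightMinimal_vdeg c, sideDeg_le_top⟩
  let W : Type := {v : LightVertex (S.deg id Computable.id) // ∀ x ∈ V, v ≠ vert (x + 1)}
  refine ⟨S.deg id Computable.id, isLight_deg_iff.2 fun n => ⟨2 * n, ?_⟩, W, ⟨vert 0, ?_⟩, ⟨?_⟩⟩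
  · simp
    omega
  · intro x _ h
    have := hinj (congrArg Subtype.val h)
    omega
  · let f : V ⊕ W → LightVertex (S.deg id Computable.id) :=
      Sum.elim (fun x => vert (x.1 + 1)) Subtype.val
    have hf : Function.Bijective f := by
      constructor
      · rintro (x | x) (y | y) h
        · have := hinj (congrArg Subtype.val h)
          exact congrArg Sum.inl (Subtype.ext (by omega))
        · exact (y.2 x.1 x.2 h.symm).elim
        · exact (x.2 y.1 y.2 h).elim
        · exact congrArg Sum.inr (Subtype.ext h)
      · intro v
        by_cases h : ∀ x ∈ V, v ≠ vert (x + 1)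
        · exact ⟨Sum.inr ⟨v, h⟩, rfl⟩
        · push Not at h
          obtain ⟨x, hx, rfl⟩ := h
          exact ⟨Sum.inl ⟨x, hx⟩, rfl⟩
    have hout : ∀ w : W, ∀ c d, w.1.1 = S.vdeg c → ¬ S.E c d := by
      rintro w c d hc ⟨⟨h0, -⟩, h1, -, -⟩
      refine w.2 _ h1 (Subtype.ext ?_)
      rw [hc]
      change _ = S.vdeg (c - 1 + 1)
      rw [Nat.sub_add_cancel h0]
    refine RelIso.symm ⟨Equiv.ofBijective f hf, ?_⟩
    rintro (x | x) (y | y)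
    · refine (adj_iff _ _).trans ⟨?_, fun h => ⟨_, _, rfl, rfl, (hS _ _).2 ⟨x.2, y.2, h⟩⟩⟩
      rintro ⟨c, d, hc, hd, h⟩
      obtain rfl := hinj hc
      obtain rfl := hinj hd
      exact ((hS _ _).1 h).2.2
    · refine iff_of_false (fun h => ?_) (by simp)
      obtain ⟨c, d, hc, hd, h⟩ := (adj_iff _ _).1 h
      exact hout y d c hd (S.symm _ _ h)
    · refine iff_of_false (fun h => ?_) (by simp)
      obtain ⟨c, d, hc, hd, h⟩ := (adj_iff _ _).1 h
      exact hout x c d hc h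
    · refine iff_of_false (fun h => ?_) (by simp)
      obtain ⟨c, d, hc, hd, h⟩ := (adj_iff _ _).1 h
      exact hout x c d hc h
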